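/- Let $\mathfrak n$ be a real two-step nilpotent Lie algebra with a basis $Z_1,\dots,Z_r,Y_1,\dots,Y_d,X_1,\dots,X_d$ ($d\ge 1$) such that the $Z_i$ span the center $\mathfrak z$, $[\mathfrak n,\mathfrak n]\subseteq\mathfrak z$, $[Y_i,Y_j]=[X_i,X_j]=0$ for all $i,j$, and for some linear functional $\ell$ on $\mathfrak n$ the stabilizer $\{u:\ell[u,v]=0\ \forall v\}$ equals $\mathfrak z$. Let $N=\exp\mathfrak n$ be the connected, simply connected Lie group of $\mathfrak n$, with Haar measure $dn=dz\,dy\,dx$ in the coordinates $n=\exp(\sum z_iZ_i)\exp(\sum y_iY_i)\exp(\sum x_iX_i)$, and let $L$ be the left regular representation on $L^2(N)$. For $\lambda\in\mathbb R^r\cong\mathfrak z^*$, extended by $0$ to the $Y_i$ and $X_i$, let $B(\lambda)=(-\lambda[X_i,Y_j])_{i,j}$, and let $V(\lambda)$ be the matrix of the form $(u,v)\mapsto\lambda[u,v]$ on $Y_1,\dots,Y_d,X_1,\dots,X_d$; put $\Sigma=\{\lambda:\det V(\lambda)\ne0\}$, where $\det V(\lambda)=(\det B(\lambda))^2$. For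 $\lambda\in\Sigma$ let $\pi_\lambda$ be the irreducible representation of $N$ on $L^2(\mathbb R^d)$ given, for $n$ with coordinates $(z,y,x)$, by $(\pi_\lambda(n)F)(t)=e^{2\pi i\langle\lambda,z\rangle}e^{2\pi i\langle t,B(\lambda)y\rangle}F(t-x)$. Let $\mathcal P:L^2(N)\to\int_\Sigma^\oplus L^2(\mathbb R^d)\otimes L^2(\mathbb R^d)\,d\mu(\lambda)$, $d\mu(\lambda)=|\det B(\lambda)|\,d\lambda$, be the Plancherel transform, i.e. the continuous extension of $f\mapsto\big(\int_N f(n)\pi_\lambda(n)\,dn\big)_\lambda$ from $L^1(N)\cap L^2(N)$, where $L^2(\mathbb R^d)\otimes L^2(\mathbb R^d)$ is the space of Hilbert--Schmidt operators on $L^2(\mathbb R^d)$, with $f\otimes u:\psi\mapsto\langle\psi,u\rangle f$. Let $\mathbf I\subseteq\Sigma$ be bounded and measurable, let $(P_\lambda)_{\lambda\in\mathbf I}$ be a measurable field of orthogonal projections of $L^2(\mathbb R^d)$, let $m(\lambda)=\operatorname{rank}P_\lambda\in\mathbb N\cup\{0,\infty\}$, and let $\mathcal K\subseteq L^2(N)$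 be the band-limited subspace with $$\mathcal P(\mathcal K)=\int_{\mathbf I}^\oplus L^2(\mathbb R^d)\otimes P_\lambda\big(L^2(\mathbb R^d)\big)\,d\mu(\lambda).$$ Let $a\in(0,\infty)^r$ and $q,b\in(0,\infty)^d$, and let $$\Gamma_{a,q,b}=\Big\{\prod_{j=1}^r\exp\big(\tfrac{m_j}{a_j}Z_j\big)\prod_{j=1}^d\exp\big(\tfrac{k_j}{q_j}Y_j\big)\prod_{j=1}^d\exp\big(\tfrac{n_j}{b_j}X_j\big):m_j,k_j,n_j\in\mathbb Z\Big\}.$$ Suppose that $\phi\in\mathcal K$ is a continuous wavelet, i.e. $\psi\mapsto\langle\psi,L(\cdot)\phi\rangle$ is an isometry of $\mathcal K$ into $L^2(N)$, and that $\{L(\gamma)\phi\}_{\gamma\in\Gamma_{a,q,b}}$ is a Parseval frame of $\mathcal K$. Then $$m(\lambda)\le\frac1{a_1\cdots a_r\,|\det B(\lambda)|}\quad\text{for almost every }\lambda\in\mathbf I,\qquad\text{and}\qquad\|\phi\|^2\le\int_{\mathbf I}b_1\cdots b_d\,q_1\cdots q_d\,d\lambda.$$ -/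

import Mathlib

open MeasureTheory Filter Topology
open scoped ENNReal Matrix ComplexConjugate

noncomputable section

namespace TwoStep

/-- A basis `Z₁, …, Z_r, Y₁, …, Y_d, X₁, …, X_d` of a real Lie algebra `𝔫` as in the class of
two-step nilpotent Lie algebras under consideration: `𝔫` is two-step, the `Z`'s span the center,
the `Z`'s and `Y`'s span a commutative ideal `𝔭`, the `X`'s span a commutative subalgebra `𝔪`,
and the stabilizer `𝔫(l) = {u | l [u, v] = 0 for all v}` of some (hence of a generic) linear
functional `l` is the center. -/
structure AdaptedBasis (𝔫 : Type*) [LieRing 𝔫] [LieAlgebra ℝ 𝔫] (r d : ℕ) where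
  basis : Module.Basis (Fin r ⊕ Fin d ⊕ Fin d) ℝ 𝔫
  two_step : ∀ u v : 𝔫, ⁅u, v⁆ ∈ LieAlgebra.center ℝ 𝔫
  span_Z : Submodule.span ℝ (Set.range fun i => basis (Sum.inl i)) =
    (LieAlgebra.center ℝ 𝔫).toSubmodule
  lie_Y_Y : ∀ i j, ⁅basis (Sum.inr (Sum.inl i)), basis (Sum.inr (Sum.inl j))⁆ = 0
  lie_X_X : ∀ i j, ⁅basis (Sum.inr (Sum.inr i)), basis (Sum.inr (Sum.inr j))⁆ = 0
  generic : ∃ l : Module.Dual ℝ 𝔫, ∀ u : 𝔫, (∀ v : 𝔫, l ⁅u, v⁆ = 0) →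
    u ∈ LieAlgebra.center ℝ 𝔫

universe u

variable {𝔫 : Type u} [LieRing 𝔫] [LieAlgebra ℝ 𝔫] {r d : ℕ}

namespace AdaptedBasis

/-- `z₁ Z₁ + ⋯ + z_r Z_r`. -/
def Z (e : AdaptedBasis 𝔫 r d) (z : Fin r → ℝ) : 𝔫 := ∑ i, z i • e.basis (Sum.inl i)

/-- `y₁ Y₁ + ⋯ + y_d Y_d`. -/
def Y (e : AdaptedBasis 𝔫 r d) (y : Fin d → ℝ) : 𝔫 := ∑ i, y i • e.basis (Sum.inr (Sum.inl i))

/-- `x₁ X₁ + ⋯ + x_d X_d`. -/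
def X (e : AdaptedBasis 𝔫 r d) (x : Fin d → ℝ) : 𝔫 := ∑ i, x i • e.basis (Sum.inr (Sum.inr i))

/-- The linear functional `(l₁, …, l_r, 0, …, 0)` on `𝔫`, in coordinates with respect to the
dual basis. -/
def functional (e : AdaptedBasis 𝔫 r d) (l : Fin r → ℝ) (u : 𝔫) : ℝ :=
  ∑ i, l i * e.basis.repr u (Sum.inl i)

/-- The matrix `B(l)` with entries `-l [X_i, Y_j]`. -/
def B (e : AdaptedBasis 𝔫 r d) (l : Fin r → ℝ) : Matrix (Fin d) (Fin d) ℝ :=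
  Matrix.of fun i j =>
    -e.functional l ⁅e.basis (Sum.inr (Sum.inr i)), e.basis (Sum.inr (Sum.inl j))⁆

/-- The skew-symmetric matrix `V(l)` of the form `(u, v) ↦ l [u, v]` on the non-central basis
vectors `Y₁, …, Y_d, X₁, …, X_d`. -/
def V (e : AdaptedBasis 𝔫 r d) (l : Fin r → ℝ) :
    Matrix (Fin d ⊕ Fin d) (Fin d ⊕ Fin d) ℝ :=
  Matrix.of fun i j => e.functional l ⁅e.basis (Sum.inr i), e.basis (Sum.inr j)⁆

/-- The cross-section `Σ` of the generic coadjoint orbits, as a subset of `𝔷(𝔫)* = ℝ^r`. -/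
def crossSection (e : AdaptedBasis 𝔫 r d) : Set (Fin r → ℝ) := {l | (e.V l).det ≠ 0}

end AdaptedBasis

/-- The connected, simply connected Lie group `N = exp 𝔫` of the two-step nilpotent Lie algebra
`𝔫`: the exponential map is a bijection, and the product is given by the
Baker-Campbell-Hausdorff formula `exp u * exp v = exp (u + v + [u, v] / 2)`. -/
@[ext] structure NilGroup (e : AdaptedBasis 𝔫 r d) where
  exp ::
  log : 𝔫

namespace NilGroup

variable {e : AdaptedBasis 𝔫 r d}

instance : Mul (NilGroup e) := ⟨fun g h => exp (g.log + h.log + (1 / 2 : ℝ) • ⁅g.log, h.log⁆)⟩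
instance : One (NilGroup e) := ⟨exp 0⟩
instance : Inv (NilGroup e) := ⟨fun g => exp (-g.log)⟩

theorem log_mul (g h : NilGroup e) :
    (g * h).log = g.log + h.log + (1 / 2 : ℝ) • ⁅g.log, h.log⁆ := rfl
theorem log_one : (1 : NilGroup e).log = 0 := rfl
theorem log_inv (g : NilGroup e) : (g⁻¹).log = -g.log := rfl

theorem central_lie {c : 𝔫} (hc : c ∈ LieAlgebra.center ℝ 𝔫) (u : 𝔫) : ⁅u, c⁆ = 0 :=
  (LieModule.mem_maxTrivSubmodule ℝ 𝔫 𝔫 c).1 hc u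

theorem lie_central {c : 𝔫} (hc : c ∈ LieAlgebra.center ℝ 𝔫) (u : 𝔫) : ⁅c, u⁆ = 0 := by
  rw [← lie_skew, central_lie hc, neg_zero]

theorem lie_lie_right (e : AdaptedBasis 𝔫 r d) (u v w : 𝔫) : ⁅u, ⁅v, w⁆⁆ = 0 :=
  central_lie (e.two_step v w) u

theorem lie_lie_left (e : AdaptedBasis 𝔫 r d) (u v w : 𝔫) : ⁅⁅u, v⁆, w⁆ = 0 :=
  lie_central (e.two_step u v) w

instance : Group (NilGroup e) :=
  Group.ofLeftAxioms
    (fun a b c => by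
      ext
      simp only [log_mul, lie_add, add_lie, lie_smul, smul_lie, lie_lie_right e, lie_lie_left e,
        smul_zero, add_zero, smul_add]
      abel)
    (fun a => by ext; simp [log_mul, log_one])
    (fun a => by ext; simp [log_mul, log_one, log_inv])

theorem repr_central (e : AdaptedBasis 𝔫 r d) {c : 𝔫} (hc : c ∈ LieAlgebra.center ℝ 𝔫)
    (j : Fin d ⊕ Fin d) : e.basis.repr c (Sum.inr j) = 0 := by
  have h : Submodule.span ℝ (Set.range fun i => e.basis (Sum.inl i)) ≤
      LinearMap.ker (e.basis.coord (Sum.inr j)) := by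
    rw [Submodule.span_le]
    rintro _ ⟨i, rfl⟩
    simp
  rw [e.span_Z] at h
  simpa using h hc

theorem Z_central (e : AdaptedBasis 𝔫 r d) (z : Fin r → ℝ) :
    e.Z z ∈ LieAlgebra.center ℝ 𝔫 := by
  have h : e.Z z ∈ Submodule.span ℝ (Set.range fun i => e.basis (Sum.inl i)) :=
    Submodule.sum_mem _ fun i _ => Submodule.smul_mem _ _ (Submodule.subset_span ⟨i, rfl⟩)
  rw [e.span_Z] at h
  exact h

theorem lie_Y_Y (e : AdaptedBasis 𝔫 r d) (y y' : Fin d → ℝ) : ⁅e.Y y, e.Y y'⁆ = 0 := by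
  simp [AdaptedBasis.Y, sum_lie, lie_sum, e.lie_Y_Y]

theorem lie_X_X (e : AdaptedBasis 𝔫 r d) (x x' : Fin d → ℝ) : ⁅e.X x, e.X x'⁆ = 0 := by
  simp [AdaptedBasis.X, sum_lie, lie_sum, e.lie_X_X]

theorem Z_add (e : AdaptedBasis 𝔫 r d) (z z' : Fin r → ℝ) : e.Z (z + z') = e.Z z + e.Z z' := by
  simp [AdaptedBasis.Z, add_smul, Finset.sum_add_distrib]

theorem Y_add (e : AdaptedBasis 𝔫 r d) (y y' : Fin d → ℝ) : e.Y (y + y') = e.Y y + e.Y y' := by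
  simp [AdaptedBasis.Y, add_smul, Finset.sum_add_distrib]

theorem X_add (e : AdaptedBasis 𝔫 r d) (x x' : Fin d → ℝ) : e.X (x + x') = e.X x + e.X x' := by
  simp [AdaptedBasis.X, add_smul, Finset.sum_add_distrib]

theorem Y_zero (e : AdaptedBasis 𝔫 r d) : e.Y 0 = 0 := by simp [AdaptedBasis.Y]

theorem X_zero (e : AdaptedBasis 𝔫 r d) : e.X 0 = 0 := by simp [AdaptedBasis.X]

theorem eq_Z_add_Y_add_X (e : AdaptedBasis 𝔫 r d) (u : 𝔫) :
    u = e.Z (fun i => e.basis.repr u (Sum.inl i))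
      + e.Y (fun i => e.basis.repr u (Sum.inr (Sum.inl i)))
      + e.X (fun i => e.basis.repr u (Sum.inr (Sum.inr i))) := by
  have h := e.basis.sum_repr u
  rw [Fintype.sum_sum_type, Fintype.sum_sum_type, ← add_assoc] at h
  exact h.symm

theorem repr_Z_add_Y_add_X (e : AdaptedBasis 𝔫 r d) (z : Fin r → ℝ) (y x : Fin d → ℝ) :
    e.basis.repr (e.Z z + e.Y y + e.X x) =
      Finsupp.equivFunOnFinite.symm (Sum.elim z (Sum.elim y x)) := by
  ext (i | i | i) <;>
    simp [AdaptedBasis.Z, AdaptedBasis.Y, AdaptedBasis.X, Finsupp.single_apply]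

/-- Coordinates on `N`: the element `exp (∑ z_i Z_i) * exp (∑ y_i Y_i) * exp (∑ x_i X_i)`. -/
def ofCoords (e : AdaptedBasis 𝔫 r d) (p : (Fin r → ℝ) × (Fin d → ℝ) × (Fin d → ℝ)) :
    NilGroup e :=
  exp (e.Z p.1) * exp (e.Y p.2.1) * exp (e.X p.2.2)

/-- The coordinates `(z, y, x)` of `exp (∑ z_i Z_i) * exp (∑ y_i Y_i) * exp (∑ x_i X_i)`. -/
def coords (g : NilGroup e) : (Fin r → ℝ) × (Fin d → ℝ) × (Fin d → ℝ) :=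
  let y : Fin d → ℝ := fun i => e.basis.repr g.log (Sum.inr (Sum.inl i))
  let x : Fin d → ℝ := fun i => e.basis.repr g.log (Sum.inr (Sum.inr i))
  (fun i => e.basis.repr (g.log - (1 / 2 : ℝ) • ⁅e.Y y, e.X x⁆) (Sum.inl i), y, x)

theorem log_ofCoords (e : AdaptedBasis 𝔫 r d)
    (p : (Fin r → ℝ) × (Fin d → ℝ) × (Fin d → ℝ)) :
    (ofCoords e p).log =
      e.Z p.1 + e.Y p.2.1 + e.X p.2.2 + (1 / 2 : ℝ) • ⁅e.Y p.2.1, e.X p.2.2⁆ := by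
  simp [ofCoords, log_mul, lie_central (Z_central e p.1)]

/-- The vector of structure constants `[∑ x_i X_i, ∑ y_j Y_j] = ∑ c_i Z_i`. -/
def bracketXY (e : AdaptedBasis 𝔫 r d) (x y : Fin d → ℝ) : Fin r → ℝ :=
  fun i => e.basis.repr ⁅e.X x, e.Y y⁆ (Sum.inl i)

theorem Z_bracketXY (e : AdaptedBasis 𝔫 r d) (x y : Fin d → ℝ) :
    e.Z (bracketXY e x y) = ⁅e.X x, e.Y y⁆ := by
  conv_rhs => rw [eq_Z_add_Y_add_X e ⁅e.X x, e.Y y⁆]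
  simp only [repr_central e (e.two_step _ _)]
  have h0 : (fun _ => 0 : Fin d → ℝ) = 0 := rfl
  simp only [h0, Y_zero, X_zero, add_zero]
  rfl

theorem coords_ofCoords (p : (Fin r → ℝ) × (Fin d → ℝ) × (Fin d → ℝ)) :
    coords (ofCoords e p) = p := by
  have hr : ∀ j, e.basis.repr (ofCoords e p).log (Sum.inr j) = Sum.elim p.2.1 p.2.2 j := by
    intro j
    rw [log_ofCoords, map_add, repr_Z_add_Y_add_X]
    simp [repr_central e (e.two_step _ _)]
  have h1 : (fun i => e.basis.repr (ofCoords e p).log (Sum.inr (Sum.inl i))) = p.2.1 := by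
    ext i; simp [hr]
  have h2 : (fun i => e.basis.repr (ofCoords e p).log (Sum.inr (Sum.inr i))) = p.2.2 := by
    ext i; simp [hr]
  simp only [coords, h1, h2]
  refine Prod.ext ?_ rfl
  ext i
  rw [log_ofCoords, add_sub_cancel_right, repr_Z_add_Y_add_X]
  simp

theorem ofCoords_coords (g : NilGroup e) : ofCoords e (coords g) = g := by
  ext
  rw [log_ofCoords]
  set w := (1 / 2 : ℝ) • ⁅e.Y (coords g).2.1, e.X (coords g).2.2⁆ with hw
  have h := eq_Z_add_Y_add_X e (g.log - w)
  have hr : ∀ j, e.basis.repr (g.log - w) (Sum.inr j) = e.basis.repr g.log (Sum.inr j) := by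
    intro j
    rw [hw, map_sub, map_smul]
    simp [repr_central e (e.two_step _ _)]
  simp only [hr] at h
  exact (sub_eq_iff_eq_add.1 h).symm

/-- The coordinates of the second kind as a bijection onto `N`. -/
def coordsEquiv (e : AdaptedBasis 𝔫 r d) :
    NilGroup e ≃ (Fin r → ℝ) × (Fin d → ℝ) × (Fin d → ℝ) where
  toFun := coords
  invFun := ofCoords e
  left_inv := ofCoords_coords
  right_inv := coords_ofCoords

theorem ofCoords_mul (e : AdaptedBasis 𝔫 r d)
    (p p' : (Fin r → ℝ) × (Fin d → ℝ) × (Fin d → ℝ)) :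
    ofCoords e p * ofCoords e p' =
      ofCoords e (p.1 + p'.1 + bracketXY e p.2.2 p'.2.1, p.2.1 + p'.2.1, p.2.2 + p'.2.2) := by
  ext
  simp only [log_mul, log_ofCoords, Z_add, Y_add, X_add, Z_bracketXY, lie_add, add_lie, lie_smul,
    smul_lie, lie_lie_right e, lie_lie_left e, lie_central (Z_central e _),
    central_lie (Z_central e _), lie_Y_Y, lie_X_X, smul_zero, add_zero, zero_add, smul_add]
  rw [← lie_skew (e.Y p'.2.1) (e.X p.2.2)]
  module

/-- The Borel structure of `N`, transported from the coordinates. -/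
instance : MeasurableSpace (NilGroup e) := MeasurableSpace.comap coords inferInstance

/-- The coordinates of the second kind as an isomorphism of Borel spaces. -/
def coordsMeasurableEquiv (e : AdaptedBasis 𝔫 r d) :
    NilGroup e ≃ᵐ (Fin r → ℝ) × (Fin d → ℝ) × (Fin d → ℝ) where
  toEquiv := coordsEquiv e
  measurable_toFun := comap_measurable _
  measurable_invFun := by
    rintro _ ⟨s, hs, rfl⟩
    have h : (coordsEquiv e).symm ⁻¹' (coords ⁻¹' s) = s := by
      ext p
      simp [coordsEquiv, coords_ofCoords]
    rw [h]
    exact hs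

/-- The canonical Haar measure `dn = dz dy dx` of `N`. -/
def haar (e : AdaptedBasis 𝔫 r d) : Measure (NilGroup e) :=
  Measure.map (ofCoords e) volume

theorem measurable_bracketXY (e : AdaptedBasis 𝔫 r d) (x : Fin d → ℝ) :
    Measurable (bracketXY e x) := by
  refine measurable_pi_lambda _ fun i => ?_
  simp only [bracketXY, AdaptedBasis.Y, lie_sum, lie_smul, map_sum, map_smul, Finsupp.coe_finsetSum,
    Finset.sum_apply, Finsupp.smul_apply]
  fun_prop

/-- The measure `dz dy dx` is invariant under left translations. -/
theorem measurePreserving_mul_left (g : NilGroup e) :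
    MeasurePreserving (fun n => g * n) (haar e) (haar e) := by
  have hc : MeasurePreserving (ofCoords e) volume (haar e) :=
    ⟨(coordsMeasurableEquiv e).symm.measurable, rfl⟩
  have hc' : MeasurePreserving (coords (e := e)) (haar e) volume :=
    MeasurePreserving.symm (coordsMeasurableEquiv e).symm hc
  set p := coords g with hp
  have hskew : MeasurePreserving
      (fun w : ((Fin d → ℝ) × (Fin d → ℝ)) × (Fin r → ℝ) =>
        (p.2 + w.1, p.1 + w.2 + bracketXY e p.2.2 w.1.1))
      (volume.prod volume) (volume.prod volume) := by
    have hadd : MeasurePreserving (fun w : (Fin d → ℝ) × (Fin d → ℝ) => p.2 + w)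
        volume volume :=
      (measurePreserving_add_left volume p.2.1).prod (measurePreserving_add_left volume p.2.2)
    refine hadd.skew_product
      (g := fun w z => p.1 + z + bracketXY e p.2.2 w.1) ?_ ?_
    · exact (measurable_const.add measurable_snd).add
        ((measurable_bracketXY e p.2.2).comp (measurable_fst.comp measurable_fst))
    · refine Eventually.of_forall fun w => ?_
      exact ((measurePreserving_add_right volume (bracketXY e p.2.2 w.1)).comp
        (measurePreserving_add_left volume p.1)).map_eq
  have hsw := Measure.measurePreserving_swap
    (μ := (volume : Measure ((Fin d → ℝ) × (Fin d → ℝ)))) (ν := (volume : Measure (Fin r → ℝ)))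
  have hsw' := Measure.measurePreserving_swap
    (μ := (volume : Measure (Fin r → ℝ))) (ν := (volume : Measure ((Fin d → ℝ) × (Fin d → ℝ))))
  have h := hc.comp ((hsw.comp (hskew.comp hsw')).comp hc')
  convert h using 1
  funext n
  conv_lhs => rw [← ofCoords_coords g, ← ofCoords_coords n, ofCoords_mul]
  rfl

end NilGroup

/-- The Hilbert space `L²(N)`. -/
abbrev L2N (e : AdaptedBasis 𝔫 r d) : Type u := Lp ℂ 2 (NilGroup.haar e)

/-- The Hilbert space `L²(ℝ^d)`. -/
abbrev L2 (d : ℕ) : Type := Lp ℂ 2 (volume : Measure (Fin d → ℝ))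

/-- The left regular representation, `(L(g) f)(n) = f(g⁻¹ n)`. -/
def leftRegular (e : AdaptedBasis 𝔫 r d) (g : NilGroup e) (f : L2N e) : L2N e :=
  Lp.compMeasurePreserving (fun n => g⁻¹ * n) (NilGroup.measurePreserving_mul_left g⁻¹) f

/-- The phase of the unitary operator `π_l(n)`, where `n` has coordinates `p = (z, y, x)`. -/
def piPhase (e : AdaptedBasis 𝔫 r d) (l : Fin r → ℝ)
    (p : (Fin r → ℝ) × (Fin d → ℝ) × (Fin d → ℝ)) (t : Fin d → ℝ) : ℂ :=
  Complex.exp (((2 * Real.pi * (l ⬝ᵥ p.1 + t ⬝ᵥ (e.B l *ᵥ p.2.1)) : ℝ) : ℂ) * Complex.I)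

theorem memLp_pi (e : AdaptedBasis 𝔫 r d) (l : Fin r → ℝ)
    (p : (Fin r → ℝ) × (Fin d → ℝ) × (Fin d → ℝ)) (F : L2 d) :
    MemLp (fun t => piPhase e l p t * F (t - p.2.2)) 2 volume := by
  have h : MemLp (fun t => F (t - p.2.2)) 2 volume :=
    (Lp.memLp F).comp_measurePreserving (measurePreserving_sub_right volume p.2.2)
  refine h.of_le (AEStronglyMeasurable.mul ?_ h.1) (Eventually.of_forall fun t => ?_)
  · have hcont : Continuous (piPhase e l p) := by
      unfold piPhase
      fun_prop
    exact hcont.aestronglyMeasurable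
  · rw [norm_mul, piPhase, Complex.norm_exp_ofReal_mul_I, one_mul]

/-- The irreducible unitary representation `π_l` of `N` on `L²(ℝ^d)`: for
`n = exp (∑ z_i Z_i) * exp (∑ y_i Y_i) * exp (∑ x_i X_i)`,
`(π_l(n) F)(t) = exp (2πi ⟨l, z⟩) exp (2πi ⟨t, B(l) y⟩) F(t - x)`. -/
def piRep (e : AdaptedBasis 𝔫 r d) (l : Fin r → ℝ) (n : NilGroup e) (F : L2 d) : L2 d :=
  (memLp_pi e l n.coords F).toLp _

/-- The Plancherel measure `dμ(l) = |det B(l)| dl`. -/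
def plancherelMeasure (e : AdaptedBasis 𝔫 r d) : Measure (Fin r → ℝ) :=
  volume.withDensity fun l => ENNReal.ofReal |(e.B l).det|

/-- The direct integral `∫^⊕ L²(ℝ^d) ⊗ L²(ℝ^d) dμ(l)`. An element of `L²(ℝ^d) ⊗ L²(ℝ^d)`, that is, a
Hilbert-Schmidt operator on `L²(ℝ^d)`, is given by its integral kernel `k(t, s)` in
`L²(ℝ^d × ℝ^d)`; the kernel of the rank one operator `f ⊗ u : ψ ↦ ⟨ψ, u⟩ f` is
`f(t) * conj u(s)`, and the Hilbert-Schmidt norm is the `L²` norm of the kernel. The measure `μ`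
gives no mass to the complement of `Σ`, where `det B(l) = 0`. -/
abbrev L2Dual (e : AdaptedBasis 𝔫 r d) : Type :=
  Lp ℂ 2 ((plancherelMeasure e).prod
    (volume : Measure ((Fin d → ℝ) × (Fin d → ℝ))))

/-- `G` is the group Fourier transform of `f`: for almost every `l` the operator
`∫ f(n) π_l(n) dn` on `L²(ℝ^d)` (a weak operator integral) has the integral kernel `G(l, ·, ·)`. -/
def IsFourierTransform (e : AdaptedBasis 𝔫 r d) (f : L2N e) (G : L2Dual e) : Prop :=
  ∀ᵐ l ∂plancherelMeasure e, ∀ ψ χ : L2 d,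
    ∫ p : (Fin d → ℝ) × (Fin d → ℝ), conj (χ p.1) * G (l, p) * ψ p.2 =
      ∫ n, f n * inner ℂ χ (piRep e l n ψ) ∂NilGroup.haar e

/-- The graph of the Fourier transform on `L¹(N) ∩ L²(N)`. -/
def fourierGraph (e : AdaptedBasis 𝔫 r d) : Set (L2N e × L2Dual e) :=
  {p | Integrable p.1 (NilGroup.haar e) ∧ IsFourierTransform e p.1 p.2}

/-- The Plancherel transform: the extension by continuity of the Fourier transform from
`L¹(N) ∩ L²(N)` to `L²(N)`, i.e. `𝒫 f` is the limit of the Fourier transforms `G` of functions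
`g ∈ L¹(N) ∩ L²(N)` as `g` tends to `f` in `L²(N)`. -/
def plancherel (e : AdaptedBasis 𝔫 r d) (f : L2N e) : L2Dual e :=
  limUnder (comap Prod.fst (𝓝 f) ⊓ 𝓟 (fourierGraph e)) Prod.snd

/-- The subspace `∫_I^⊕ L²(ℝ^d) ⊗ P_l(L²(ℝ^d)) dμ(l)` of the direct integral: the fields that
vanish outside of `I` and take their values in `L²(ℝ^d) ⊗ P_l(L²(ℝ^d))` on `I`. -/
def directIntegral (e : AdaptedBasis 𝔫 r d) (I : Set (Fin r → ℝ))
    (P : (Fin r → ℝ) → L2 d →L[ℂ] L2 d) : Set (L2Dual e) :=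
  {G | ∀ᵐ l ∂plancherelMeasure e,
    (l ∈ I → ∀ᵐ t : Fin d → ℝ, ∃ u ∈ Set.range (P l), ∀ᵐ s : Fin d → ℝ,
      G (l, t, s) = conj (u s)) ∧
    (l ∉ I → ∀ᵐ t : Fin d → ℝ, ∀ᵐ s : Fin d → ℝ, G (l, t, s) = 0)}

/-- `P` is a measurable field of orthogonal projections of `L²(ℝ^d)` over `I`. -/
structure IsProjectionField (I : Set (Fin r → ℝ)) (P : (Fin r → ℝ) → L2 d →L[ℂ] L2 d) :
    Prop where
  isStarProjection : ∀ l ∈ I, IsStarProjection (P l)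
  measurable : ∀ u v : L2 d, Measurable fun l : I => inner ℂ u (P l v)

/-- The multiplicity function `m(l) = rank P_l`, with values in `ℕ ∪ {∞}`. -/
def multiplicity (P : (Fin r → ℝ) → L2 d →L[ℂ] L2 d) (l : Fin r → ℝ) : ℕ∞ :=
  Cardinal.toENat (LinearMap.rank (P l : L2 d →ₗ[ℂ] L2 d))

/-- `φ ∈ K` is a continuous wavelet (admissible vector) for the left regular representation
restricted to `K`: the map `ψ ↦ (n ↦ ⟨ψ, L(n) φ⟩)` is an isometry of `K` into `L²(N)`. -/
def IsContinuousWavelet (e : AdaptedBasis 𝔫 r d) (K : Submodule ℂ (L2N e)) (φ : L2N e) : Prop :=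
  φ ∈ K ∧ ∀ ψ ∈ K,
    ∫⁻ n, ‖inner ℂ (leftRegular e n φ) ψ‖ₑ ^ 2 ∂NilGroup.haar e = ‖ψ‖ₑ ^ 2

/-- The family `v` is a Parseval frame of the subspace `K`. -/
def IsParsevalFrame {H ι : Type*} [NormedAddCommGroup H] [InnerProductSpace ℂ H]
    (K : Submodule ℂ H) (v : ι → H) : Prop :=
  (∀ i, v i ∈ K) ∧ ∀ ψ ∈ K, HasSum (fun i => ‖inner ℂ (v i) ψ‖ ^ 2) (‖ψ‖ ^ 2)

/-- The quasi-lattice `Γ_{a,q,b}` of all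
`∏ exp ((m_j / a_j) Z_j) * ∏ exp ((k_j / q_j) Y_j) * ∏ exp ((n_j / b_j) X_j)` with integers
`m_j`, `k_j`, `n_j`. -/
def quasiLattice (e : AdaptedBasis 𝔫 r d) (a : Fin r → ℝ) (q b : Fin d → ℝ) :
    Set (NilGroup e) :=
  Set.range fun i : (Fin r → ℤ) × (Fin d → ℤ) × (Fin d → ℤ) =>
    NilGroup.ofCoords e
      (fun j => i.1 j / a j, fun j => i.2.1 j / q j, fun j => i.2.2 j / b j)

end TwoStep

end

/-!
Under the Plancherel transform, translation by a central element becomes multiplication by a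
character of the center. Hence for `ψ ∈ K` the function `z ↦ ⟨ψ, L(z)ψ⟩` is the Fourier transform
of the fiber weight `w(l) = |det B(l)| ‖𝓟ψ(l)‖²_HS`. Averaging the Parseval identity for the cut-off
`ψ` of `φ` to frequencies in `E` over a fundamental cell of the central lattice gives
`∫_E w² ≤ (a₁⋯a_r)⁻¹ ∫_E w` for every `E`, where `w` is now the weight of `φ`, so that
`w ≤ 1 / (a₁⋯a_r)` almost everywhere.

Admissibility is tested on the fields of rank one operators `1_C ⊗ P_l v` with `l` in small sets.
It shows that for almost every `l` the integral operator with kernel `𝓟φ(l)` does not decrease the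
norm of any vector in the range of `P_l`. Its squared Hilbert-Schmidt norm is therefore at least the
rank of `P_l`, that is, `m(l) ≤ ‖𝓟φ(l)‖²_HS = w(l) / |det B(l)|`.

Comparing admissibility with the average of the Parseval identity over a fundamental cell of the
whole quasi-lattice gives `a₁⋯a_r q₁⋯q_d b₁⋯b_d = 1` unless `φ = 0`. Hence
`‖φ‖² = ∫_I w ≤ ∫_I 1 / (a₁⋯a_r) = ∫_I b₁⋯b_d q₁⋯q_d`.
-/

noncomputable section

namespace TwoStep

open scoped FourierTransform

universe u

section LpTwo

variable {α : Type*} [MeasurableSpace α] {μ : Measure α}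

theorem eLpNorm_two_sq {ε : Type*} [ENorm ε] (f : α → ε) :
    eLpNorm f 2 μ ^ 2 = ∫⁻ x, ‖f x‖ₑ ^ 2 ∂μ := by
  simpa using eLpNorm_nnreal_pow_eq_lintegral (f := f) (p := 2) (μ := μ) two_ne_zero

theorem enorm_Lp_two_sq {E : Type*} [NormedAddCommGroup E] (f : Lp E 2 μ) :
    ‖f‖ₑ ^ 2 = ∫⁻ x, ‖f x‖ₑ ^ 2 ∂μ := by
  rw [Lp.enorm_def, eLpNorm_two_sq]

theorem memLp_two_iff_lintegral_enorm_sq_lt_top {E : Type*} [NormedAddCommGroup E] {f : α → E}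
    (hf : AEStronglyMeasurable f μ) : MemLp f 2 μ ↔ ∫⁻ x, ‖f x‖ₑ ^ 2 ∂μ < ∞ := by
  rw [← eLpNorm_two_sq, ENNReal.pow_lt_top_iff, or_iff_left two_ne_zero]
  exact and_iff_right hf

theorem enorm_sq_eq_ofReal {E : Type*} [SeminormedAddGroup E] (x : E) :
    ‖x‖ₑ ^ 2 = ENNReal.ofReal (‖x‖ ^ 2) := by
  rw [← ofReal_norm, ENNReal.ofReal_pow (norm_nonneg _)]

theorem norm_sq_le_setIntegral_of_enorm_sq_le_setLIntegral {E : Type*}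
    [SeminormedAddGroup E] {s : Set α} {f : α → ℝ} (hf : IntegrableOn f s μ)
    (hf0 : 0 ≤ᵐ[μ.restrict s] f) {x : E}
    (h : ‖x‖ₑ ^ 2 ≤ ∫⁻ y in s, ENNReal.ofReal (f y) ∂μ) : ‖x‖ ^ 2 ≤ ∫ y in s, f y ∂μ := by
  rw [enorm_sq_eq_ofReal, ← ofReal_integral_eq_lintegral_ofReal hf hf0] at h
  exact (ENNReal.ofReal_le_ofReal_iff (integral_nonneg_of_ae hf0)).1 h

end LpTwo

section Fourier

open scoped SchwartzMap ContDiff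

variable {V F : Type*} [NormedAddCommGroup V] [InnerProductSpace ℝ V] [FiniteDimensional ℝ V]
  [MeasurableSpace V] [BorelSpace V] [NormedAddCommGroup F] [InnerProductSpace ℂ F]
  [CompleteSpace F] {f : V → F}

/-- Both sides are locally integrable and define the same tempered distribution. -/
theorem fourier_toLp_ae_eq (hf : Integrable f) (hf2 : MemLp f 2) :
    (𝓕 (hf2.toLp f) : Lp (α := V) F 2) =ᵐ[volume] 𝓕 f := by
  have hcont : Continuous (𝓕 f) :=
    VectorFourier.fourierIntegral_continuous Real.continuous_fourierChar continuous_inner hf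
  refine ae_eq_of_integral_contDiff_smul_eq
    ((Lp.memLp _).locallyIntegrable one_le_two) hcont.locallyIntegrable fun g hg hgc => ?_
  have hgc' : HasCompactSupport (Complex.ofRealCLM ∘ g) := hgc.comp_left rfl
  let G : 𝓢(V, ℂ) := hgc'.toSchwartzMap (by fun_prop : ContDiff ℝ ∞ (Complex.ofRealCLM ∘ g))
  have hG (u : V → F) : ∫ x, g x • u x = ∫ x, G x • u x :=
    integral_congr_ae (Eventually.of_forall fun x => (Complex.coe_smul (g x) (u x)).symm)
  have hdistrib := congrArg (fun T => T G) (Lp.fourier_toTemperedDistribution_eq (hf2.toLp f))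
  simp only [TemperedDistribution.fourier_apply, Lp.toTemperedDistribution_apply] at hdistrib
  have htoLp : ∫ x, (𝓕 G) x • (hf2.toLp f) x = ∫ x, (𝓕 (G : V → ℂ)) x • f x := by
    refine integral_congr_ae ?_
    filter_upwards [hf2.coeFn_toLp] with x hx
    rw [hx, SchwartzMap.fourier_coe]
  have hflip : ∫ x, (𝓕 (G : V → ℂ)) x • f x = ∫ x, G x • 𝓕 f x := by
    have h := VectorFourier.integral_fourierIntegral_smul_eq_flip (L := innerₗ V) (μ := volume)
      (ν := volume) Real.continuous_fourierChar continuous_inner G.integrable hf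
    rwa [flip_innerₗ] at h
  rw [hG, hG, ← hflip, ← htoLp, hdistrib]

theorem lintegral_enorm_sq_fourier (hf : Integrable f) (hf2 : MemLp f 2) :
    ∫⁻ w, ‖𝓕 f w‖ₑ ^ 2 = ∫⁻ v, ‖f v‖ₑ ^ 2 := by
  have h := Lp.norm_fourier_eq (hf2.toLp f)
  rw [Lp.norm_def, Lp.norm_def, ENNReal.toReal_eq_toReal_iff' (Lp.eLpNorm_ne_top _)
    (Lp.eLpNorm_ne_top _), eLpNorm_congr_ae (fourier_toLp_ae_eq hf hf2),
    eLpNorm_congr_ae hf2.coeFn_toLp] at h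
  rw [← eLpNorm_two_sq, ← eLpNorm_two_sq, h]

end Fourier

section CoordinateFourier

theorem conj_fourierChar (x : ℝ) : conj (𝐞 x : ℂ) = 𝐞 (-x) := by
  rw [AddChar.map_neg_eq_inv, Circle.coe_inv_eq_conj]

theorem fourierChar_add (x y : ℝ) : (𝐞 (x + y) : ℂ) = 𝐞 x * 𝐞 y := by
  rw [AddChar.map_add_eq_mul, Circle.coe_mul]

@[fun_prop] theorem continuous_coe_fourierChar {X : Type*} [TopologicalSpace X] {f : X → ℝ}
    (hf : Continuous f) : Continuous fun x => (𝐞 (f x) : ℂ) :=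
  continuous_subtype_val.comp (Real.continuous_fourierChar.comp hf)

variable {ι κ : Type*} [Fintype ι] [Fintype κ]

theorem lintegral_enorm_sq_fourier_pi {h : (ι → ℝ) → ℂ} (h1 : Integrable h) (h2 : MemLp h 2) :
    ∫⁻ w, ‖∫ v, (𝐞 (w ⬝ᵥ v) : ℂ) * h v‖ₑ ^ 2 = ∫⁻ v, ‖h v‖ₑ ^ 2 := by
  have hm : MeasurePreserving (@WithLp.ofLp 2 (ι → ℝ)) := PiLp.volume_preserving_ofLp ι
  have hemb : MeasurableEmbedding (@WithLp.ofLp 2 (ι → ℝ)) :=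
    (MeasurableEquiv.toLp 2 (ι → ℝ)).symm.measurableEmbedding
  have key := lintegral_enorm_sq_fourier (hm.integrable_comp_of_integrable h1)
    (h2.comp_measurePreserving hm)
  simp only [Function.comp_apply] at key
  rw [hm.lintegral_comp_emb hemb (fun v => ‖h v‖ₑ ^ 2)] at key
  rw [← key, ← hm.lintegral_comp_emb hemb, ← lintegral_neg_eq_self]
  refine lintegral_congr fun w => ?_
  rw [Real.fourier_eq, ← hm.integral_comp hemb]
  congr 3
  ext v
  simp only [Circle.smul_def, smul_eq_mul, Function.comp_apply, PiLp.inner_apply,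
    WithLp.ofLp_neg, dotProduct, real_inner_eq_re_inner]
  congr 4
  simp

theorem lintegral_enorm_sq_fourier_pi_neg {h : (ι → ℝ) → ℂ} (h1 : Integrable h)
    (h2 : MemLp h 2) :
    ∫⁻ w, ‖∫ v, (𝐞 (-(w ⬝ᵥ v)) : ℂ) * h v‖ₑ ^ 2 = ∫⁻ v, ‖h v‖ₑ ^ 2 := by
  rw [← lintegral_enorm_sq_fourier_pi h1 h2]
  conv_rhs => rw [← lintegral_neg_eq_self]
  simp only [neg_dotProduct]

theorem lintegral_enorm_sq_fourier_prod {h : (ι → ℝ) × (κ → ℝ) → ℂ} (h1 : Integrable h)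
    (h2 : MemLp h 2) :
    ∫⁻ w : (ι → ℝ) × (κ → ℝ),
      ‖∫ v : (ι → ℝ) × (κ → ℝ), (𝐞 (w.1 ⬝ᵥ v.1 + w.2 ⬝ᵥ v.2) : ℂ) * h v‖ₑ ^ 2 =
      ∫⁻ v, ‖h v‖ₑ ^ 2 := by
  have hm := volume_measurePreserving_sumPiEquivProdPi (fun _ : ι ⊕ κ => ℝ)
  have hemb := (MeasurableEquiv.sumPiEquivProdPi (fun _ : ι ⊕ κ => ℝ)).measurableEmbedding
  have key := lintegral_enorm_sq_fourier_pi (hm.integrable_comp_of_integrable h1)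
    (h2.comp_measurePreserving hm)
  simp only [Function.comp_apply] at key
  rw [hm.lintegral_comp_emb hemb (fun v => ‖h v‖ₑ ^ 2)] at key
  rw [← key, ← hm.lintegral_comp_emb hemb]
  refine lintegral_congr fun w => ?_
  rw [← hm.integral_comp hemb]
  congr 3
  ext v
  congr 4
  simp [dotProduct, Fintype.sum_sum_type, MeasurableEquiv.sumPiEquivProdPi]

theorem lintegral_enorm_sq_fourier_prod_neg_le {h : (ι → ℝ) × (κ → ℝ) → ℂ}
    (h1 : Integrable h) :
    ∫⁻ w : (ι → ℝ) × (κ → ℝ),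
      ‖∫ v : (ι → ℝ) × (κ → ℝ), (𝐞 (-(w.1 ⬝ᵥ v.1 + w.2 ⬝ᵥ v.2)) : ℂ) * h v‖ₑ ^ 2 ≤
      ∫⁻ v, ‖h v‖ₑ ^ 2 := by
  rcases eq_or_ne (∫⁻ v, ‖h v‖ₑ ^ 2) ∞ with htop | hfin
  · exact htop ▸ le_top
  have h2 : MemLp h 2 := (memLp_two_iff_lintegral_enorm_sq_lt_top h1.1).2 hfin.lt_top
  have : (volume : Measure ((ι → ℝ) × (κ → ℝ))).IsNegInvariant :=
    ⟨((Measure.measurePreserving_neg volume).prod (Measure.measurePreserving_neg volume)).map_eq⟩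
  rw [← lintegral_enorm_sq_fourier_prod h1 h2]
  conv_rhs => rw [← lintegral_neg_eq_self]
  simp only [Prod.fst_neg, Prod.snd_neg, neg_dotProduct, neg_add, le_refl]

end CoordinateFourier

section Tilings

theorem lintegral_eq_tsum_of_tiling {α ι : Type*} [MeasurableSpace α] [Countable ι]
    {μ : Measure α} {R : ι → α → α} {S : ι → Set α} {D : Set α}
    (hS : ∀ i, MeasurableSet (S i)) (hdisj : Pairwise (Function.onFun Disjoint S))
    (hcover : ⋃ i, S i = Set.univ) (hR : ∀ i, MeasurePreserving (R i) μ μ)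
    (hD : ∀ i, R i ⁻¹' S i = D) {F : α → ℝ≥0∞} (hF : Measurable F) :
    ∫⁻ x, F x ∂μ = ∑' i, ∫⁻ x in D, F (R i x) ∂μ := by
  rw [← setLIntegral_univ, ← hcover, lintegral_iUnion hS hdisj]
  refine tsum_congr fun i => ?_
  rw [← hD i, (hR i).setLIntegral_comp_preimage (hS i) hF]

variable {ι : Type*}

/-- The cell `∏ [m_j / c_j, (m_j + 1) / c_j)` of the tiling of `ℝ^ι` by translates along the
lattice of the points `(m_j / c_j)`. -/
def cell (c : ι → ℝ) (m : ι → ℤ) : Set (ι → ℝ) := {x | ∀ j, ⌊c j * x j⌋ = m j}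

theorem measurableSet_cell [Countable ι] (c : ι → ℝ) (m : ι → ℤ) : MeasurableSet (cell c m) := by
  rw [cell, Set.ofPred_forall]
  exact MeasurableSet.iInter fun j =>
    (by fun_prop : Measurable fun x : ι → ℝ => ⌊c j * x j⌋) (measurableSet_singleton (m j))

theorem iUnion_cell (c : ι → ℝ) : ⋃ m, cell c m = Set.univ :=
  Set.eq_univ_of_forall fun x => Set.mem_iUnion.2 ⟨fun j => ⌊c j * x j⌋, fun _ => rfl⟩

theorem eq_of_mem_cell {c : ι → ℝ} {m m' : ι → ℤ} {x : ι → ℝ} (h : x ∈ cell c m)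
    (h' : x ∈ cell c m') : m = m' :=
  funext fun j => (h j).symm.trans (h' j)

theorem pairwise_disjoint_cell (c : ι → ℝ) : Pairwise (Function.onFun Disjoint (cell c)) :=
  fun _ _ hne => Set.disjoint_left.2 fun _ hx hx' => hne (eq_of_mem_cell hx hx')

theorem add_div_mem_cell_iff {c : ι → ℝ} (hc : ∀ j, 0 < c j) {x : ι → ℝ} {m : ι → ℤ} :
    (x + fun j => m j / c j) ∈ cell c m ↔ x ∈ cell c 0 := by
  refine forall_congr' fun j => ?_
  rw [Pi.add_apply, mul_add, mul_div_cancel₀ _ (hc j).ne', Int.floor_add_intCast, add_eq_right,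
    Pi.zero_apply]

theorem volume_cell_zero [Fintype ι] {c : ι → ℝ} (hc : ∀ j, 0 < c j) :
    volume (cell c 0) = ENNReal.ofReal (∏ j, c j)⁻¹ := by
  have h : cell c 0 = Set.pi Set.univ fun j => Set.Ico 0 (c j)⁻¹ := by
    ext x
    simp only [cell, Pi.zero_apply, Set.mem_ofPred_eq, Set.mem_pi, Set.mem_univ, true_imp_iff,
      Set.mem_Ico, Int.floor_eq_zero_iff]
    refine forall_congr' fun j => and_congr (mul_nonneg_iff_of_pos_left (hc j)) ?_
    rw [← one_div, lt_div_iff₀' (hc j)]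
  rw [h, Real.volume_pi_Ico, ← Finset.prod_inv_distrib,
    ENNReal.ofReal_prod_of_nonneg fun j _ => inv_nonneg.2 (hc j).le]
  simp only [sub_zero]

theorem lintegral_eq_tsum_cell [Fintype ι] {c : ι → ℝ} (hc : ∀ j, 0 < c j)
    {F : (ι → ℝ) → ℝ≥0∞} (hF : Measurable F) :
    ∫⁻ x, F x = ∑' m : ι → ℤ, ∫⁻ x in cell c 0, F (x + fun j => m j / c j) :=
  lintegral_eq_tsum_of_tiling (measurableSet_cell c) (pairwise_disjoint_cell c) (iUnion_cell c)
    (fun _ => measurePreserving_add_right volume _)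
    (fun _ => Set.ext fun _ => add_div_mem_cell_iff hc) hF

end Tilings

section Slices

variable {α β E : Type*} [MeasurableSpace α] [MeasurableSpace β] [NormedAddCommGroup E]
  {μ : Measure α} {ν : Measure β} [SFinite ν]

theorem ae_eq_prod_of_ae_ae_eq {f g : α × β → E} (hf : AEStronglyMeasurable f (μ.prod ν))
    (hg : AEStronglyMeasurable g (μ.prod ν)) (h : ∀ᵐ a ∂μ, ∀ᵐ b ∂ν, f (a, b) = g (a, b)) :
    f =ᵐ[μ.prod ν] g := by
  suffices hf.mk f =ᵐ[μ.prod ν] hg.mk g from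
    hf.ae_eq_mk.trans (this.trans hg.ae_eq_mk.symm)
  refine (Measure.ae_prod_iff_ae_ae
    (hf.stronglyMeasurable_mk.measurableSet_eq_fun hg.stronglyMeasurable_mk)).2 ?_
  filter_upwards [h, Measure.ae_ae_of_ae_prod hf.ae_eq_mk,
    Measure.ae_ae_of_ae_prod hg.ae_eq_mk] with a ha hfa hga
  filter_upwards [ha, hfa, hga] with b hb hfb hgb
  rw [← hfb, hb, hgb]

theorem ae_memLp_two_prodMk [SFinite μ] {f : α × β → E} (hf : MemLp f 2 (μ.prod ν)) :
    ∀ᵐ a ∂μ, MemLp (fun b => f (a, b)) 2 ν := by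
  have hsq : Integrable (fun p => ‖f p‖ ^ 2) (μ.prod ν) := hf.integrable_norm_pow two_ne_zero
  filter_upwards [hsq.prod_right_ae, hf.1.prodMk_left] with a hsqa hfa
  exact (memLp_two_iff_integrable_sq_norm hfa).2 hsqa

theorem memLp_two_mul_prod {f : α → ℂ} {g : β → ℂ} (hf : MemLp f 2 μ) (hg : MemLp g 2 ν) :
    MemLp (fun p : α × β => f p.1 * g p.2) 2 (μ.prod ν) := by
  have hm : AEStronglyMeasurable (fun p : α × β => f p.1 * g p.2) (μ.prod ν) :=
    hf.1.comp_fst.mul hg.1.comp_snd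
  have hprod : ∫⁻ p, ‖f p.1 * g p.2‖ₑ ^ 2 ∂μ.prod ν =
      (∫⁻ x, ‖f x‖ₑ ^ 2 ∂μ) * ∫⁻ y, ‖g y‖ₑ ^ 2 ∂ν := by
    simp_rw [enorm_mul, mul_pow]
    exact lintegral_prod_mul (hf.1.enorm.pow_const 2) (hg.1.enorm.pow_const 2)
  rw [memLp_two_iff_lintegral_enorm_sq_lt_top hm, hprod]
  exact ENNReal.mul_lt_top ((memLp_two_iff_lintegral_enorm_sq_lt_top hf.1).1 hf)
    ((memLp_two_iff_lintegral_enorm_sq_lt_top hg.1).1 hg)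

end Slices

section KernelOperators

variable {α β : Type*} [MeasurableSpace α] [MeasurableSpace β] {μ : Measure α} {ν : Measure β}

theorem inner_Lp_eq_integral (u v : Lp ℂ 2 μ) : inner ℂ u v = ∫ x, conj (u x) * v x ∂μ := by
  rw [L2.inner_def]
  exact integral_congr_ae (Eventually.of_forall fun x => mul_comm _ _)

theorem lintegral_enorm_sq_eq_of_ae_eq_conj {f : β → ℂ} {c : Lp ℂ 2 ν}
    (h : f =ᵐ[ν] fun s => conj (c s)) : ∫⁻ s, ‖f s‖ₑ ^ 2 ∂ν = ‖c‖ₑ ^ 2 := by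
  rw [enorm_Lp_two_sq]
  refine lintegral_congr_ae ?_
  filter_upwards [h] with s hs
  rw [hs, RCLike.enorm_conj]

variable [SFinite ν] {k : α × β → ℂ}

theorem aestronglyMeasurable_integral_kernel_mul (hk : MemLp k 2 (μ.prod ν)) (u : Lp ℂ 2 ν) :
    AEStronglyMeasurable (fun t => ∫ s, k (t, s) * u s ∂ν) μ :=
  (hk.1.mul (Lp.aestronglyMeasurable u).comp_snd).integral_prod_right'

theorem lintegral_lintegral_enorm_sq_kernel (hk : MemLp k 2 (μ.prod ν)) :
    ∫⁻ t, ∫⁻ s, ‖k (t, s)‖ₑ ^ 2 ∂ν ∂μ = ∫⁻ p, ‖k p‖ₑ ^ 2 ∂μ.prod ν :=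
  (lintegral_prod _ (hk.1.enorm.pow_const 2)).symm

variable [SFinite μ]

theorem ae_exists_slice (hk : MemLp k 2 (μ.prod ν)) :
    ∀ᵐ t ∂μ, ∃ c : Lp ℂ 2 ν, (fun s => k (t, s)) =ᵐ[ν] (fun s => conj (c s)) ∧
      ∀ u : Lp ℂ 2 ν, ∫ s, k (t, s) * u s ∂ν = inner ℂ c u := by
  filter_upwards [ae_memLp_two_prodMk hk] with t ht
  have hslice : (fun s => k (t, s)) =ᵐ[ν] fun s => conj (ht.star.toLp _ s) := by
    filter_upwards [ht.star.coeFn_toLp] with s hs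
    rw [hs, Pi.star_apply, RCLike.star_def, Complex.conj_conj]
  refine ⟨ht.star.toLp _, hslice, fun u => ?_⟩
  rw [inner_Lp_eq_integral]
  refine integral_congr_ae ?_
  filter_upwards [hslice] with s hs
  rw [hs]

theorem lintegral_enorm_sq_integral_kernel_mul_le (hk : MemLp k 2 (μ.prod ν)) (u : Lp ℂ 2 ν) :
    ∫⁻ t, ‖∫ s, k (t, s) * u s ∂ν‖ₑ ^ 2 ∂μ ≤ (∫⁻ p, ‖k p‖ₑ ^ 2 ∂μ.prod ν) * ‖u‖ₑ ^ 2 := by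
  rw [← lintegral_lintegral_enorm_sq_kernel hk,
    ← lintegral_mul_const' _ _ (ENNReal.pow_ne_top enorm_ne_top)]
  refine lintegral_mono_ae ?_
  filter_upwards [ae_exists_slice hk] with t ⟨c, hkc, hc⟩
  rw [lintegral_enorm_sq_eq_of_ae_eq_conj hkc, hc, ← mul_pow]
  gcongr
  simp only [enorm_eq_nnnorm]
  exact_mod_cast nnnorm_inner_le_nnnorm (𝕜 := ℂ) c u

theorem memLp_integral_kernel_mul (hk : MemLp k 2 (μ.prod ν)) (u : Lp ℂ 2 ν) :
    MemLp (fun t => ∫ s, k (t, s) * u s ∂ν) 2 μ := by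
  refine (memLp_two_iff_lintegral_enorm_sq_lt_top
    (aestronglyMeasurable_integral_kernel_mul hk u)).2 ?_
  exact (lintegral_enorm_sq_integral_kernel_mul_le hk u).trans_lt (ENNReal.mul_lt_top
    ((memLp_two_iff_lintegral_enorm_sq_lt_top hk.1).1 hk) (ENNReal.pow_lt_top enorm_lt_top))

/-- The Hilbert-Schmidt operator `u ↦ ∫ k(·, s) u(s) ds` with the square-integrable integral
kernel `k`. -/
def kernelOperator (hk : MemLp k 2 (μ.prod ν)) : Lp ℂ 2 ν →L[ℂ] Lp ℂ 2 μ :=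
  LinearMap.mkContinuous
    { toFun := fun u => (memLp_integral_kernel_mul hk u).toLp _
      map_add' := fun u v => by
        rw [← MemLp.toLp_add]
        refine (MemLp.toLp_eq_toLp_iff _ _).2 ?_
        filter_upwards [ae_exists_slice hk] with t ⟨c, _, hc⟩
        simp only [Pi.add_apply, hc, inner_add_right]
      map_smul' := fun a u => by
        rw [RingHom.id_apply, ← MemLp.toLp_const_smul]
        refine (MemLp.toLp_eq_toLp_iff _ _).2 ?_
        filter_upwards [ae_exists_slice hk] with t ⟨c, _, hc⟩
        simp only [Pi.smul_apply, hc, inner_smul_right, smul_eq_mul] }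
    (eLpNorm k 2 (μ.prod ν)).toReal fun u => by
      have hsq := lintegral_enorm_sq_integral_kernel_mul_le hk u
      rw [← eLpNorm_two_sq, ← eLpNorm_two_sq, ← mul_pow,
        (ENNReal.pow_right_strictMono two_ne_zero).le_iff_le] at hsq
      have h := ENNReal.toReal_mono (ENNReal.mul_ne_top hk.2.ne enorm_ne_top) hsq
      rwa [ENNReal.toReal_mul, toReal_enorm,
        ← Lp.norm_toLp _ (memLp_integral_kernel_mul hk u)] at h

theorem coeFn_kernelOperator (hk : MemLp k 2 (μ.prod ν)) (u : Lp ℂ 2 ν) :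
    kernelOperator hk u =ᵐ[μ] fun t => ∫ s, k (t, s) * u s ∂ν :=
  (memLp_integral_kernel_mul hk u).coeFn_toLp

theorem enorm_sq_kernelOperator (hk : MemLp k 2 (μ.prod ν)) (u : Lp ℂ 2 ν) :
    ‖kernelOperator hk u‖ₑ ^ 2 = ∫⁻ t, ‖∫ s, k (t, s) * u s ∂ν‖ₑ ^ 2 ∂μ := by
  rw [enorm_Lp_two_sq]
  refine lintegral_congr_ae ?_
  filter_upwards [coeFn_kernelOperator hk u] with t ht
  rw [ht]

theorem inner_kernelOperator (hk : MemLp k 2 (μ.prod ν)) (χ : Lp ℂ 2 μ) (ψ : Lp ℂ 2 ν) :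
    inner ℂ χ (kernelOperator hk ψ) = ∫ p, conj (χ p.1) * k p * ψ p.2 ∂μ.prod ν := by
  have hint : Integrable (fun p => conj (χ p.1) * k p * ψ p.2) (μ.prod ν) :=
    (hk.integrable_mul (memLp_two_mul_prod (Lp.memLp χ).star (Lp.memLp ψ))).congr
      (Eventually.of_forall fun p => by simp only [Pi.mul_apply, Pi.star_apply, RCLike.star_def]
                                        ring)
  rw [integral_prod _ hint, inner_Lp_eq_integral]
  refine integral_congr_ae ?_
  filter_upwards [coeFn_kernelOperator hk ψ] with t ht
  simp only [ht, mul_assoc, integral_const_mul]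

theorem ae_eq_of_kernelOperator_eq [TopologicalSpace.SeparableSpace (Lp ℂ 2 ν)]
    {k₁ k₂ : α × β → ℂ} (h₁ : MemLp k₁ 2 (μ.prod ν)) (h₂ : MemLp k₂ 2 (μ.prod ν))
    (h : kernelOperator h₁ = kernelOperator h₂) : k₁ =ᵐ[μ.prod ν] k₂ := by
  refine ae_eq_prod_of_ae_ae_eq h₁.1 h₂.1 ?_
  have hdense : ∀ᵐ t ∂μ, ∀ n, kernelOperator h₁ (TopologicalSpace.denseSeq (Lp ℂ 2 ν) n) t =
      ∫ s, k₂ (t, s) * TopologicalSpace.denseSeq (Lp ℂ 2 ν) n s ∂ν :=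
    ae_all_iff.2 fun n => h ▸ coeFn_kernelOperator h₂ _
  filter_upwards [hdense, ae_all_iff.2 fun n => coeFn_kernelOperator h₁
    (TopologicalSpace.denseSeq (Lp ℂ 2 ν) n), ae_exists_slice h₁, ae_exists_slice h₂]
    with t h₂t h₁t ⟨c₁, hk₁, hc₁⟩ ⟨c₂, hk₂, hc₂⟩
  have hc : c₁ = c₂ := by
    refine (TopologicalSpace.denseRange_denseSeq (Lp ℂ 2 ν)).eq_of_inner_left (𝕜 := ℂ) fun n => ?_
    rw [← hc₁, ← hc₂, ← h₁t, h₂t]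
  exact hk₁.trans (hc ▸ hk₂.symm)

/-- Apply Bessel's inequality to each slice `k(t, ·)`. -/
theorem sum_enorm_sq_kernelOperator_le (hk : MemLp k 2 (μ.prod ν)) {ι : Type*} [Fintype ι]
    {u : ι → Lp ℂ 2 ν} (hu : Orthonormal ℂ u) :
    ∑ i, ‖kernelOperator hk (u i)‖ₑ ^ 2 ≤ ∫⁻ p, ‖k p‖ₑ ^ 2 ∂μ.prod ν := by
  simp only [enorm_sq_kernelOperator]
  rw [← lintegral_finsetSum' _ fun i _ =>
    (aestronglyMeasurable_integral_kernel_mul hk (u i)).enorm.pow_const 2,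
    ← lintegral_lintegral_enorm_sq_kernel hk]
  refine lintegral_mono_ae ?_
  filter_upwards [ae_exists_slice hk] with t ⟨c, hkc, hc⟩
  have hbessel := hu.sum_inner_products_le c (s := Finset.univ)
  rw [lintegral_enorm_sq_eq_of_ae_eq_conj hkc, ← ofReal_norm,
    ← ENNReal.ofReal_pow (norm_nonneg _)]
  refine le_of_eq_of_le ?_ (ENNReal.ofReal_le_ofReal hbessel)
  rw [ENNReal.ofReal_sum_of_nonneg fun i _ => sq_nonneg _]
  refine Finset.sum_congr rfl fun i _ => ?_
  rw [hc, ← ofReal_norm, ← ENNReal.ofReal_pow (norm_nonneg _), norm_inner_symm]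

theorem exists_orthonormal_of_le_rank {𝕜 H : Type*} [RCLike 𝕜] [NormedAddCommGroup H]
    [InnerProductSpace 𝕜 H] {W : Submodule 𝕜 H} {n : ℕ} (hn : n ≤ Module.rank 𝕜 W) :
    ∃ u : Fin n → H, Orthonormal 𝕜 u ∧ ∀ i, u i ∈ W := by
  obtain ⟨s, hs, hli⟩ := le_rank_iff_exists_linearIndependent_finset.1 hn
  have : FiniteDimensional 𝕜 (Submodule.span 𝕜 (s : Set W)) := FiniteDimensional.span_finset 𝕜 s
  have hrank : Module.finrank 𝕜 (Submodule.span 𝕜 (s : Set W)) = n := by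
    rw [finrank_span_finset_eq_card hli, hs]
  let basis := (stdOrthonormalBasis 𝕜 (Submodule.span 𝕜 (s : Set W))).reindex (finCongr hrank)
  exact ⟨fun i => basis i, (basis.orthonormal.comp_linearIsometry
    (Submodule.span 𝕜 (s : Set W)).subtypeₗᵢ).comp_linearIsometry W.subtypeₗᵢ,
    fun i => (basis i : W).2⟩

theorem rank_le_lintegral_of_norm_le_kernelOperator (hk : MemLp k 2 (μ.prod ν))
    {W : Submodule ℂ (Lp ℂ 2 ν)} (hW : ∀ w ∈ W, ‖w‖ ≤ ‖kernelOperator hk w‖) :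
    (Cardinal.toENat (Module.rank ℂ W) : ℝ≥0∞) ≤ ∫⁻ p, ‖k p‖ₑ ^ 2 ∂μ.prod ν := by
  refine ENat.le_floor.1 (ENat.forall_natCast_le_iff_le.1 fun n hn => ENat.le_floor.2 ?_)
  obtain ⟨u, hu, huW⟩ := exists_orthonormal_of_le_rank (Cardinal.natCast_le_toENat.1 hn)
  have hone (i : Fin n) : 1 ≤ ‖kernelOperator hk (u i)‖ₑ ^ 2 := by
    rw [← ofReal_norm]
    exact one_le_pow₀ (ENNReal.one_le_ofReal.2 (hu.1 i ▸ hW (u i) (huW i)))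
  calc ((n : ℕ∞) : ℝ≥0∞) = ∑ _i : Fin n, (1 : ℝ≥0∞) := by simp
    _ ≤ ∑ i, ‖kernelOperator hk (u i)‖ₑ ^ 2 := Finset.sum_le_sum fun i _ => hone i
    _ ≤ ∫⁻ p, ‖k p‖ₑ ^ 2 ∂μ.prod ν := sum_enorm_sq_kernelOperator_le hk hu

end KernelOperators

section MeasurableFields

theorem exists_measurable_dist_denseSeq_lt {X M : Type*} [MeasurableSpace X]
    [PseudoMetricSpace M] [TopologicalSpace.SeparableSpace M] [Nonempty M] {T : X → M}
    (hT : ∀ w, Measurable fun x => dist (T x) w) {ε : ℝ} (hε : 0 < ε) :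
    ∃ N : X → ℕ, Measurable N ∧ ∀ x, dist (T x) (TopologicalSpace.denseSeq M (N x)) < ε := by
  classical
  have hex (x : X) : ∃ j, dist (T x) (TopologicalSpace.denseSeq M j) < ε :=
    (TopologicalSpace.denseRange_denseSeq M).exists_dist_lt (T x) hε
  exact ⟨fun x => Nat.find (hex x),
    measurable_find hex fun _ => measurableSet_lt (hT _) measurable_const,
    fun x => Nat.find_spec (hex x)⟩

theorem ae_tendsto_of_tsum_enorm_sub_sq_ne_top {β E : Type*} [MeasurableSpace β] {ν : Measure β}
    [NormedAddCommGroup E] {f : ℕ → Lp E 2 ν} {g : Lp E 2 ν}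
    (h : ∑' n, ‖f n - g‖ₑ ^ 2 ≠ ∞) : ∀ᵐ s ∂ν, Tendsto (fun n => f n s) atTop (𝓝 (g s)) := by
  have hmeas (n : ℕ) : AEMeasurable (fun s => ‖(f n - g) s‖ₑ ^ 2) ν :=
    (Lp.aestronglyMeasurable _).enorm.pow_const 2
  simp only [enorm_Lp_two_sq] at h
  rw [← lintegral_tsum hmeas] at h
  filter_upwards [ae_lt_top' (AEMeasurable.tsum hmeas) h,
    ae_all_iff.2 fun n => Lp.coeFn_sub (f n) g] with s hs hsub
  have hzero := (ENNReal.tendsto_atTop_zero_of_tsum_ne_top hs.ne).ennrpow_const (1 / 2 : ℝ)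
  rw [ENNReal.zero_rpow_of_pos one_half_pos] at hzero
  refine tendsto_iff_edist_tendsto_0.2 (hzero.congr fun n => ?_)
  rw [hsub, Pi.sub_apply, edist_eq_enorm_sub, ← ENNReal.rpow_natCast, ← ENNReal.rpow_mul]
  norm_num

theorem exists_stronglyMeasurable_prod {X β : Type*} [MeasurableSpace X] [MeasurableSpace β]
    {ν : Measure β} [TopologicalSpace.SeparableSpace (Lp ℂ 2 ν)] (T : X → Lp ℂ 2 ν)
    (hT : ∀ w, Measurable fun x => dist (T x) w) :
    ∃ u : X × β → ℂ, StronglyMeasurable u ∧ ∀ x, (fun s => u (x, s)) =ᵐ[ν] T x := by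
  choose N hN hdist using fun n : ℕ =>
    exists_measurable_dist_denseSeq_lt hT (pow_pos one_half_pos n : (0 : ℝ) < (1 / 2) ^ n)
  let v (n : ℕ) (p : X × β) : ℂ := TopologicalSpace.denseSeq (Lp ℂ 2 ν) (N n p.1) p.2
  have hv (n : ℕ) : StronglyMeasurable (v n) := by
    have hseq : Measurable fun p : ℕ × β => TopologicalSpace.denseSeq (Lp ℂ 2 ν) p.1 p.2 :=
      measurable_from_prod_countable_right fun j =>
        (Lp.stronglyMeasurable (TopologicalSpace.denseSeq (Lp ℂ 2 ν) j)).measurable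
    exact (hseq.comp (((hN n).comp measurable_fst).prodMk measurable_snd)).stronglyMeasurable
  refine ⟨fun p => limUnder atTop fun n => v n p, StronglyMeasurable.limUnder hv, fun x => ?_⟩
  have hle (n : ℕ) : ‖TopologicalSpace.denseSeq (Lp ℂ 2 ν) (N n x) - T x‖ₑ ^ 2 ≤
      ENNReal.ofReal (1 / 4) ^ n := by
    rw [← ofReal_norm, ← ENNReal.ofReal_pow (norm_nonneg _), ← ENNReal.ofReal_pow (by norm_num),
      norm_sub_rev, ← dist_eq_norm]
    refine ENNReal.ofReal_le_ofReal ?_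
    calc dist (T x) (TopologicalSpace.denseSeq (Lp ℂ 2 ν) (N n x)) ^ 2
        ≤ ((1 / 2 : ℝ) ^ n) ^ 2 := pow_le_pow_left₀ dist_nonneg (hdist n x).le 2
      _ = (1 / 4 : ℝ) ^ n := by rw [← pow_mul, mul_comm, pow_mul]; norm_num
  have hsum : ∑' n, ‖TopologicalSpace.denseSeq (Lp ℂ 2 ν) (N n x) - T x‖ₑ ^ 2 ≠ ∞ := by
    refine ne_top_of_le_ne_top ?_ (ENNReal.tsum_le_tsum hle)
    rw [ENNReal.tsum_geometric]
    exact ENNReal.inv_ne_top.2 (tsub_pos_of_lt (ENNReal.ofReal_lt_one.2 (by norm_num))).ne'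
  filter_upwards [ae_tendsto_of_tsum_enorm_sub_sq_ne_top hsum] with s hs
  exact hs.limUnder_eq

end MeasurableFields

section StarProjections

variable {𝕜 H : Type*} [RCLike 𝕜] [NormedAddCommGroup H] [InnerProductSpace 𝕜 H]
  [CompleteSpace H] {Q : H →L[𝕜] H}

theorem norm_apply_le_of_isStarProjection (hQ : IsStarProjection Q) (v : H) : ‖Q v‖ ≤ ‖v‖ := by
  obtain ⟨U, _, rfl⟩ := isStarProjection_iff_eq_starProjection.1 hQ
  exact U.norm_starProjection_apply_le v

theorem norm_sq_apply_of_isStarProjection (hQ : IsStarProjection Q) (v : H) :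
    ‖Q v‖ ^ 2 = RCLike.re (inner 𝕜 v (Q v)) := by
  obtain ⟨U, _, rfl⟩ := isStarProjection_iff_eq_starProjection.1 hQ
  rw [← inner_re_symm, U.re_inner_starProjection_eq_normSq, U.starProjection_apply, U.coe_norm]

end StarProjections

section Determinants

variable {n : Type*} [Fintype n] [DecidableEq n]

open Polynomial in
theorem ae_det_add_smul_ne_zero (M : Matrix n n ℝ) {N : Matrix n n ℝ} (hN : N.det ≠ 0) :
    ∀ᵐ s : ℝ, (M + s • N).det ≠ 0 := by
  set p : ℝ[X] := ((X : ℝ[X]) • N.map C + M.map C).det with hp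
  have hp0 : p ≠ 0 := fun h => hN <| by
    rw [← Polynomial.coeff_det_X_add_C_card N M, ← hp, h, Polynomial.coeff_zero]
  have heval (s : ℝ) : p.eval s = (M + s • N).det := by
    rw [hp, ← Polynomial.coe_evalRingHom, RingHom.map_det, add_comm M]
    congr 1
    ext i j
    simp only [RingHom.mapMatrix_apply, Matrix.map_apply, Matrix.add_apply, Matrix.smul_apply,
      smul_eq_mul, map_add, Polynomial.eval_mul, Polynomial.coe_evalRingHom, Polynomial.eval_X,
      Polynomial.eval_C]
  have hroots : (p.roots.toFinset : Set ℝ)ᶜ ∈ ae (volume : Measure ℝ) :=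
    compl_mem_ae_iff.2 ((Finset.finite_toSet _).measure_zero _)
  filter_upwards [hroots] with s hs
  rw [← heval]
  simpa only [Set.mem_compl_iff, Finset.mem_coe, Multiset.mem_toFinset, Polynomial.mem_roots hp0,
    Polynomial.IsRoot.def] using hs

theorem lintegral_comp_vecMul {M : Matrix n n ℝ} (hM : M.det ≠ 0) {F : (n → ℝ) → ℝ≥0∞}
    (hF : Measurable F) : ENNReal.ofReal |M.det| * ∫⁻ t, F (t ᵥ* M) = ∫⁻ t, F t := by
  have hmeas : Measurable (Matrix.toLin' Mᵀ) :=
    (Matrix.toLin' Mᵀ).continuous_of_finiteDimensional.measurable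
  have hmap := lintegral_map (μ := volume) hF hmeas
  rw [Real.map_matrix_volume_pi_eq_smul_volume_pi (by rwa [Matrix.det_transpose]),
    lintegral_smul_measure] at hmap
  simp only [Matrix.toLin'_apply, Matrix.mulVec_transpose, Matrix.det_transpose] at hmap
  rw [← hmap, smul_eq_mul, ← mul_assoc, ← ENNReal.ofReal_mul (abs_nonneg _), ← abs_mul,
    mul_inv_cancel₀ hM, abs_one, ENNReal.ofReal_one, one_mul]

end Determinants

variable {𝔫 : Type u} [LieRing 𝔫] [LieAlgebra ℝ 𝔫] {r d : ℕ} (e : AdaptedBasis 𝔫 r d)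

section Brackets

theorem functional_eq_dotProduct (l : Fin r → ℝ) (u : 𝔫) :
    e.functional l u = l ⬝ᵥ fun i => e.basis.repr u (Sum.inl i) := rfl

theorem bracketXY_eq_sum (x y : Fin d → ℝ) : NilGroup.bracketXY e x y = fun k => ∑ i, ∑ j,
    x i * y j *
      e.basis.repr ⁅e.basis (Sum.inr (Sum.inr i)), e.basis (Sum.inr (Sum.inl j))⁆ (Sum.inl k) := by
  ext k
  simp only [NilGroup.bracketXY, AdaptedBasis.X, AdaptedBasis.Y, sum_lie, lie_sum, lie_smul,
    smul_lie, map_sum, map_smul, Finsupp.finsetSum_apply, Finsupp.smul_apply, smul_eq_mul,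
    mul_assoc]
  rw [Finset.sum_comm]
  refine Finset.sum_congr rfl fun j _ => ?_
  rw [Finset.mul_sum]
  exact Finset.sum_congr rfl fun i _ => mul_left_comm _ _ _

theorem dotProduct_bracketXY (l : Fin r → ℝ) (x y : Fin d → ℝ) :
    l ⬝ᵥ NilGroup.bracketXY e x y = -(x ⬝ᵥ (e.B l *ᵥ y)) := by
  rw [bracketXY_eq_sum]
  simp only [dotProduct, Matrix.mulVec, AdaptedBasis.B, Matrix.of_apply, AdaptedBasis.functional,
    Finset.mul_sum, neg_mul, Finset.sum_neg_distrib, mul_neg, neg_neg, Finset.sum_mul]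
  rw [Finset.sum_comm]
  refine Finset.sum_congr rfl fun i _ => ?_
  rw [Finset.sum_comm]
  refine Finset.sum_congr rfl fun j _ => Finset.sum_congr rfl fun k _ => ?_
  ring

theorem lie_Y_eq_neg_Z_bracketXY (y : Fin d → ℝ) (v : 𝔫) :
    ⁅e.Y y, v⁆ = -e.Z (NilGroup.bracketXY e (fun i => e.basis.repr v (Sum.inr (Sum.inr i))) y) := by
  conv_lhs => rw [NilGroup.eq_Z_add_Y_add_X e v]
  rw [lie_add, lie_add, NilGroup.central_lie (NilGroup.Z_central e _), NilGroup.lie_Y_Y,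
    zero_add, zero_add, ← lie_skew, NilGroup.Z_bracketXY]

theorem eq_zero_of_Y_mem_center {y : Fin d → ℝ} (hy : e.Y y ∈ LieAlgebra.center ℝ 𝔫) :
    y = 0 := by
  ext j
  have h := NilGroup.repr_central e hy (Sum.inl j)
  simpa [AdaptedBasis.Y, Finsupp.single_apply] using h

/-- A null vector `y` of `B(l)` for the generic functional would make `∑ y_i Y_i` central. -/
theorem exists_det_B_ne_zero : ∃ l, (e.B l).det ≠ 0 := by
  obtain ⟨L, hL⟩ := e.generic
  have hLZ (z : Fin r → ℝ) : L (e.Z z) = (fun i => L (e.basis (Sum.inl i))) ⬝ᵥ z := by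
    simp only [AdaptedBasis.Z, map_sum, map_smul, smul_eq_mul, dotProduct, mul_comm]
  refine ⟨fun i => L (e.basis (Sum.inl i)), fun hdet => ?_⟩
  obtain ⟨y, hy0, hy⟩ := Matrix.exists_mulVec_eq_zero_iff.2 hdet
  refine hy0 (eq_zero_of_Y_mem_center e (hL _ fun v => ?_))
  rw [lie_Y_eq_neg_Z_bracketXY, map_neg, hLZ, dotProduct_bracketXY, hy, dotProduct_zero, neg_zero,
    neg_zero]

theorem B_add_smul (l l' : Fin r → ℝ) (s : ℝ) : e.B (l + s • l') = e.B l + s • e.B l' := by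
  ext i j
  simp only [AdaptedBasis.B, Matrix.of_apply, Matrix.add_apply, Matrix.smul_apply,
    functional_eq_dotProduct, add_dotProduct, smul_dotProduct, smul_eq_mul]
  ring

@[fun_prop]
theorem continuous_B : Continuous e.B := by
  refine continuous_matrix fun i j => ?_
  simp only [AdaptedBasis.B, Matrix.of_apply, functional_eq_dotProduct]
  fun_prop

@[fun_prop]
theorem continuous_det_B : Continuous fun l => (e.B l).det :=
  (continuous_B e).matrix_det

theorem ae_det_B_ne_zero : ∀ᵐ l, (e.B l).det ≠ 0 := by
  obtain ⟨l₀, h₀⟩ := exists_det_B_ne_zero e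
  refine ae_mem_of_ae_add_linearMap_mem (s := {l | (e.B l).det ≠ 0})
    (LinearMap.toSpanSingleton ℝ _ l₀) volume volume
    (isOpen_ne.preimage (continuous_det_B e)).measurableSet fun l => ?_
  filter_upwards [ae_det_add_smul_ne_zero (e.B l) h₀] with s hs
  rwa [LinearMap.toSpanSingleton_apply, B_add_smul]

theorem continuous_bracketXY : Continuous fun p : (Fin d → ℝ) × (Fin d → ℝ) =>
    NilGroup.bracketXY e p.1 p.2 := by
  simp only [bracketXY_eq_sum]
  fun_prop

@[fun_prop]
theorem measurable_bracketXY_comp {α : Type*} [MeasurableSpace α] {f g : α → Fin d → ℝ}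
    (hf : Measurable f) (hg : Measurable g) :
    Measurable fun a => NilGroup.bracketXY e (f a) (g a) :=
  (continuous_bracketXY e).measurable.comp (hf.prodMk hg)

end Brackets

/-- The coordinates `(z, y, x)` on `N`. The points `(l, t, s)` at which the integral kernels of
fields of Hilbert-Schmidt operators are evaluated have the same type. -/
abbrev Coords (r d : ℕ) : Type := (Fin r → ℝ) × (Fin d → ℝ) × (Fin d → ℝ)

section HaarMeasure

theorem measurePreserving_ofCoords :
    MeasurePreserving (NilGroup.ofCoords e) volume (NilGroup.haar e) :=
  ⟨(NilGroup.coordsMeasurableEquiv e).symm.measurable, rfl⟩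

theorem measurableEmbedding_ofCoords : MeasurableEmbedding (NilGroup.ofCoords e) :=
  (NilGroup.coordsMeasurableEquiv e).symm.measurableEmbedding

theorem measurePreserving_coords :
    MeasurePreserving (NilGroup.coords (e := e)) (NilGroup.haar e) volume :=
  MeasurePreserving.symm (NilGroup.coordsMeasurableEquiv e).symm (measurePreserving_ofCoords e)

theorem lintegral_haar (F : NilGroup e → ℝ≥0∞) :
    ∫⁻ n, F n ∂NilGroup.haar e = ∫⁻ p, F (NilGroup.ofCoords e p) :=
  ((measurePreserving_ofCoords e).lintegral_comp_emb (measurableEmbedding_ofCoords e) F).symm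

theorem coords_mul (g h : NilGroup e) : NilGroup.coords (g * h) =
    (g.coords.1 + h.coords.1 + NilGroup.bracketXY e g.coords.2.2 h.coords.2.1,
      g.coords.2.1 + h.coords.2.1, g.coords.2.2 + h.coords.2.2) := by
  conv_lhs => rw [← NilGroup.ofCoords_coords g, ← NilGroup.ofCoords_coords h, NilGroup.ofCoords_mul,
    NilGroup.coords_ofCoords]

theorem measurePreserving_coords_mul_right (p' : Coords r d) :
    MeasurePreserving fun p : Coords r d =>
      (p.1 + p'.1 + NilGroup.bracketXY e p.2.2 p'.2.1, p.2 + p'.2) := by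
  have hskew : MeasurePreserving
      (fun w : ((Fin d → ℝ) × (Fin d → ℝ)) × (Fin r → ℝ) =>
        (w.1 + p'.2, w.2 + p'.1 + NilGroup.bracketXY e w.1.2 p'.2.1))
      (volume.prod volume) (volume.prod volume) := by
    have hadd : MeasurePreserving (fun w : (Fin d → ℝ) × (Fin d → ℝ) => w + p'.2) :=
      (measurePreserving_add_right volume p'.2.1).prod (measurePreserving_add_right volume p'.2.2)
    refine hadd.skew_product
      (g := fun w z => z + p'.1 + NilGroup.bracketXY e w.2 p'.2.1) (by fun_prop) ?_
    refine Eventually.of_forall fun w => ?_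
    exact ((measurePreserving_add_right volume (NilGroup.bracketXY e w.2 p'.2.1)).comp
      (measurePreserving_add_right volume p'.1)).map_eq
  exact Measure.measurePreserving_swap.comp (hskew.comp Measure.measurePreserving_swap)

theorem measurePreserving_mul_right (g : NilGroup e) :
    MeasurePreserving (fun n => n * g) (NilGroup.haar e) (NilGroup.haar e) := by
  convert (measurePreserving_ofCoords e).comp
    ((measurePreserving_coords_mul_right e g.coords).comp (measurePreserving_coords e)) using 1
  ext1 n
  rw [Function.comp_apply, Function.comp_apply, ← NilGroup.ofCoords_coords (n * g), coords_mul]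
  rfl

end HaarMeasure

section QuasiLattice

variable (a : Fin r → ℝ) (q b : Fin d → ℝ)

/-- The points of the quasi-lattice `Γ_{a,q,b}`, indexed by the exponents `(m, k, n)`. -/
def latticePoint (i : (Fin r → ℤ) × (Fin d → ℤ) × (Fin d → ℤ)) : NilGroup e :=
  NilGroup.ofCoords e (fun j => i.1 j / a j, fun j => i.2.1 j / q j, fun j => i.2.2 j / b j)

/-- The fundamental domain of `Γ_{a,q,b}`, acting by right translations, that is a cell of `ℝ^r`,
`ℝ^d` and `ℝ^d` in the coordinates `z`, `y` and `x`. -/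
def fundamentalCell : Set (NilGroup e) :=
  NilGroup.coords ⁻¹' (cell a 0 ×ˢ cell q 0 ×ˢ cell b 0)

variable {a q b}

theorem eq_of_forall_div_eq {ι : Type*} {c : ι → ℝ} (hc : ∀ j, 0 < c j) {m m' : ι → ℤ}
    (h : (fun j => (m j : ℝ) / c j) = fun j => (m' j : ℝ) / c j) : m = m' :=
  funext fun j => by exact_mod_cast (div_left_inj' (hc j).ne').1 (congrFun h j)

theorem latticePoint_injective (ha : ∀ j, 0 < a j) (hq : ∀ j, 0 < q j) (hb : ∀ j, 0 < b j) :
    Function.Injective (latticePoint e a q b) := fun i i' h => by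
  have hcoords := (NilGroup.coordsEquiv e).symm.injective h
  simp only [Prod.mk.injEq] at hcoords
  exact Prod.ext (eq_of_forall_div_eq ha hcoords.1)
    (Prod.ext (eq_of_forall_div_eq hq hcoords.2.1) (eq_of_forall_div_eq hb hcoords.2.2))

theorem haar_fundamentalCell (ha : ∀ j, 0 < a j) (hq : ∀ j, 0 < q j) (hb : ∀ j, 0 < b j) :
    NilGroup.haar e (fundamentalCell e a q b) =
      ENNReal.ofReal ((∏ j, a j)⁻¹ * ((∏ j, q j)⁻¹ * (∏ j, b j)⁻¹)) := by
  have hnonneg {n : ℕ} {c : Fin n → ℝ} (hc : ∀ j, 0 < c j) : 0 ≤ (∏ j, c j)⁻¹ :=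
    inv_nonneg.2 (Finset.prod_nonneg fun j _ => (hc j).le)
  rw [fundamentalCell, (measurePreserving_coords e).measure_preimage ((measurableSet_cell a 0).prod
    ((measurableSet_cell q 0).prod (measurableSet_cell b 0))).nullMeasurableSet,
    Measure.volume_eq_prod, Measure.prod_prod, Measure.volume_eq_prod, Measure.prod_prod,
    volume_cell_zero ha, volume_cell_zero hq, volume_cell_zero hb,
    ENNReal.ofReal_mul (hnonneg ha), ENNReal.ofReal_mul (hnonneg hq)]

theorem coords_latticePoint (i : (Fin r → ℤ) × (Fin d → ℤ) × (Fin d → ℤ)) :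
    (latticePoint e a q b i).coords =
      (fun j => i.1 j / a j, fun j => i.2.1 j / q j, fun j => i.2.2 j / b j) :=
  NilGroup.coords_ofCoords _

/-- The translate of the fundamental cell by the lattice point with exponents `(m, k, n)`: the
central coordinate is shifted by a bracket, which is determined by `x` and `k`. -/
def latticeTile (e : AdaptedBasis 𝔫 r d) (a : Fin r → ℝ) (q b : Fin d → ℝ)
    (i : (Fin r → ℤ) × (Fin d → ℤ) × (Fin d → ℤ)) : Set (NilGroup e) :=
  {g | g.coords.2.1 ∈ cell q i.2.1 ∧ g.coords.2.2 ∈ cell b i.2.2 ∧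
    g.coords.1 - NilGroup.bracketXY e (g.coords.2.2 - fun j => i.2.2 j / b j)
      (fun j => i.2.1 j / q j) ∈ cell a i.1}

theorem measurableSet_latticeTile (i : (Fin r → ℤ) × (Fin d → ℤ) × (Fin d → ℤ)) :
    MeasurableSet (latticeTile e a q b i) := by
  have hcoords : Measurable (NilGroup.coords (e := e)) := (measurePreserving_coords e).measurable
  have hz : Measurable fun g : NilGroup e => g.coords.1 -
      NilGroup.bracketXY e (g.coords.2.2 - fun j => i.2.2 j / b j) (fun j => i.2.1 j / q j) := by
    fun_prop
  exact (hcoords.snd.fst (measurableSet_cell q i.2.1)).inter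
    ((hcoords.snd.snd (measurableSet_cell b i.2.2)).inter (hz (measurableSet_cell a i.1)))

theorem pairwise_disjoint_latticeTile :
    Pairwise (Function.onFun Disjoint (latticeTile e a q b)) := by
  rintro ⟨m, k, n⟩ ⟨m', k', n'⟩ hne
  refine Set.disjoint_left.2 fun g ⟨hy, hx, hz⟩ ⟨hy', hx', hz'⟩ => hne ?_
  obtain rfl : k = k' := eq_of_mem_cell hy hy'
  obtain rfl : n = n' := eq_of_mem_cell hx hx'
  obtain rfl : m = m' := eq_of_mem_cell hz hz'
  rfl

theorem iUnion_latticeTile : ⋃ i, latticeTile e a q b i = Set.univ := by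
  refine Set.eq_univ_of_forall fun g => Set.mem_iUnion.2 ?_
  have hcell {n : ℕ} (c x : Fin n → ℝ) : ∃ m, x ∈ cell c m :=
    Set.mem_iUnion.1 (iUnion_cell c ▸ Set.mem_univ x)
  obtain ⟨k, hk⟩ := hcell q g.coords.2.1
  obtain ⟨n, hn⟩ := hcell b g.coords.2.2
  obtain ⟨m, hm⟩ := hcell a (g.coords.1 -
    NilGroup.bracketXY e (g.coords.2.2 - fun j => n j / b j) fun j => k j / q j)
  exact ⟨(m, k, n), hk, hn, hm⟩

theorem mul_latticePoint_mem_latticeTile_iff (ha : ∀ j, 0 < a j) (hq : ∀ j, 0 < q j)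
    (hb : ∀ j, 0 < b j) {g : NilGroup e} {i : (Fin r → ℤ) × (Fin d → ℤ) × (Fin d → ℤ)} :
    g * latticePoint e a q b i ∈ latticeTile e a q b i ↔ g ∈ fundamentalCell e a q b := by
  simp only [latticeTile, fundamentalCell, Set.mem_ofPred_eq, Set.mem_preimage, Set.mem_prod,
    coords_mul, coords_latticePoint, add_sub_cancel_right, add_div_mem_cell_iff ha,
    add_div_mem_cell_iff hq, add_div_mem_cell_iff hb]
  tauto

theorem lintegral_eq_tsum_latticePoint (ha : ∀ j, 0 < a j) (hq : ∀ j, 0 < q j) (hb : ∀ j, 0 < b j)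
    {F : NilGroup e → ℝ≥0∞} (hF : Measurable F) :
    ∫⁻ g, F g ∂NilGroup.haar e =
      ∑' i, ∫⁻ g in fundamentalCell e a q b, F (g * latticePoint e a q b i) ∂NilGroup.haar e :=
  lintegral_eq_tsum_of_tiling (measurableSet_latticeTile e) (pairwise_disjoint_latticeTile e)
    (iUnion_latticeTile e) (fun _ => measurePreserving_mul_right e _)
    (fun _ => Set.ext fun _ => mul_latticePoint_mem_latticeTile_iff e ha hq hb) hF

end QuasiLattice

section KernelCoordinates

instance : SigmaFinite (plancherelMeasure e) :=
  SigmaFinite.withDensity_ofReal _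

theorem measurable_vecMul_B : Measurable fun p : (Fin r → ℝ) × (Fin d → ℝ) => p.2 ᵥ* e.B p.1 :=
  (continuous_snd.matrix_vecMul ((continuous_B e).comp continuous_fst)).measurable

theorem lintegral_plancherelMeasure {F : (Fin r → ℝ) → ℝ≥0∞} (hF : Measurable F) :
    ∫⁻ l, F l ∂plancherelMeasure e = ∫⁻ l, ENNReal.ofReal |(e.B l).det| * F l :=
  lintegral_withDensity_eq_lintegral_mul _
    (continuous_det_B e).measurable.abs.ennreal_ofReal hF

/-- The density `|det B(l)|` of the Plancherel measure is the Jacobian of `t ↦ t B(l)`. -/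
theorem measurePreserving_vecMul_B :
    MeasurePreserving (fun p : (Fin r → ℝ) × (Fin d → ℝ) => (p.1, p.2 ᵥ* e.B p.1))
      ((plancherelMeasure e).prod volume) volume := by
  have hmeas : Measurable (fun p : (Fin r → ℝ) × (Fin d → ℝ) => (p.1, p.2 ᵥ* e.B p.1)) :=
    measurable_fst.prodMk (measurable_vecMul_B e)
  refine ⟨hmeas, Measure.ext_of_lintegral _ fun F hF => ?_⟩
  calc ∫⁻ p, F p ∂Measure.map _ ((plancherelMeasure e).prod volume)
      = ∫⁻ p, F (p.1, p.2 ᵥ* e.B p.1) ∂(plancherelMeasure e).prod volume :=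
        lintegral_map hF hmeas
    _ = ∫⁻ l, (∫⁻ t, F (l, t ᵥ* e.B l)) ∂plancherelMeasure e :=
        lintegral_prod _ (hF.comp hmeas).aemeasurable
    _ = ∫⁻ l, ENNReal.ofReal |(e.B l).det| * ∫⁻ t, F (l, t ᵥ* e.B l) :=
        lintegral_plancherelMeasure e (hF.comp hmeas).lintegral_prod_right'
    _ = ∫⁻ l, ∫⁻ w, F (l, w) := by
        refine lintegral_congr_ae ?_
        filter_upwards [ae_det_B_ne_zero e] with l hl
        exact lintegral_comp_vecMul hl (F := fun w => F (l, w)) (by fun_prop)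
    _ = ∫⁻ p, F p := (lintegral_prod _ hF.aemeasurable).symm

/-- The change of variables `(l, t, s) ↦ ((l, t B(l)), t - s)`, which takes the Plancherel measure
times `dt ds` to Lebesgue measure. -/
def kernelCoords (p : Coords r d) : ((Fin r → ℝ) × (Fin d → ℝ)) × (Fin d → ℝ) :=
  ((p.1, p.2.1 ᵥ* e.B p.1), p.2.1 - p.2.2)

theorem measurePreserving_prod_sub_left {G : Type*} [AddCommGroup G] [MeasurableSpace G]
    [MeasurableAdd₂ G] [MeasurableNeg G] (μ ν : Measure G) [SFinite μ] [SFinite ν]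
    [ν.IsAddLeftInvariant] [ν.IsNegInvariant] :
    MeasurePreserving (fun p : G × G => (p.1, p.1 - p.2)) (μ.prod ν) (μ.prod ν) :=
  (MeasurePreserving.id μ).skew_product measurable_sub
    (Eventually.of_forall fun t => (Measure.measurePreserving_sub_left ν t).map_eq)

theorem measurePreserving_kernelCoords :
    MeasurePreserving (kernelCoords e) ((plancherelMeasure e).prod volume) volume := by
  have hsub : MeasurePreserving
      (Prod.map id fun p : (Fin d → ℝ) × (Fin d → ℝ) => (p.1, p.1 - p.2))
      ((plancherelMeasure e).prod volume) ((plancherelMeasure e).prod (volume.prod volume)) :=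
    (MeasurePreserving.id _).prod (measurePreserving_prod_sub_left volume volume)
  have hassoc := (measurePreserving_prodAssoc (plancherelMeasure e)
    (volume : Measure (Fin d → ℝ)) (volume : Measure (Fin d → ℝ))).symm
  exact ((measurePreserving_vecMul_B e).prod (MeasurePreserving.id volume)).comp
    (hassoc.comp hsub)

end KernelCoordinates

section PartialFourier

variable {ι κ X : Type*} [Fintype ι] [Fintype κ] {G G' : ((ι → ℝ) × (κ → ℝ)) × X → ℂ}

/-- The Fourier transform (with the positive sign in the exponent) of a function of
`((z, y), x)` in the variables `z` and `y`. -/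
def partialFourier (G : ((ι → ℝ) × (κ → ℝ)) × X → ℂ) (p : ((ι → ℝ) × (κ → ℝ)) × X) : ℂ :=
  ∫ v, (𝐞 (p.1.1 ⬝ᵥ v.1 + p.1.2 ⬝ᵥ v.2) : ℂ) * G (v, p.2)

theorem partialFourier_smul (c : ℂ) : partialFourier (c • G) = c • partialFourier G := by
  ext p
  simp only [partialFourier, Pi.smul_apply, smul_eq_mul, ← integral_const_mul, mul_left_comm c]

variable [MeasurableSpace X] {ρ : Measure X}

theorem ae_ae_of_ae_volume_prod [SFinite ρ] {P : ((ι → ℝ) × (κ → ℝ)) × X → Prop}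
    (h : ∀ᵐ p ∂volume.prod ρ, P p) : ∀ᵐ x ∂ρ, ∀ᵐ v : (ι → ℝ) × (κ → ℝ), P (v, x) :=
  Measure.ae_ae_of_ae_prod (Measure.measurePreserving_swap.quasiMeasurePreserving.ae h)

theorem partialFourier_congr_ae [SFinite ρ] (h : G =ᵐ[volume.prod ρ] G') :
    partialFourier G =ᵐ[volume.prod ρ] partialFourier G' := by
  filter_upwards [Measure.quasiMeasurePreserving_snd.ae (ae_ae_of_ae_volume_prod h)] with p hp
  exact integral_congr_ae (hp.mono fun v hv => congrArg (_ * ·) hv)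

theorem stronglyMeasurable_partialFourier (hG : StronglyMeasurable G) :
    StronglyMeasurable (partialFourier G) := by
  have hphase : Continuous fun w : ((ι → ℝ) × (κ → ℝ)) × ((ι → ℝ) × (κ → ℝ)) =>
      (𝐞 (w.1.1 ⬝ᵥ w.2.1 + w.1.2 ⬝ᵥ w.2.2) : ℂ) := by fun_prop
  have hproj : Measurable fun p : (((ι → ℝ) × (κ → ℝ)) × X) × ((ι → ℝ) × (κ → ℝ)) =>
      (p.1.1, p.2) := by fun_prop
  exact ((hphase.measurable.comp hproj).stronglyMeasurable.mul
    (hG.comp_measurable (by fun_prop))).integral_prod_right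

theorem aestronglyMeasurable_partialFourier [SFinite ρ]
    (hG : AEStronglyMeasurable G (volume.prod ρ)) :
    AEStronglyMeasurable (partialFourier G) (volume.prod ρ) :=
  ⟨_, stronglyMeasurable_partialFourier hG.stronglyMeasurable_mk,
    partialFourier_congr_ae hG.ae_eq_mk⟩

theorem lintegral_enorm_sq_partialFourier [SFinite ρ] (h1 : Integrable G (volume.prod ρ))
    (h2 : MemLp G 2 (volume.prod ρ)) :
    ∫⁻ p, ‖partialFourier G p‖ₑ ^ 2 ∂volume.prod ρ = ∫⁻ p, ‖G p‖ₑ ^ 2 ∂volume.prod ρ := by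
  rw [lintegral_prod_symm _ (h1.1.enorm.pow_const 2),
    lintegral_prod_symm _ ((aestronglyMeasurable_partialFourier h1.1).enorm.pow_const 2)]
  refine lintegral_congr_ae ?_
  filter_upwards [h1.prod_left_ae,
    ae_memLp_two_prodMk (h2.comp_measurePreserving Measure.measurePreserving_swap)] with x hx hx'
  simp only [partialFourier]
  exact lintegral_enorm_sq_fourier_prod hx hx'

theorem integrable_fourierChar_mul {Y : Type*} [TopologicalSpace Y] [MeasurableSpace Y]
    [OpensMeasurableSpace Y] {μ : Measure Y} {f : Y → ℝ} (hf : Continuous f) {h : Y → ℂ}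
    (hh : Integrable h μ) :
    Integrable (fun v => (𝐞 (f v) : ℂ) * h v) μ :=
  hh.bdd_mul (continuous_coe_fourierChar hf).aestronglyMeasurable
    (Eventually.of_forall fun _ => (Circle.norm_coe _).le)

theorem partialFourier_add [SFinite ρ] (h : Integrable G (volume.prod ρ))
    (h' : Integrable G' (volume.prod ρ)) :
    partialFourier (G + G') =ᵐ[volume.prod ρ] partialFourier G + partialFourier G' := by
  filter_upwards [Measure.quasiMeasurePreserving_snd.ae h.prod_left_ae,
    Measure.quasiMeasurePreserving_snd.ae h'.prod_left_ae] with p hp hp'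
  simp only [partialFourier, Pi.add_apply, mul_add]
  exact integral_add (integrable_fourierChar_mul (by fun_prop) hp)
    (integrable_fourierChar_mul (by fun_prop) hp')

end PartialFourier

section FourierKernel

/-- The integral kernels `(l, t, s) ↦ k_l(t, s)` of the operators `∫ g(n) π_l(n) dn`, where `g`
is given in the coordinates of `N`. -/
def fourierKernel (g : Coords r d → ℂ) (p : Coords r d) : ℂ :=
  partialFourier (g ∘ MeasurableEquiv.prodAssoc) (kernelCoords e p)

theorem fourierKernel_apply (g : Coords r d → ℂ) (l : Fin r → ℝ) (t s : Fin d → ℝ) :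
    fourierKernel e g (l, t, s) = ∫ v : (Fin r → ℝ) × (Fin d → ℝ),
      (𝐞 (l ⬝ᵥ v.1 + t ⬝ᵥ (e.B l *ᵥ v.2)) : ℂ) * g (v.1, v.2, t - s) := by
  simp only [fourierKernel, kernelCoords, partialFourier, Matrix.dotProduct_mulVec]
  rfl

variable {g g' : Coords r d → ℂ}

theorem fourierKernel_congr_ae (h : g =ᵐ[volume] g') :
    fourierKernel e g =ᵐ[(plancherelMeasure e).prod volume] fourierKernel e g' :=
  (measurePreserving_kernelCoords e).quasiMeasurePreserving.ae
    (partialFourier_congr_ae (volume_preserving_prodAssoc.quasiMeasurePreserving.ae h))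

theorem aestronglyMeasurable_fourierKernel (hg : AEStronglyMeasurable g volume) :
    AEStronglyMeasurable (fourierKernel e g) ((plancherelMeasure e).prod volume) :=
  (aestronglyMeasurable_partialFourier (hg.comp_measurePreserving
    volume_preserving_prodAssoc)).comp_measurePreserving (measurePreserving_kernelCoords e)

theorem eLpNorm_fourierKernel (h1 : Integrable g) (h2 : MemLp g 2) :
    eLpNorm (fourierKernel e g) 2 ((plancherelMeasure e).prod volume) = eLpNorm g 2 volume := by
  have hassoc := volume_preserving_prodAssoc (α₁ := Fin r → ℝ) (β₁ := Fin d → ℝ) (γ₁ := Fin d → ℝ)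
  have h1' := hassoc.integrable_comp_of_integrable h1
  refine (eLpNorm_comp_measurePreserving (aestronglyMeasurable_partialFourier h1'.1)
    (measurePreserving_kernelCoords e)).trans ?_
  rw [← eLpNorm_comp_measurePreserving h2.1 hassoc]
  refine (ENNReal.pow_right_strictMono two_ne_zero).injective ?_
  simp only [eLpNorm_two_sq]
  exact lintegral_enorm_sq_partialFourier h1' (h2.comp_measurePreserving hassoc)

theorem memLp_fourierKernel (h1 : Integrable g) (h2 : MemLp g 2) :
    MemLp (fourierKernel e g) 2 ((plancherelMeasure e).prod volume) :=
  ⟨aestronglyMeasurable_fourierKernel e h1.1, (eLpNorm_fourierKernel e h1 h2).symm ▸ h2.2⟩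

theorem fourierKernel_add (h : Integrable g) (h' : Integrable g') :
    fourierKernel e (g + g') =ᵐ[(plancherelMeasure e).prod volume]
      fourierKernel e g + fourierKernel e g' :=
  (measurePreserving_kernelCoords e).quasiMeasurePreserving.ae (partialFourier_add
    (volume_preserving_prodAssoc.integrable_comp_of_integrable h)
    (volume_preserving_prodAssoc.integrable_comp_of_integrable h'))

theorem fourierKernel_smul (c : ℂ) (g : Coords r d → ℂ) :
    fourierKernel e (c • g) = c • fourierKernel e g :=
  funext fun p => congrFun (partialFourier_smul c) (kernelCoords e p)

end FourierKernel

section WeakIntegral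

theorem inner_piRep (l : Fin r → ℝ) (p : Coords r d) (χ ψ : L2 d) :
    inner ℂ χ (piRep e l (NilGroup.ofCoords e p) ψ) =
      ∫ t, conj (χ t) * ((𝐞 (l ⬝ᵥ p.1 + t ⬝ᵥ (e.B l *ᵥ p.2.1)) : ℂ) * ψ (t - p.2.2)) := by
  rw [inner_Lp_eq_integral]
  refine integral_congr_ae ?_
  filter_upwards [(memLp_pi e l (NilGroup.ofCoords e p).coords ψ).coeFn_toLp] with t ht
  rw [piRep, ht, NilGroup.coords_ofCoords]
  rfl

section Translates

variable {A Y : Type*} [MeasurableSpace A] [AddGroup A] [MeasurableSpace Y] {μ : Measure A}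
  {ν : Measure Y}

theorem memLp_comp_sub_right [MeasurableAdd A] [μ.IsAddRightInvariant] (ψ : Lp ℂ 2 μ) (x : A) :
    MemLp (fun t => ψ (t - x)) 2 μ :=
  (Lp.memLp ψ).comp_measurePreserving (measurePreserving_sub_right μ x)

theorem integrable_norm_mul_norm_sub [MeasurableAdd A] [μ.IsAddRightInvariant] (χ ψ : Lp ℂ 2 μ)
    (x : A) : Integrable (fun t => ‖χ t‖ * ‖ψ (t - x)‖) μ :=
  (Lp.memLp χ).norm.integrable_mul (memLp_comp_sub_right ψ x).norm

theorem integral_norm_mul_norm_sub_le [MeasurableAdd A] [μ.IsAddRightInvariant]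
    (χ ψ : Lp ℂ 2 μ) (x : A) :
    ∫ t, ‖χ t‖ * ‖ψ (t - x)‖ ∂μ ≤ (∫ t, ‖χ t‖ ^ 2 ∂μ) + ∫ t, ‖ψ t‖ ^ 2 ∂μ := by
  have hχ : Integrable (fun t => ‖χ t‖ ^ 2) μ := (Lp.memLp χ).integrable_norm_pow two_ne_zero
  have hψ : Integrable (fun t => ‖ψ (t - x)‖ ^ 2) μ :=
    (memLp_comp_sub_right ψ x).integrable_norm_pow two_ne_zero
  rw [← integral_sub_right_eq_self (fun t => ‖ψ t‖ ^ 2) x, ← integral_add hχ hψ]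
  refine integral_mono (integrable_norm_mul_norm_sub χ ψ x) (hχ.add hψ) fun t => ?_
  dsimp only
  nlinarith [two_mul_le_add_sq ‖χ t‖ ‖ψ (t - x)‖, sq_nonneg ‖χ t‖, sq_nonneg ‖ψ (t - x)‖]

theorem integrable_conj_mul_mul_sub [MeasurableAdd₂ A] [MeasurableNeg A] [SFinite μ] [SFinite ν]
    [μ.IsAddRightInvariant] (χ ψ : Lp ℂ 2 μ) {g : Y → ℂ} (hg : Integrable g ν) {x : Y → A}
    (hx : Measurable x) :
    Integrable (fun w : A × Y => conj (χ w.1) * g w.2 * ψ (w.1 - x w.2)) (μ.prod ν) := by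
  have hmeas : AEStronglyMeasurable (fun w : A × Y => conj (χ w.1) * g w.2 * ψ (w.1 - x w.2))
      (μ.prod ν) :=
    ((Lp.aestronglyMeasurable χ).star.comp_fst.mul hg.1.comp_snd).mul
      ((Lp.stronglyMeasurable ψ).comp_measurable (by fun_prop)).aestronglyMeasurable
  have hnorm : ∀ (t : A) (y : Y),
      ‖conj (χ t) * g y * ψ (t - x y)‖ = ‖g y‖ * (‖χ t‖ * ‖ψ (t - x y)‖) := fun t y => by
    rw [norm_mul, norm_mul, RCLike.norm_conj]
    ring
  rw [integrable_prod_iff' hmeas]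
  constructor
  · filter_upwards [hmeas.prodMk_right] with y hy
    exact ((integrable_norm_mul_norm_sub χ ψ (x y)).const_mul ‖g y‖).mono' hy
      (Eventually.of_forall fun t => (hnorm t y).le)
  · refine (hg.norm.mul_const ((∫ t, ‖χ t‖ ^ 2 ∂μ) + ∫ t, ‖ψ t‖ ^ 2 ∂μ)).mono'
      hmeas.norm.prod_swap.integral_prod_right' (Eventually.of_forall fun y => ?_)
    simp only [hnorm, integral_const_mul]
    rw [Real.norm_of_nonneg (mul_nonneg (norm_nonneg _) (integral_nonneg fun t => by positivity))]
    exact mul_le_mul_of_nonneg_left (integral_norm_mul_norm_sub_le χ ψ (x y)) (norm_nonneg _)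

end Translates

/-- The change of variables `((t, s), (z, y)) ↦ (t, (z, y, t - s))`. -/
def differenceEquiv (r d : ℕ) : ((Fin d → ℝ) × (Fin d → ℝ)) × ((Fin r → ℝ) × (Fin d → ℝ)) ≃ᵐ
    (Fin d → ℝ) × Coords r d :=
  (MeasurableEquiv.prodCongr (MeasurableEquiv.ofInvolutive
    (fun p : (Fin d → ℝ) × (Fin d → ℝ) => (p.1, p.1 - p.2))
    (fun p => Prod.ext rfl (sub_sub_cancel p.1 p.2)) (by fun_prop))
    (MeasurableEquiv.refl _)).trans <| MeasurableEquiv.prodAssoc.trans <|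
      MeasurableEquiv.prodCongr (MeasurableEquiv.refl _)
        (MeasurableEquiv.prodComm.trans MeasurableEquiv.prodAssoc)

theorem measurePreserving_differenceEquiv (r d : ℕ) : MeasurePreserving (differenceEquiv r d) :=
  ((MeasurePreserving.id _).prod
    (volume_preserving_prodAssoc.comp Measure.measurePreserving_swap)).comp
    (volume_preserving_prodAssoc.comp
      ((measurePreserving_prod_sub_left volume volume).prod (MeasurePreserving.id _)))

theorem integral_integral_sub_eq {W : (Fin d → ℝ) × Coords r d → ℂ}
    (hW : Integrable W (volume.prod volume)) :
    ∫ p : (Fin d → ℝ) × (Fin d → ℝ), ∫ v : (Fin r → ℝ) × (Fin d → ℝ),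
      W (p.1, (v.1, v.2, p.1 - p.2)) = ∫ q, ∫ t, W (t, q) := by
  have hdiff := measurePreserving_differenceEquiv r d
  have hemb := (differenceEquiv r d).measurableEmbedding
  exact ((integral_prod _ ((hdiff.integrable_comp_emb hemb).2 hW)).symm.trans
    (hdiff.integral_comp hemb W)).trans (integral_prod_symm W hW)

theorem integral_fourierKernel {g : Coords r d → ℂ} (hg : Integrable g) (l : Fin r → ℝ)
    (χ ψ : L2 d) :
    ∫ p : (Fin d → ℝ) × (Fin d → ℝ), conj (χ p.1) * fourierKernel e g (l, p) * ψ p.2 =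
      ∫ p, g p * inner ℂ χ (piRep e l (NilGroup.ofCoords e p) ψ) := by
  let W : (Fin d → ℝ) × Coords r d → ℂ := fun w =>
    (𝐞 (l ⬝ᵥ w.2.1 + w.1 ⬝ᵥ (e.B l *ᵥ w.2.2.1)) : ℂ) *
      (conj (χ w.1) * g w.2 * ψ (w.1 - w.2.2.2))
  have hphase : Continuous fun w : (Fin d → ℝ) × Coords r d =>
      l ⬝ᵥ w.2.1 + w.1 ⬝ᵥ (e.B l *ᵥ w.2.2.1) := by fun_prop
  have hamp : Integrable (fun w : (Fin d → ℝ) × Coords r d =>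
      conj (χ w.1) * g w.2 * ψ (w.1 - w.2.2.2)) (volume.prod volume) :=
    integrable_conj_mul_mul_sub χ ψ hg (x := fun q : Coords r d => q.2.2) (by fun_prop)
  have hW : Integrable W (volume.prod volume) := integrable_fourierChar_mul hphase hamp
  have hleft : ∀ p : (Fin d → ℝ) × (Fin d → ℝ),
      conj (χ p.1) * fourierKernel e g (l, p) * ψ p.2 =
        ∫ v : (Fin r → ℝ) × (Fin d → ℝ), W (p.1, (v.1, v.2, p.1 - p.2)) := fun p => by
    rw [fourierKernel_apply e g l p.1 p.2, ← integral_const_mul, ← integral_mul_const]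
    refine integral_congr_ae (Eventually.of_forall fun v => ?_)
    simp only [W, sub_sub_cancel]
    ring
  have hright : ∀ p : Coords r d,
      g p * inner ℂ χ (piRep e l (NilGroup.ofCoords e p) ψ) = ∫ t, W (t, p) := fun p => by
    rw [inner_piRep, ← integral_const_mul]
    refine integral_congr_ae (Eventually.of_forall fun t => ?_)
    simp only [W]
    ring
  simp only [hleft, hright]
  exact integral_integral_sub_eq hW

end WeakIntegral

section PlancherelTransform

instance : TopologicalSpace.SeparableSpace (L2 d) :=
  have : Fact ((2 : ℝ≥0∞) ≠ ∞) := ⟨ENNReal.ofNat_ne_top⟩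
  inferInstance

theorem integrable_comp_ofCoords {f : NilGroup e → ℂ} (h : Integrable f (NilGroup.haar e)) :
    Integrable (f ∘ NilGroup.ofCoords e) :=
  (measurePreserving_ofCoords e).integrable_comp_of_integrable h

theorem memLp_comp_ofCoords (f : L2N e) : MemLp (f ∘ NilGroup.ofCoords e) 2 :=
  (Lp.memLp f).comp_measurePreserving (measurePreserving_ofCoords e)

theorem isFourierTransform_iff {f : L2N e} (hf : Integrable f (NilGroup.haar e)) (G : L2Dual e) :
    IsFourierTransform e f G ↔
      G =ᵐ[(plancherelMeasure e).prod volume] fourierKernel e (f ∘ NilGroup.ofCoords e) := by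
  have hk := memLp_fourierKernel e (integrable_comp_ofCoords e hf) (memLp_comp_ofCoords e f)
  have hweak : ∀ l (ψ χ : L2 d), ∫ n, f n * inner ℂ χ (piRep e l n ψ) ∂NilGroup.haar e =
      ∫ p : (Fin d → ℝ) × (Fin d → ℝ),
        conj (χ p.1) * fourierKernel e (f ∘ NilGroup.ofCoords e) (l, p) * ψ p.2 := fun l ψ χ => by
    rw [integral_fourierKernel e (integrable_comp_ofCoords e hf),
      ← (measurePreserving_ofCoords e).integral_comp (measurableEmbedding_ofCoords e)]
    rfl
  simp only [IsFourierTransform, hweak]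
  refine ⟨fun h => ae_eq_prod_of_ae_ae_eq (Lp.aestronglyMeasurable G) hk.1 ?_, fun h => ?_⟩
  · filter_upwards [h, ae_memLp_two_prodMk (Lp.memLp G), ae_memLp_two_prodMk hk] with l hl hGl hkl
    refine ae_eq_of_kernelOperator_eq hGl hkl
      (ContinuousLinearMap.ext fun ψ => ext_inner_left ℂ fun χ => ?_)
    rw [inner_kernelOperator, inner_kernelOperator]
    exact hl ψ χ
  · filter_upwards [Measure.ae_ae_of_ae_prod h] with l hl ψ χ
    exact integral_congr_ae (hl.mono fun p hp => by simp only [hp])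

/-- The subspace `L¹(N) ∩ L²(N)` of `L²(N)`. -/
def integrableSubmodule : Submodule ℂ (L2N e) where
  carrier := {f | Integrable f (NilGroup.haar e)}
  add_mem' {f g} hf hg := (integrable_congr (Lp.coeFn_add f g)).2 (hf.add hg)
  zero_mem' := (integrable_congr (Lp.coeFn_zero ℂ 2 (NilGroup.haar e))).2 (integrable_zero _ _ _)
  smul_mem' c f hf := (integrable_congr (Lp.coeFn_smul c f)).2 (hf.smul c)

/-- The Fourier transform of an element of `L¹(N) ∩ L²(N)`. -/
def fourierLp (f : integrableSubmodule e) : L2Dual e :=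
  (memLp_fourierKernel e (integrable_comp_ofCoords e f.2) (memLp_comp_ofCoords e f.1)).toLp _

theorem coeFn_fourierLp (f : integrableSubmodule e) :
    fourierLp e f =ᵐ[(plancherelMeasure e).prod volume]
      fourierKernel e (f.1 ∘ NilGroup.ofCoords e) :=
  MemLp.coeFn_toLp _

theorem fourierLp_eq_of_ae_eq {f : integrableSubmodule e} {G : L2Dual e} {g : NilGroup e → ℂ}
    (hf : f.1 =ᵐ[NilGroup.haar e] g)
    (hG : G =ᵐ[(plancherelMeasure e).prod volume] fourierKernel e (g ∘ NilGroup.ofCoords e)) :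
    fourierLp e f = G :=
  Lp.ext (((coeFn_fourierLp e f).trans (fourierKernel_congr_ae e
    ((measurePreserving_ofCoords e).quasiMeasurePreserving.ae hf))).trans hG.symm)

theorem norm_fourierLp (f : integrableSubmodule e) : ‖fourierLp e f‖ = ‖f‖ := by
  rw [fourierLp, Lp.norm_toLp, eLpNorm_fourierKernel e (integrable_comp_ofCoords e f.2)
    (memLp_comp_ofCoords e f.1)]
  exact congrArg ENNReal.toReal (eLpNorm_comp_measurePreserving (Lp.aestronglyMeasurable f.1)
    (measurePreserving_ofCoords e))

/-- The Fourier transform on `L¹(N) ∩ L²(N)` as a linear isometry. -/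
def fourierIsometry : integrableSubmodule e →ₗᵢ[ℂ] L2Dual e where
  toFun := fourierLp e
  map_add' f g := fourierLp_eq_of_ae_eq e (Lp.coeFn_add f.1 g.1)
    (((Lp.coeFn_add _ _).trans ((coeFn_fourierLp e f).add (coeFn_fourierLp e g))).trans
      (fourierKernel_add e (integrable_comp_ofCoords e f.2) (integrable_comp_ofCoords e g.2)).symm)
  map_smul' c f := fourierLp_eq_of_ae_eq e (Lp.coeFn_smul c f.1)
    (((Lp.coeFn_smul _ _).trans ((coeFn_fourierLp e f).const_smul c)).trans
      (EventuallyEq.of_eq (fourierKernel_smul e c _).symm))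
  norm_map' := norm_fourierLp e

theorem denseRange_integrableSubmodule : DenseRange (integrableSubmodule e).subtype := by
  have h : Dense (integrableSubmodule e : Set (L2N e)) := by
    refine (Lp.simpleFunc.dense (E := ℂ) (p := 2) (μ := NilGroup.haar e)
      ENNReal.ofNat_ne_top).mono fun f hf => ?_
    have hf' := Lp.simpleFunc.memLp (⟨f, hf⟩ : Lp.simpleFunc ℂ 2 (NilGroup.haar e))
    rw [SimpleFunc.memLp_iff_integrable two_ne_zero ENNReal.ofNat_ne_top] at hf'
    exact (integrable_congr (Lp.simpleFunc.toSimpleFunc_eq_toFun _)).1 hf'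
  rwa [DenseRange, Submodule.coe_subtype, Subtype.range_coe]

/-- The continuous linear extension of the Fourier transform from `L¹(N) ∩ L²(N)` to `L²(N)`. -/
def plancherelCLM : L2N e →L[ℂ] L2Dual e :=
  (fourierIsometry e).toLinearMap.extendOfNorm (integrableSubmodule e).subtype

theorem plancherelCLM_coe (f : integrableSubmodule e) : plancherelCLM e f = fourierLp e f :=
  LinearMap.extendOfNorm_eq (denseRange_integrableSubmodule e)
    ⟨1, fun f => by rw [one_mul]; exact (norm_fourierLp e f).le⟩ f

/-- The Plancherel transform as a linear isometry, see `plancherel_eq`. -/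
def plancherelIsometry : L2N e →ₗᵢ[ℂ] L2Dual e where
  toLinearMap := plancherelCLM e
  norm_map' f := (denseRange_integrableSubmodule e).induction_on
    (p := fun f => ‖plancherelCLM e f‖ = ‖f‖) f (isClosed_eq (by fun_prop) (by fun_prop)) fun f =>
    (congrArg norm (plancherelCLM_coe e f)).trans (norm_fourierLp e f)

theorem plancherelIsometry_coe (f : integrableSubmodule e) :
    plancherelIsometry e f = fourierLp e f :=
  plancherelCLM_coe e f

theorem mem_fourierGraph_iff {f : L2N e} {G : L2Dual e} :
    (f, G) ∈ fourierGraph e ↔ f ∈ integrableSubmodule e ∧ G = plancherelIsometry e f := by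
  refine and_congr_right fun hf => (isFourierTransform_iff e hf G).trans ?_
  rw [plancherelIsometry_coe e ⟨f, hf⟩]
  exact ⟨fun h => Lp.ext (h.trans (coeFn_fourierLp e ⟨f, hf⟩).symm),
    fun h => h ▸ coeFn_fourierLp e ⟨f, hf⟩⟩

theorem fourierGraph_limit_neBot (f : L2N e) :
    (comap Prod.fst (𝓝 f) ⊓ 𝓟 (fourierGraph e)).NeBot := by
  rw [inf_principal_neBot_iff]
  rintro U ⟨V, hV, hVU⟩
  obtain ⟨g, hgV, g', rfl⟩ := mem_closure_iff_nhds.1 (denseRange_integrableSubmodule e f) V hV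
  exact ⟨(g', plancherelIsometry e g'), hVU hgV, (mem_fourierGraph_iff e).2 ⟨g'.2, rfl⟩⟩

theorem plancherel_eq (f : L2N e) : plancherel e f = plancherelIsometry e f := by
  have := fourierGraph_limit_neBot e f
  refine Tendsto.limUnder_eq ?_
  have hlim : Tendsto (fun p : L2N e × L2Dual e => plancherelIsometry e p.1)
      (comap Prod.fst (𝓝 f) ⊓ 𝓟 (fourierGraph e)) (𝓝 (plancherelIsometry e f)) :=
    ((plancherelIsometry e).continuous.tendsto f).comp (tendsto_comap.mono_left inf_le_left)
  refine hlim.congr' ?_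
  filter_upwards [mem_inf_of_right (mem_principal_self _)] with p hp
  exact ((mem_fourierGraph_iff e).1 hp).2.symm

end PlancherelTransform

section Intertwining

/-- Left translation by the element with coordinates `c`, as a transformation of the coordinates
`(z, y)`. -/
def shearEquiv (c : Coords r d) :
    (Fin r → ℝ) × (Fin d → ℝ) ≃ᵐ (Fin r → ℝ) × (Fin d → ℝ) where
  toFun v := (c.1 + v.1 + NilGroup.bracketXY e c.2.2 v.2, c.2.1 + v.2)
  invFun v := (v.1 - NilGroup.bracketXY e c.2.2 (v.2 - c.2.1) - c.1, v.2 - c.2.1)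
  left_inv v := by ext <;> simp
  right_inv v := by ext <;> simp
  measurable_toFun := by simp only [Equiv.coe_fn_mk]; fun_prop
  measurable_invFun := by simp only [Equiv.coe_fn_symm_mk]; fun_prop

theorem shearEquiv_apply (c : Coords r d) (v : (Fin r → ℝ) × (Fin d → ℝ)) :
    shearEquiv e c v = (c.1 + v.1 + NilGroup.bracketXY e c.2.2 v.2, c.2.1 + v.2) := rfl

theorem measurePreserving_shearEquiv (c : Coords r d) : MeasurePreserving (shearEquiv e c) := by
  have hskew : MeasurePreserving
      (fun w : (Fin d → ℝ) × (Fin r → ℝ) =>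
        (c.2.1 + w.1, c.1 + w.2 + NilGroup.bracketXY e c.2.2 w.1))
      (volume.prod volume) (volume.prod volume) :=
    (measurePreserving_add_left volume c.2.1).skew_product
      (g := fun w z => c.1 + z + NilGroup.bracketXY e c.2.2 w) (by fun_prop)
      (Eventually.of_forall fun w =>
        ((measurePreserving_add_right volume (NilGroup.bracketXY e c.2.2 w)).comp
          (measurePreserving_add_left volume c.1)).map_eq)
  exact Measure.measurePreserving_swap.comp (hskew.comp Measure.measurePreserving_swap)

/-- The phase of `π_l(n)` acting on integral kernels `k(t, s)`, at the point `p = (l, t, s)`, where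
`n` has coordinates `c`. -/
def dualPhase (c p : Coords r d) : ℂ := 𝐞 (p.1 ⬝ᵥ c.1 + p.2.1 ⬝ᵥ (e.B p.1 *ᵥ c.2.1))

theorem norm_dualPhase (c p : Coords r d) : ‖dualPhase e c p‖ = 1 := Circle.norm_coe _

theorem continuous_dualPhase : Continuous fun w : Coords r d × Coords r d =>
    dualPhase e w.1 w.2 := by
  have hphase : Continuous fun w : Coords r d × Coords r d =>
      w.2.1 ⬝ᵥ w.1.1 + w.2.2.1 ⬝ᵥ (e.B w.2.1 *ᵥ w.1.2.1) := by fun_prop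
  exact continuous_coe_fourierChar hphase

/-- Translation by `x` in the first variable of the integral kernels. -/
def dualShift (x : Fin d → ℝ) (p : Coords r d) : Coords r d := (p.1, p.2.1 - x, p.2.2)

theorem measurePreserving_dualShift (x : Fin d → ℝ) :
    MeasurePreserving (dualShift (r := r) x) ((plancherelMeasure e).prod volume)
      ((plancherelMeasure e).prod volume) :=
  (MeasurePreserving.id _).prod
    ((measurePreserving_sub_right volume x).prod (MeasurePreserving.id volume))

theorem fourierKernel_translate (f : NilGroup e → ℂ) (g : NilGroup e) (p : Coords r d) :
    fourierKernel e ((fun n => f (g⁻¹ * n)) ∘ NilGroup.ofCoords e) p =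
      dualPhase e g.coords p *
        fourierKernel e (f ∘ NilGroup.ofCoords e) (dualShift g.coords.2.2 p) := by
  obtain ⟨l, t, s⟩ := p
  set c := g.coords
  have hg : g = NilGroup.ofCoords e c := (NilGroup.ofCoords_coords g).symm
  simp only [dualShift, dualPhase]
  rw [fourierKernel_apply, fourierKernel_apply, ← integral_const_mul,
    ← (measurePreserving_shearEquiv e c).integral_comp (shearEquiv e c).measurableEmbedding]
  refine integral_congr_ae (Eventually.of_forall fun v => ?_)
  simp only [shearEquiv_apply, Function.comp_apply]
  rw [← mul_assoc, ← fourierChar_add]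
  refine congrArg₂ (fun (x : ℝ) (y : ℂ) => (𝐞 x : ℂ) * y) ?_ (congrArg f ?_)
  · simp only [dotProduct_add, dotProduct_bracketXY, Matrix.mulVec_add, sub_dotProduct]
    ring
  · rw [inv_mul_eq_iff_eq_mul, hg, NilGroup.ofCoords_mul,
      show c.2.2 + (t - c.2.2 - s) = t - s by abel]

theorem memLp_dualAction (c : Coords r d) (G : L2Dual e) :
    MemLp (fun p => dualPhase e c p * G (dualShift c.2.2 p)) 2
      ((plancherelMeasure e).prod volume) := by
  have hphase : Continuous (dualPhase e c) :=
    (continuous_dualPhase e).comp (Continuous.prodMk_right c)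
  have hshift := (Lp.memLp G).comp_measurePreserving (measurePreserving_dualShift e c.2.2)
  refine hshift.of_le (hphase.aestronglyMeasurable.mul hshift.1)
    (Eventually.of_forall fun p => le_of_eq ?_)
  simp only [norm_mul, norm_dualPhase, one_mul, Function.comp_apply]

/-- The operators `π_l(n)` acting from the left on fields of Hilbert-Schmidt operators, where `n`
has coordinates `c`. -/
def dualAction (c : Coords r d) (G : L2Dual e) : L2Dual e := (memLp_dualAction e c G).toLp _

theorem coeFn_dualAction (c : Coords r d) (G : L2Dual e) :
    dualAction e c G =ᵐ[(plancherelMeasure e).prod volume]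
      fun p => dualPhase e c p * G (dualShift c.2.2 p) := MemLp.coeFn_toLp _

theorem norm_dualAction (c : Coords r d) (G : L2Dual e) : ‖dualAction e c G‖ = ‖G‖ := by
  rw [dualAction, Lp.norm_toLp, Lp.norm_def,
    ← eLpNorm_comp_measurePreserving (Lp.aestronglyMeasurable G)
      (measurePreserving_dualShift e c.2.2)]
  congr 1
  refine eLpNorm_congr_norm_ae (Eventually.of_forall fun p => ?_)
  simp only [norm_mul, norm_dualPhase, one_mul, Function.comp_apply]

theorem dualAction_sub (c : Coords r d) (G G' : L2Dual e) :
    dualAction e c (G - G') = dualAction e c G - dualAction e c G' := by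
  refine Lp.ext ?_
  filter_upwards [coeFn_dualAction e c (G - G'), coeFn_dualAction e c G, coeFn_dualAction e c G',
    Lp.coeFn_sub (dualAction e c G) (dualAction e c G'),
    (measurePreserving_dualShift e c.2.2).quasiMeasurePreserving.ae (Lp.coeFn_sub G G')]
    with p hsub hG hG' hsub' hshift
  rw [hsub, hsub', Pi.sub_apply, hG, hG', hshift, Pi.sub_apply, mul_sub]

theorem isometry_dualAction (c : Coords r d) : Isometry (dualAction e c) :=
  Isometry.of_dist_eq fun G G' => by
    rw [dist_eq_norm, dist_eq_norm, ← dualAction_sub, norm_dualAction]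

theorem coeFn_leftRegular (g : NilGroup e) (f : L2N e) :
    leftRegular e g f =ᵐ[NilGroup.haar e] fun n => f (g⁻¹ * n) :=
  Lp.coeFn_compMeasurePreserving f (NilGroup.measurePreserving_mul_left g⁻¹)

theorem isometry_leftRegular (g : NilGroup e) : Isometry (leftRegular e g) :=
  Lp.isometry_compMeasurePreserving (NilGroup.measurePreserving_mul_left g⁻¹)

theorem fourierLp_leftRegular (g : NilGroup e) (f : integrableSubmodule e) :
    plancherelIsometry e (leftRegular e g f) = dualAction e g.coords (fourierLp e f) := by
  have hL : Integrable (leftRegular e g f) (NilGroup.haar e) :=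
    (integrable_congr (coeFn_leftRegular e g f)).2
      ((NilGroup.measurePreserving_mul_left g⁻¹).integrable_comp_of_integrable f.2)
  refine (plancherelIsometry_coe e ⟨_, hL⟩).trans
    (fourierLp_eq_of_ae_eq e (coeFn_leftRegular e g f) ?_)
  filter_upwards [coeFn_dualAction e g.coords (fourierLp e f),
    (measurePreserving_dualShift e g.coords.2.2).quasiMeasurePreserving.ae (coeFn_fourierLp e f)]
    with p hp hshift
  rw [hp, hshift, ← fourierKernel_translate]

theorem plancherelIsometry_leftRegular (g : NilGroup e) (f : L2N e) :
    plancherelIsometry e (leftRegular e g f) =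
      dualAction e g.coords (plancherelIsometry e f) :=
  (denseRange_integrableSubmodule e).induction_on
    (p := fun f => plancherelIsometry e (leftRegular e g f) =
      dualAction e g.coords (plancherelIsometry e f)) f
    (isClosed_eq ((plancherelIsometry e).continuous.comp (isometry_leftRegular e g).continuous)
      ((isometry_dualAction e _).continuous.comp (plancherelIsometry e).continuous)) fun f =>
    (fourierLp_leftRegular e g f).trans
      (congrArg (dualAction e g.coords) (plancherelIsometry_coe e f).symm)

end Intertwining

section LeftRegular

theorem norm_leftRegular (g : NilGroup e) (f : L2N e) : ‖leftRegular e g f‖ = ‖f‖ :=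
  Lp.norm_compMeasurePreserving f (NilGroup.measurePreserving_mul_left g⁻¹)

theorem inner_leftRegular_leftRegular (g : NilGroup e) (f h : L2N e) :
    inner ℂ (leftRegular e g f) (leftRegular e g h) = inner ℂ f h :=
  LinearIsometry.inner_map_map (Lp.compMeasurePreservingₗᵢ ℂ (fun n => g⁻¹ * n)
    (NilGroup.measurePreserving_mul_left g⁻¹) : L2N e →ₗᵢ[ℂ] L2N e) f h

theorem leftRegular_mul (g h : NilGroup e) (f : L2N e) :
    leftRegular e (g * h) f = leftRegular e g (leftRegular e h f) := by
  refine Lp.ext ?_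
  filter_upwards [coeFn_leftRegular e (g * h) f, coeFn_leftRegular e g (leftRegular e h f),
    (NilGroup.measurePreserving_mul_left g⁻¹).quasiMeasurePreserving.ae (coeFn_leftRegular e h f)]
    with n hgh hg hh
  rw [hgh, hg, hh, mul_inv_rev, mul_assoc]

theorem leftRegular_one (f : L2N e) : leftRegular e 1 f = f := by
  refine Lp.ext ?_
  filter_upwards [coeFn_leftRegular e 1 f] with n hn
  rw [hn, inv_one, one_mul]

theorem inner_leftRegular_mul (g h : NilGroup e) (f f' : L2N e) :
    inner ℂ (leftRegular e (g * h) f) f' =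
      inner ℂ (leftRegular e h f) (leftRegular e g⁻¹ f') := by
  rw [leftRegular_mul, ← inner_leftRegular_leftRegular e g⁻¹, ← leftRegular_mul,
    inv_mul_cancel, leftRegular_one]

theorem inner_leftRegular_eq_integral (g : NilGroup e) (f f' : L2N e) :
    inner ℂ (leftRegular e g f) f' =
      ∫ w, conj (dualPhase e g.coords w * plancherelIsometry e f (dualShift g.coords.2.2 w)) *
        plancherelIsometry e f' w ∂(plancherelMeasure e).prod volume := by
  rw [← (plancherelIsometry e).inner_map_map, inner_Lp_eq_integral,
    plancherelIsometry_leftRegular]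
  refine integral_congr_ae ?_
  filter_upwards [coeFn_dualAction e g.coords (plancherelIsometry e f)] with w hw
  rw [hw]

theorem stronglyMeasurable_inner_leftRegular (f f' : L2N e) :
    StronglyMeasurable fun g : NilGroup e => inner ℂ (leftRegular e g f) f' := by
  have hshift : Measurable fun w : Coords r d × Coords r d => dualShift w.1.2.2 w.2 := by
    unfold dualShift
    fun_prop
  have hfield : StronglyMeasurable fun w : Coords r d × Coords r d =>
      conj (dualPhase e w.1 w.2 * plancherelIsometry e f (dualShift w.1.2.2 w.2)) *
        plancherelIsometry e f' w.2 :=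
    (Complex.continuous_conj.comp_stronglyMeasurable
      ((continuous_dualPhase e).stronglyMeasurable.mul
        ((Lp.stronglyMeasurable _).comp_measurable hshift))).mul
      ((Lp.stronglyMeasurable _).comp_measurable measurable_snd)
  simp only [inner_leftRegular_eq_integral]
  exact (hfield.integral_prod_right' (ν := (plancherelMeasure e).prod volume)).comp_measurable
    (NilGroup.coordsMeasurableEquiv e).measurable

end LeftRegular

section BandLimited

variable {I : Set (Fin r → ℝ)} {P : (Fin r → ℝ) → L2 d →L[ℂ] L2 d} {e}

theorem mem_directIntegral_of_ae_eq_mul {G G' : L2Dual e} (hG : G ∈ directIntegral e I P)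
    (c : (Fin r → ℝ) → (Fin d → ℝ) → ℂ) (x : Fin d → ℝ)
    (h : G' =ᵐ[(plancherelMeasure e).prod volume]
      fun p => c p.1 p.2.1 * G (p.1, p.2.1 - x, p.2.2)) :
    G' ∈ directIntegral e I P := by
  have hshift := (measurePreserving_sub_right (volume : Measure (Fin d → ℝ)) x
    ).quasiMeasurePreserving
  change ∀ᵐ l ∂plancherelMeasure e, _
  filter_upwards [hG, Measure.ae_ae_of_ae_prod h] with l ⟨hmem, hzero⟩ hl
  have hl := Measure.ae_ae_of_ae_prod hl
  constructor
  · intro hI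
    filter_upwards [hshift.ae (hmem hI), hl] with t ⟨u, ⟨v, hv⟩, hu⟩ ht
    refine ⟨conj (c l t) • u, ⟨conj (c l t) • v, by rw [map_smul, hv]⟩, ?_⟩
    filter_upwards [hu, ht, Lp.coeFn_smul (conj (c l t)) u] with s hus hs hsmul
    rw [hs, hsmul, hus, Pi.smul_apply, smul_eq_mul, map_mul, Complex.conj_conj]
  · intro hI
    filter_upwards [hshift.ae (hzero hI), hl] with t hzt ht
    filter_upwards [hzt, ht] with s hzs hs
    rw [hs, hzs, mul_zero]

theorem indicator_mem_directIntegral {G G' : L2Dual e} (hG : G ∈ directIntegral e I P)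
    (E : Set (Fin r → ℝ))
    (h : G' =ᵐ[(plancherelMeasure e).prod volume] (Prod.fst ⁻¹' E).indicator G) :
    G' ∈ directIntegral e I P := by
  refine mem_directIntegral_of_ae_eq_mul hG (fun l _ => E.indicator 1 l) 0 (h.trans ?_)
  refine Eventually.of_forall fun p => ?_
  by_cases hp : p.1 ∈ E <;> simp [Set.indicator, hp]

variable {K : Submodule ℂ (L2N e)}
  (hK : plancherel e '' (K : Set (L2N e)) = directIntegral e I P)
include hK

theorem mem_iff_plancherelIsometry_mem (f : L2N e) :
    f ∈ K ↔ plancherelIsometry e f ∈ directIntegral e I P := by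
  rw [← hK, show plancherel e = plancherelIsometry e from funext (plancherel_eq e),
    (plancherelIsometry e).injective.mem_set_image]
  rfl

theorem exists_mem_plancherelIsometry_eq {G : L2Dual e} (hG : G ∈ directIntegral e I P) :
    ∃ f ∈ K, plancherelIsometry e f = G := by
  rw [← hK] at hG
  obtain ⟨f, hf, rfl⟩ := hG
  exact ⟨f, hf, (plancherel_eq e f).symm⟩

theorem leftRegular_mem (g : NilGroup e) {f : L2N e} (hf : f ∈ K) : leftRegular e g f ∈ K := by
  rw [mem_iff_plancherelIsometry_mem hK] at hf ⊢
  rw [plancherelIsometry_leftRegular]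
  exact mem_directIntegral_of_ae_eq_mul hf (fun l t => dualPhase e g.coords (l, t, 0))
    g.coords.2.2 (coeFn_dualAction e _ _)

end BandLimited

section Frames

theorem IsParsevalFrame.tsum_enorm_sq_inner {H ι : Type*} [NormedAddCommGroup H]
    [InnerProductSpace ℂ H] {K : Submodule ℂ H} {v : ι → H} (h : IsParsevalFrame K v) {ψ : H}
    (hψ : ψ ∈ K) : ∑' i, ‖(inner ℂ (v i) ψ : ℂ)‖ₑ ^ 2 = ‖ψ‖ₑ ^ 2 := by
  have hsum := h.2 ψ hψ
  simp only [enorm_sq_eq_ofReal]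
  rw [← ENNReal.ofReal_tsum_of_nonneg (fun _ => sq_nonneg _) hsum.summable, hsum.tsum_eq]

variable {e} {a : Fin r → ℝ} {q b : Fin d → ℝ} {K : Submodule ℂ (L2N e)} {φ ψ : L2N e}
  (ha : ∀ j, 0 < a j) (hq : ∀ j, 0 < q j) (hb : ∀ j, 0 < b j)
  (hframe : IsParsevalFrame K (fun γ : quasiLattice e a q b => leftRegular e γ.1 φ))
  (hinv : ∀ g, ∀ f ∈ K, leftRegular e g f ∈ K) (hψ : ψ ∈ K)
include ha hq hb hframe hinv hψ

theorem tsum_enorm_sq_inner_leftRegular_mul_latticePoint (g : NilGroup e) :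
    ∑' i, ‖(inner ℂ (leftRegular e (g * latticePoint e a q b i) φ) ψ : ℂ)‖ₑ ^ 2 =
      ‖ψ‖ₑ ^ 2 := by
  have htranslate := hframe.tsum_enorm_sq_inner (hinv g⁻¹ ψ hψ)
  rw [← ofReal_norm, norm_leftRegular, ofReal_norm] at htranslate
  simp only [inner_leftRegular_mul]
  exact ((Equiv.ofInjective _ (latticePoint_injective e ha hq hb)).tsum_eq fun γ =>
    ‖(inner ℂ (leftRegular e γ.1 φ) (leftRegular e g⁻¹ ψ) : ℂ)‖ₑ ^ 2).trans htranslate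

theorem lintegral_enorm_sq_inner_leftRegular :
    ∫⁻ n, ‖(inner ℂ (leftRegular e n φ) ψ : ℂ)‖ₑ ^ 2 ∂NilGroup.haar e =
      ‖ψ‖ₑ ^ 2 * ENNReal.ofReal ((∏ j, a j)⁻¹ * ((∏ j, q j)⁻¹ * (∏ j, b j)⁻¹)) := by
  have hmeas : Measurable fun n => ‖(inner ℂ (leftRegular e n φ) ψ : ℂ)‖ₑ ^ 2 :=
    (stronglyMeasurable_inner_leftRegular e φ ψ).enorm.pow_const 2
  have htranslate (i : (Fin r → ℤ) × (Fin d → ℤ) × (Fin d → ℤ)) : Measurable fun n =>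
      ‖(inner ℂ (leftRegular e (n * latticePoint e a q b i) φ) ψ : ℂ)‖ₑ ^ 2 :=
    hmeas.comp (measurePreserving_mul_right e _).measurable
  rw [lintegral_eq_tsum_latticePoint e ha hq hb hmeas,
    ← lintegral_tsum fun i => (htranslate i).aemeasurable]
  simp only [tsum_enorm_sq_inner_leftRegular_mul_latticePoint ha hq hb hframe hinv hψ]
  rw [setLIntegral_const, haar_fundamentalCell e ha hq hb]

theorem lintegral_enorm_sq_inner_leftRegular_central_le :
    ∫⁻ z : Fin r → ℝ, ‖(inner ℂ (leftRegular e (NilGroup.ofCoords e (z, 0, 0)) φ) ψ : ℂ)‖ₑ ^ 2 ≤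
      ‖ψ‖ₑ ^ 2 * ENNReal.ofReal (∏ j, a j)⁻¹ := by
  have hmeas : Measurable fun z : Fin r → ℝ =>
      ‖(inner ℂ (leftRegular e (NilGroup.ofCoords e (z, 0, 0)) φ) ψ : ℂ)‖ₑ ^ 2 :=
    ((stronglyMeasurable_inner_leftRegular e φ ψ).enorm.pow_const 2).comp
      ((measurePreserving_ofCoords e).measurable.comp (by fun_prop))
  have hcentral (z : Fin r → ℝ) (m : Fin r → ℤ) :
      NilGroup.ofCoords e (z + fun j => m j / a j, 0, 0) =
        NilGroup.ofCoords e (z, 0, 0) * latticePoint e a q b (m, 0, 0) := by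
    rw [latticePoint, NilGroup.ofCoords_mul]
    refine congrArg _ (Prod.ext ?_ (Prod.ext ?_ ?_)) <;> ext j <;>
      simp [NilGroup.bracketXY, NilGroup.X_zero]
  rw [lintegral_eq_tsum_cell ha hmeas, ← volume_cell_zero ha, ← setLIntegral_const,
    ← lintegral_tsum]
  · refine lintegral_mono fun z => ?_
    rw [← tsum_enorm_sq_inner_leftRegular_mul_latticePoint ha hq hb hframe hinv hψ
      (NilGroup.ofCoords e (z, 0, 0))]
    simp only [hcentral]
    exact ENNReal.tsum_comp_le_tsum_of_injective (Prod.mk_left_injective (0, 0)) _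
  · exact fun m => (hmeas.comp (measurable_add_const _)).aemeasurable

end Frames

section FiberWeight

variable (G : L2Dual e)

/-- The squared Hilbert-Schmidt norm of the fiber at `l` of a field of integral kernels. -/
def fiberNormSq (l : Fin r → ℝ) : ℝ≥0∞ :=
  ∫⁻ p : (Fin d → ℝ) × (Fin d → ℝ), ‖G (l, p)‖ₑ ^ 2

/-- The density, with respect to Lebesgue measure on the center's dual, of the squared norm of a
field of integral kernels. -/
def fiberWeight (l : Fin r → ℝ) : ℝ≥0∞ :=
  ENNReal.ofReal |(e.B l).det| * fiberNormSq e G l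

theorem measurable_fiberNormSq : Measurable (fiberNormSq e G) :=
  ((Lp.stronglyMeasurable G).enorm.pow_const 2).lintegral_prod_right'

@[fun_prop]
theorem measurable_fiberWeight : Measurable (fiberWeight e G) :=
  (continuous_det_B e).measurable.abs.ennreal_ofReal.mul (measurable_fiberNormSq e G)

theorem enorm_sq_eq_lintegral_fiberNormSq :
    ‖G‖ₑ ^ 2 = ∫⁻ l, fiberNormSq e G l ∂plancherelMeasure e := by
  rw [enorm_Lp_two_sq,
    lintegral_prod _ ((Lp.stronglyMeasurable G).enorm.pow_const 2).aemeasurable]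
  rfl

theorem enorm_sq_eq_lintegral_fiberWeight : ‖G‖ₑ ^ 2 = ∫⁻ l, fiberWeight e G l := by
  rw [enorm_sq_eq_lintegral_fiberNormSq,
    lintegral_plancherelMeasure e (measurable_fiberNormSq e G)]
  rfl

theorem lintegral_fiberWeight_ne_top : ∫⁻ l, fiberWeight e G l ≠ ∞ := by
  rw [← enorm_sq_eq_lintegral_fiberWeight]
  exact ENNReal.pow_ne_top enorm_ne_top

theorem integral_plancherelMeasure (k : (Fin r → ℝ) → ℂ) :
    ∫ l, k l ∂plancherelMeasure e = ∫ l, ((|(e.B l).det| : ℝ) : ℂ) * k l := by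
  rw [plancherelMeasure, integral_withDensity_eq_integral_toReal_smul
    (continuous_det_B e).measurable.abs.ennreal_ofReal (ae_of_all _ fun _ => ENNReal.ofReal_lt_top)]
  simp only [ENNReal.toReal_ofReal (abs_nonneg _), Complex.real_smul]

theorem volume_absolutelyContinuous_plancherelMeasure :
    volume ≪ plancherelMeasure e := by
  refine withDensity_absolutelyContinuous'
    (continuous_det_B e).measurable.abs.ennreal_ofReal.aemeasurable ?_
  filter_upwards [ae_det_B_ne_zero e] with l hl
  exact (ENNReal.ofReal_pos.2 (abs_pos.2 hl)).ne'

variable {e G}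

theorem fiberWeight_ae_eq_indicator {G' : L2Dual e} {E : Set (Fin r → ℝ)}
    (h : G' =ᵐ[(plancherelMeasure e).prod volume] (Prod.fst ⁻¹' E).indicator G) :
    fiberWeight e G' =ᵐ[volume] E.indicator (fiberWeight e G) := by
  filter_upwards [(volume_absolutelyContinuous_plancherelMeasure e).ae_le
    (Measure.ae_ae_of_ae_prod h)] with l hl
  have hfiber : fiberNormSq e G' l = E.indicator (fiberNormSq e G) l := by
    refine (lintegral_congr_ae (hl.mono fun p hp => congrArg (‖·‖ₑ ^ 2) hp)).trans ?_
    by_cases hE : l ∈ E <;> simp [Set.indicator, hE, fiberNormSq]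
  rw [fiberWeight, hfiber]
  by_cases hE : l ∈ E <;> simp [hE, fiberWeight]

end FiberWeight

section CentralCoefficients

theorem integral_comp_fst_mul {α β : Type*} [MeasurableSpace α] [MeasurableSpace β]
    {μ : Measure α} {ν : Measure β} [SFinite μ] [SFinite ν] {c : α → ℂ} {k : α × β → ℂ}
    (h : Integrable (fun w => c w.1 * k w) (μ.prod ν)) :
    ∫ w, c w.1 * k w ∂μ.prod ν = ∫ x, c x * ∫ y, k (x, y) ∂ν ∂μ := by
  rw [integral_prod _ h]
  simp only [integral_const_mul]

theorem integral_conj_mul_self {α : Type*} [MeasurableSpace α] {μ : Measure α} {f : α → ℂ}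
    (hf : AEStronglyMeasurable f μ) :
    ∫ x, conj (f x) * f x ∂μ = ((∫⁻ x, ‖f x‖ₑ ^ 2 ∂μ).toReal : ℂ) := by
  simp only [Complex.conj_mul', ← Complex.ofReal_pow]
  rw [integral_complex_ofReal, integral_eq_lintegral_of_nonneg_ae
    (ae_of_all _ fun _ => sq_nonneg _) (hf.norm.pow 2)]
  simp only [ENNReal.ofReal_pow (norm_nonneg _), ofReal_norm]

theorem integrable_conj_mul {α : Type*} [MeasurableSpace α] {μ : Measure α} {f g : α → ℂ}
    (hf : MemLp f 2 μ) (hg : MemLp g 2 μ) : Integrable (fun x => conj (f x) * g x) μ :=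
  hf.star.integrable_mul hg

theorem inner_leftRegular_central (z : Fin r → ℝ) (f f' : L2N e) :
    inner ℂ (leftRegular e (NilGroup.ofCoords e (z, 0, 0)) f) f' =
      ∫ w, (𝐞 (-(z ⬝ᵥ w.1)) : ℂ) * (conj (plancherelIsometry e f w) * plancherelIsometry e f' w)
        ∂(plancherelMeasure e).prod volume := by
  rw [inner_leftRegular_eq_integral]
  refine integral_congr_ae (ae_of_all _ fun w => ?_)
  have hphase : dualPhase e (z, 0, 0) w = 𝐞 (z ⬝ᵥ w.1) := by
    simp [dualPhase, dotProduct_comm]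
  have hshift : dualShift 0 w = w := by simp [dualShift]
  simp only [NilGroup.coords_ofCoords, hphase, hshift, map_mul, conj_fourierChar, mul_assoc]

theorem inner_leftRegular_central_self (z : Fin r → ℝ) (f : L2N e) :
    inner ℂ (leftRegular e (NilGroup.ofCoords e (z, 0, 0)) f) f =
      ∫ l, (𝐞 (-(z ⬝ᵥ l)) : ℂ) * ((fiberWeight e (plancherelIsometry e f) l).toReal : ℂ) := by
  have hL2 := Lp.memLp (plancherelIsometry e f)
  rw [inner_leftRegular_central, integral_comp_fst_mul (c := fun l => (𝐞 (-(z ⬝ᵥ l)) : ℂ))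
    (integrable_fourierChar_mul (by fun_prop) (integrable_conj_mul hL2 hL2)),
    integral_plancherelMeasure]
  refine integral_congr_ae (ae_of_all _ fun l => ?_)
  have hslice : AEStronglyMeasurable (fun p => plancherelIsometry e f (l, p)) volume :=
    ((Lp.stronglyMeasurable _).comp_measurable measurable_prodMk_left).aestronglyMeasurable
  simp only [integral_conj_mul_self hslice, fiberWeight, fiberNormSq, ENNReal.toReal_mul,
    ENNReal.toReal_ofReal (abs_nonneg _), Complex.ofReal_mul]
  ring

variable {e} in
theorem inner_leftRegular_central_eq_self {f f' : L2N e} {E : Set (Fin r → ℝ)}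
    (h : plancherelIsometry e f' =ᵐ[(plancherelMeasure e).prod volume]
      (Prod.fst ⁻¹' E).indicator (plancherelIsometry e f)) (z : Fin r → ℝ) :
    inner ℂ (leftRegular e (NilGroup.ofCoords e (z, 0, 0)) f) f' =
      inner ℂ (leftRegular e (NilGroup.ofCoords e (z, 0, 0)) f') f' := by
  rw [inner_leftRegular_central, inner_leftRegular_central]
  refine integral_congr_ae (h.mono fun w hw => ?_)
  by_cases hE : w ∈ Prod.fst ⁻¹' E <;> simp [hw, hE]

theorem lintegral_enorm_sq_inner_leftRegular_central (f : L2N e) {M : ℝ≥0∞} (hM : M ≠ ∞)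
    (hle : ∀ᵐ l, fiberWeight e (plancherelIsometry e f) l ≤ M) :
    ∫⁻ z, ‖(inner ℂ (leftRegular e (NilGroup.ofCoords e (z, 0, 0)) f) f : ℂ)‖ₑ ^ 2 =
      ∫⁻ l, fiberWeight e (plancherelIsometry e f) l ^ 2 := by
  set w := fiberWeight e (plancherelIsometry e f)
  have hint : Integrable fun l => ((w l).toReal : ℂ) :=
    (integrable_toReal_of_lintegral_ne_top (measurable_fiberWeight e _).aemeasurable
      (lintegral_fiberWeight_ne_top e _)).ofReal
  have henorm : ∀ᵐ l, ‖((w l).toReal : ℂ)‖ₑ ^ 2 = w l ^ 2 := hle.mono fun l hl => by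
    rw [← ofReal_norm, Complex.norm_real, Real.norm_of_nonneg ENNReal.toReal_nonneg,
      ENNReal.ofReal_toReal (ne_top_of_le_ne_top hM hl)]
  have hL2 : MemLp (fun l => ((w l).toReal : ℂ)) 2 := by
    rw [memLp_two_iff_lintegral_enorm_sq_lt_top hint.1, lintegral_congr_ae henorm]
    calc ∫⁻ l, w l ^ 2 ≤ ∫⁻ l, M * w l := lintegral_mono_ae (hle.mono fun l hl => by
          rw [sq]
          exact mul_le_mul_left hl _)
      _ = M * ∫⁻ l, w l := lintegral_const_mul _ (measurable_fiberWeight e _)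
      _ < ∞ := ENNReal.mul_lt_top hM.lt_top (lintegral_fiberWeight_ne_top e _).lt_top
  simp only [inner_leftRegular_central_self]
  rw [lintegral_enorm_sq_fourier_pi_neg hint hL2, lintegral_congr_ae henorm]

end CentralCoefficients

section WeightBound

theorem ae_le_of_setLIntegral_sq_le {α : Type*} [MeasurableSpace α] {μ : Measure α}
    {w : α → ℝ≥0∞} (hw : Measurable w) (hfin : ∫⁻ x, w x ∂μ ≠ ∞) {c : ℝ≥0∞} (hc : c ≠ ∞)
    (h : ∀ E, MeasurableSet E → ∀ n : ℕ, (∀ x ∈ E, w x ≤ n) →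
      ∫⁻ x in E, w x ^ 2 ∂μ ≤ (∫⁻ x in E, w x ∂μ) * c) : ∀ᵐ x ∂μ, w x ≤ c := by
  have hnull (n : ℕ) : μ {x | w x ≤ n ∧ c < w x} = 0 := by
    set E := {x | w x ≤ n ∧ c < w x}
    have hE : MeasurableSet E :=
      (measurableSet_le hw measurable_const).inter (measurableSet_lt measurable_const hw)
    by_contra hpos
    have hle := h E hE n fun x hx => hx.1
    rw [← lintegral_mul_const _ hw] at hle
    refine hle.not_gt (setLIntegral_strict_mono hE hpos (hw.pow_const 2) ?_ ?_)
    · rw [lintegral_mul_const _ hw]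
      exact ENNReal.mul_ne_top
        (ne_top_of_le_ne_top hfin (setLIntegral_le_lintegral _ _)) hc
    · refine ae_of_all _ fun x ⟨hxn, hcx⟩ => ?_
      rw [sq]
      exact ENNReal.mul_lt_mul_right (pos_of_gt hcx).ne'
        (hxn.trans_lt (ENNReal.natCast_lt_top n)).ne hcx
  filter_upwards [ae_all_iff.2 fun n => measure_eq_zero_iff_ae_notMem.1 (hnull n),
    ae_lt_top hw hfin] with x hx hxfin
  obtain ⟨n, hn⟩ := ENNReal.exists_nat_gt hxfin.ne
  exact not_lt.1 fun hlt => hx n ⟨hn.le, hlt⟩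

variable {e} {a : Fin r → ℝ} {q b : Fin d → ℝ} {K : Submodule ℂ (L2N e)} {φ : L2N e}
  {I : Set (Fin r → ℝ)} {P : (Fin r → ℝ) → L2 d →L[ℂ] L2 d}
  (hK : plancherel e '' (K : Set (L2N e)) = directIntegral e I P) (hφ : φ ∈ K)
include hK hφ

theorem exists_mem_plancherelIsometry_ae_eq_indicator {E : Set (Fin r → ℝ)}
    (hE : MeasurableSet E) :
    ∃ ψ ∈ K, plancherelIsometry e ψ =ᵐ[(plancherelMeasure e).prod volume]
      (Prod.fst ⁻¹' E).indicator (plancherelIsometry e φ) := by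
  have hcut := (Lp.memLp (plancherelIsometry e φ)).indicator (measurable_fst hE)
  obtain ⟨ψ, hψ, hψE⟩ := exists_mem_plancherelIsometry_eq hK (indicator_mem_directIntegral
    ((mem_iff_plancherelIsometry_mem hK φ).1 hφ) E hcut.coeFn_toLp)
  exact ⟨ψ, hψ, hψE ▸ hcut.coeFn_toLp⟩

variable (ha : ∀ j, 0 < a j) (hq : ∀ j, 0 < q j) (hb : ∀ j, 0 < b j)
  (hframe : IsParsevalFrame K (fun γ : quasiLattice e a q b => leftRegular e γ.1 φ))
include ha hq hb hframe

theorem setLIntegral_fiberWeight_sq_le {E : Set (Fin r → ℝ)} (hE : MeasurableSet E) {M : ℝ≥0∞}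
    (hM : M ≠ ∞) (hle : ∀ l ∈ E, fiberWeight e (plancherelIsometry e φ) l ≤ M) :
    ∫⁻ l in E, fiberWeight e (plancherelIsometry e φ) l ^ 2 ≤
      (∫⁻ l in E, fiberWeight e (plancherelIsometry e φ) l) * ENNReal.ofReal (∏ j, a j)⁻¹ := by
  obtain ⟨ψ, hψ, hψE⟩ := exists_mem_plancherelIsometry_ae_eq_indicator hK hφ hE
  have hweight := fiberWeight_ae_eq_indicator hψE
  have hψM : ∀ᵐ l, fiberWeight e (plancherelIsometry e ψ) l ≤ M := by
    filter_upwards [hweight] with l hl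
    exact hl ▸ Set.indicator_apply_le' (hle l) fun _ => zero_le
  have hnorm : ‖ψ‖ₑ ^ 2 = ∫⁻ l in E, fiberWeight e (plancherelIsometry e φ) l := by
    rw [← (plancherelIsometry e).enorm_map, enorm_sq_eq_lintegral_fiberWeight,
      lintegral_congr_ae hweight, lintegral_indicator hE]
  have hsq : ∫⁻ l, fiberWeight e (plancherelIsometry e ψ) l ^ 2 =
      ∫⁻ l in E, fiberWeight e (plancherelIsometry e φ) l ^ 2 := by
    rw [← lintegral_indicator hE]
    refine lintegral_congr_ae (hweight.mono fun l hl => ?_)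
    by_cases hlE : l ∈ E <;> simp [hl, hlE]
  have hcentral := lintegral_enorm_sq_inner_leftRegular_central_le ha hq hb hframe
    (fun g _ => leftRegular_mem hK g) hψ
  simp only [inner_leftRegular_central_eq_self hψE] at hcentral
  rwa [lintegral_enorm_sq_inner_leftRegular_central e ψ hM hψM, hsq, hnorm] at hcentral

theorem ae_fiberWeight_le :
    ∀ᵐ l, fiberWeight e (plancherelIsometry e φ) l ≤ ENNReal.ofReal (∏ j, a j)⁻¹ :=
  ae_le_of_setLIntegral_sq_le (measurable_fiberWeight e _) (lintegral_fiberWeight_ne_top e _)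
    ENNReal.ofReal_ne_top fun _ hE n hle =>
    setLIntegral_fiberWeight_sq_le hK hφ ha hq hb hframe hE (ENNReal.natCast_ne_top n) hle

end WeightBound

section MatrixCoefficients

theorem lintegral_enorm_sq_integral_fourierChar_comp_le {α ι κ : Type*} [MeasurableSpace α]
    [Fintype ι] [Fintype κ] {μ : Measure α} {θ : α → (ι → ℝ) × (κ → ℝ)}
    {σ : (ι → ℝ) × (κ → ℝ) → α} (hθ : MeasurePreserving θ μ volume) (hσ : Measurable σ)
    (hinv : ∀ᵐ p ∂μ, σ (θ p) = p) {H : α → ℂ} (hmeas : StronglyMeasurable H)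
    (hH : Integrable H μ) :
    ∫⁻ w : (ι → ℝ) × (κ → ℝ),
        ‖∫ p, (𝐞 (-(w.1 ⬝ᵥ (θ p).1 + w.2 ⬝ᵥ (θ p).2)) : ℂ) * H p ∂μ‖ₑ ^ 2 ≤
      ∫⁻ p, ‖H p‖ₑ ^ 2 ∂μ := by
  have hpush : Integrable (H ∘ σ) volume :=
    (hθ.integrable_comp (hmeas.comp_measurable hσ).aestronglyMeasurable).1
      (hH.congr (hinv.mono fun p hp => congrArg H hp.symm))
  have hintegral (w : (ι → ℝ) × (κ → ℝ)) :
      ∫ p, (𝐞 (-(w.1 ⬝ᵥ (θ p).1 + w.2 ⬝ᵥ (θ p).2)) : ℂ) * H p ∂μ =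
        ∫ v, (𝐞 (-(w.1 ⬝ᵥ v.1 + w.2 ⬝ᵥ v.2)) : ℂ) * H (σ v) := by
    have hw : Integrable (fun v : (ι → ℝ) × (κ → ℝ) =>
        (𝐞 (-(w.1 ⬝ᵥ v.1 + w.2 ⬝ᵥ v.2)) : ℂ) * H (σ v)) volume :=
      integrable_fourierChar_mul (by fun_prop) hpush
    rw [← hθ.map_eq] at hw ⊢
    rw [integral_map hθ.aemeasurable hw.1]
    exact integral_congr_ae (hinv.mono fun p hp => by simp only [hp])
  simp only [hintegral]
  refine (lintegral_enorm_sq_fourier_prod_neg_le hpush).trans_eq ?_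
  rw [← hθ.lintegral_comp ((hmeas.comp_measurable hσ).enorm.pow_const 2)]
  exact lintegral_congr_ae (hinv.mono fun p hp => by simp only [Function.comp_apply, hp])

theorem measurable_vecMul_inv_B :
    Measurable fun p : (Fin r → ℝ) × (Fin d → ℝ) => p.2 ᵥ* (e.B p.1)⁻¹ := by
  have hadj : Continuous fun p : (Fin r → ℝ) × (Fin d → ℝ) => p.2 ᵥ* (e.B p.1).adjugate :=
    continuous_snd.matrix_vecMul (((continuous_B e).comp continuous_fst).matrix_adjugate)
  simp only [Matrix.inv_def, Ring.inverse_eq_inv', Matrix.vecMul_smul]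
  exact ((continuous_det_B e).measurable.inv.comp measurable_fst).smul hadj.measurable

theorem ae_vecMul_B_vecMul_inv_B :
    ∀ᵐ p : (Fin r → ℝ) × (Fin d → ℝ) ∂(plancherelMeasure e).prod volume,
      (p.1, (p.2 ᵥ* e.B p.1) ᵥ* (e.B p.1)⁻¹) = p := by
  have hdet : ∀ᵐ l ∂plancherelMeasure e, (e.B l).det ≠ 0 :=
    (withDensity_absolutelyContinuous _ _).ae_le (ae_det_B_ne_zero e)
  filter_upwards [Measure.quasiMeasurePreserving_fst.ae hdet] with p hp
  rw [Matrix.vecMul_vecMul, Matrix.mul_nonsing_inv _ hp.isUnit, Matrix.vecMul_one]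

/-- The integral kernel at `(t, t - x)`, where `v = (l, t)`, of the operator `Ψ(l) Φ(l)^*` for two
fields of Hilbert-Schmidt operators given by their kernels. The matrix coefficient
`⟨ψ, L(n) φ⟩` is its Fourier transform in the variables `(l, t B(l))`. -/
def coefficientDensity (Φ Ψ : Coords r d → ℂ) (x : Fin d → ℝ) (v : (Fin r → ℝ) × (Fin d → ℝ)) :
    ℂ :=
  ∫ s, conj (Φ (v.1, v.2 - x, s)) * Ψ (v.1, v.2, s)

theorem stronglyMeasurable_coefficientDensity {Φ Ψ : Coords r d → ℂ} (hΦ : StronglyMeasurable Φ)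
    (hΨ : StronglyMeasurable Ψ) :
    StronglyMeasurable fun w : (Fin d → ℝ) × (Fin r → ℝ) × (Fin d → ℝ) =>
      coefficientDensity Φ Ψ w.1 w.2 := by
  have hshift : Measurable fun w : ((Fin d → ℝ) × (Fin r → ℝ) × (Fin d → ℝ)) × (Fin d → ℝ) =>
      (w.1.2.1, w.1.2.2 - w.1.1, w.2) := by fun_prop
  have hassoc : Measurable fun w : ((Fin d → ℝ) × (Fin r → ℝ) × (Fin d → ℝ)) × (Fin d → ℝ) =>
      (w.1.2.1, w.1.2.2, w.2) := by fun_prop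
  have hfield : StronglyMeasurable
      fun w : ((Fin d → ℝ) × (Fin r → ℝ) × (Fin d → ℝ)) × (Fin d → ℝ) =>
        conj (Φ (w.1.2.1, w.1.2.2 - w.1.1, w.2)) * Ψ (w.1.2.1, w.1.2.2, w.2) :=
    (Complex.continuous_conj.comp_stronglyMeasurable (hΦ.comp_measurable hshift)).mul
      (hΨ.comp_measurable hassoc)
  exact hfield.integral_prod_right'

variable {e} in
theorem integrable_conj_dualShift_mul {Φ Ψ : Coords r d → ℂ}
    (hΦ : MemLp Φ 2 ((plancherelMeasure e).prod volume))
    (hΨ : MemLp Ψ 2 ((plancherelMeasure e).prod volume)) (x : Fin d → ℝ) :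
    Integrable (fun w => conj (Φ (dualShift x w)) * Ψ w) ((plancherelMeasure e).prod volume) :=
  integrable_conj_mul (hΦ.comp_measurePreserving (measurePreserving_dualShift e x)) hΨ

variable {e} in
theorem integrable_coefficientDensity {Φ Ψ : Coords r d → ℂ}
    (hΦ : MemLp Φ 2 ((plancherelMeasure e).prod volume))
    (hΨ : MemLp Ψ 2 ((plancherelMeasure e).prod volume)) (x : Fin d → ℝ) :
    Integrable (coefficientDensity Φ Ψ x) ((plancherelMeasure e).prod volume) :=
  ((measurePreserving_prodAssoc (plancherelMeasure e) volume volume).integrable_comp_of_integrable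
    (integrable_conj_dualShift_mul hΦ hΨ x)).integral_prod_left

theorem inner_leftRegular_ofCoords (z : Fin r → ℝ) (y x : Fin d → ℝ) (f f' : L2N e) :
    inner ℂ (leftRegular e (NilGroup.ofCoords e (z, y, x)) f) f' =
      ∫ v, (𝐞 (-(z ⬝ᵥ v.1 + y ⬝ᵥ (v.2 ᵥ* e.B v.1))) : ℂ) *
        coefficientDensity (plancherelIsometry e f) (plancherelIsometry e f') x v
        ∂(plancherelMeasure e).prod volume := by
  have hassoc := measurePreserving_prodAssoc (plancherelMeasure e)
    (volume : Measure (Fin d → ℝ)) (volume : Measure (Fin d → ℝ))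
  have hphase (w : Coords r d) : conj (dualPhase e (z, y, x) w) =
      𝐞 (-(z ⬝ᵥ w.1 + y ⬝ᵥ (w.2.1 ᵥ* e.B w.1))) := by
    rw [dualPhase, conj_fourierChar, Matrix.dotProduct_mulVec, dotProduct_comm w.1,
      dotProduct_comm _ y]
  have hint : Integrable (fun w : Coords r d => (𝐞 (-(z ⬝ᵥ w.1 + y ⬝ᵥ (w.2.1 ᵥ* e.B w.1))) : ℂ) *
      (conj (plancherelIsometry e f (dualShift x w)) * plancherelIsometry e f' w))
      ((plancherelMeasure e).prod (volume.prod volume)) :=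
    integrable_fourierChar_mul (by fun_prop)
      (integrable_conj_dualShift_mul (Lp.memLp _) (Lp.memLp _) x)
  rw [inner_leftRegular_eq_integral]
  simp only [NilGroup.coords_ofCoords, map_mul, hphase, mul_assoc]
  exact (hassoc.integral_comp' _).symm.trans (integral_comp_fst_mul
    (c := fun v : (Fin r → ℝ) × (Fin d → ℝ) =>
      (𝐞 (-(z ⬝ᵥ v.1 + y ⬝ᵥ (v.2 ᵥ* e.B v.1))) : ℂ))
    (hassoc.integrable_comp_of_integrable hint))

theorem lintegral_coords {F : Coords r d → ℝ≥0∞} (hF : Measurable F) :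
    ∫⁻ p, F p = ∫⁻ x, ∫⁻ w : (Fin r → ℝ) × (Fin d → ℝ), F (w.1, w.2, x) := by
  rw [← (volume_preserving_prodAssoc (α₁ := Fin r → ℝ) (β₁ := Fin d → ℝ)
    (γ₁ := Fin d → ℝ)).lintegral_comp hF]
  exact lintegral_prod_symm' _ (hF.comp MeasurableEquiv.prodAssoc.measurable)

theorem lintegral_enorm_sq_inner_leftRegular_le (f f' : L2N e) :
    ∫⁻ n, ‖(inner ℂ (leftRegular e n f) f' : ℂ)‖ₑ ^ 2 ∂NilGroup.haar e ≤
      ∫⁻ x, ∫⁻ v, ‖coefficientDensity (plancherelIsometry e f) (plancherelIsometry e f') x v‖ₑ ^ 2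
        ∂(plancherelMeasure e).prod volume := by
  have hmeas : Measurable fun p : Coords r d =>
      ‖(inner ℂ (leftRegular e (NilGroup.ofCoords e p) f) f' : ℂ)‖ₑ ^ 2 :=
    ((stronglyMeasurable_inner_leftRegular e f f').comp_measurable
      (NilGroup.coordsMeasurableEquiv e).symm.measurable).enorm.pow_const 2
  rw [lintegral_haar, lintegral_coords hmeas]
  simp only [inner_leftRegular_ofCoords]
  exact lintegral_mono fun x => lintegral_enorm_sq_integral_fourierChar_comp_le
    (measurePreserving_vecMul_B e) (measurable_fst.prodMk (measurable_vecMul_inv_B e))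
    (ae_vecMul_B_vecMul_inv_B e)
    ((stronglyMeasurable_coefficientDensity (Lp.stronglyMeasurable _)
      (Lp.stronglyMeasurable _)).comp_measurable measurable_prodMk_left)
    (integrable_coefficientDensity (Lp.memLp _) (Lp.memLp _) x)

end MatrixCoefficients

section CubeTensor

/-- The field of kernels `l ↦ 1_C ⊗ u(l)`, where `C = [0,1)^d`: a field of rank one operators with
prescribed right factors `u(l)`, on which admissibility is tested. -/
def cubeTensor (u : (Fin r → ℝ) × (Fin d → ℝ) → ℂ) (w : Coords r d) : ℂ :=
  (cell 1 0).indicator 1 w.2.1 * conj (u (w.1, w.2.2))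

variable {u : (Fin r → ℝ) × (Fin d → ℝ) → ℂ}

theorem enorm_sq_cubeTensor (w : Coords r d) :
    ‖cubeTensor u w‖ₑ ^ 2 = (cell 1 0).indicator 1 w.2.1 * ‖u (w.1, w.2.2)‖ₑ ^ 2 := by
  by_cases hw : w.2.1 ∈ cell 1 0 <;> simp [cubeTensor, hw]

theorem measurable_indicator_cell :
    Measurable ((cell (1 : Fin d → ℝ) 0).indicator (1 : (Fin d → ℝ) → ℝ≥0∞)) :=
  measurable_one.indicator (measurableSet_cell _ _)

theorem lintegral_indicator_cell : ∫⁻ t : Fin d → ℝ, (cell 1 0).indicator 1 t = 1 := by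
  rw [lintegral_indicator_one (measurableSet_cell _ _),
    volume_cell_zero (c := 1) fun _ => one_pos]
  simp

theorem stronglyMeasurable_cubeTensor (hu : StronglyMeasurable u) :
    StronglyMeasurable (cubeTensor u) := by
  have hcube : StronglyMeasurable ((cell (1 : Fin d → ℝ) 0).indicator (1 : (Fin d → ℝ) → ℂ)) :=
    stronglyMeasurable_one.indicator (measurableSet_cell _ _)
  exact (hcube.comp_measurable (measurable_fst.comp measurable_snd)).mul
    (Complex.continuous_conj.comp_stronglyMeasurable (hu.comp_measurable (by fun_prop)))

theorem lintegral_enorm_sq_cubeTensor (hu : StronglyMeasurable u) :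
    ∫⁻ w, ‖cubeTensor u w‖ₑ ^ 2 ∂(plancherelMeasure e).prod volume =
      ∫⁻ l, (∫⁻ s, ‖u (l, s)‖ₑ ^ 2) ∂plancherelMeasure e := by
  rw [lintegral_prod _ ((stronglyMeasurable_cubeTensor hu).enorm.pow_const 2).aemeasurable]
  refine lintegral_congr fun l => ?_
  have hl : Measurable fun s => ‖u (l, s)‖ₑ ^ 2 :=
    (hu.comp_measurable measurable_prodMk_left).enorm.pow_const 2
  simp only [enorm_sq_cubeTensor]
  exact (lintegral_prod_mul measurable_indicator_cell.aemeasurable hl.aemeasurable).trans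
    (by rw [lintegral_indicator_cell, one_mul])

variable {e} in
theorem mem_directIntegral_of_ae_eq_cubeTensor {I : Set (Fin r → ℝ)}
    {P : (Fin r → ℝ) → L2 d →L[ℂ] L2 d} {T : (Fin r → ℝ) → L2 d}
    (hT : ∀ l, T l ∈ Set.range (P l)) (hT0 : ∀ l ∉ I, T l = 0)
    (hu : ∀ l, (fun s => u (l, s)) =ᵐ[volume] T l) {G : L2Dual e}
    (hG : G =ᵐ[(plancherelMeasure e).prod volume] cubeTensor u) : G ∈ directIntegral e I P := by
  change ∀ᵐ l ∂plancherelMeasure e, _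
  filter_upwards [Measure.ae_ae_of_ae_prod hG] with l hl
  have hl := Measure.ae_ae_of_ae_prod hl
  constructor
  · obtain ⟨v, hv⟩ := hT l
    refine fun _ => hl.mono fun t ht => ?_
    set c : ℂ := (cell 1 0).indicator 1 t
    refine ⟨conj c • T l, ⟨conj c • v, by rw [map_smul, hv]⟩, ?_⟩
    filter_upwards [ht, hu l, Lp.coeFn_smul (conj c) (T l)] with s hs hus hsmul
    rw [hs, hsmul, cubeTensor, hus, Pi.smul_apply, smul_eq_mul, map_mul, Complex.conj_conj]
  · refine fun hlI => hl.mono fun t ht => ?_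
    have hu0 : (fun s => u (l, s)) =ᵐ[volume] 0 :=
      (hu l).trans ((hT0 l hlI) ▸ Lp.coeFn_zero ℂ 2 volume)
    filter_upwards [ht, hu0] with s hs hus
    rw [hs, cubeTensor, hus, Pi.zero_apply, map_zero, mul_zero]

variable {e} in
theorem coefficientDensity_ae_eq {Φ Ψ Ψ' : Coords r d → ℂ}
    (h : Ψ =ᵐ[(plancherelMeasure e).prod volume] Ψ') (x : Fin d → ℝ) :
    coefficientDensity Φ Ψ x =ᵐ[(plancherelMeasure e).prod volume] coefficientDensity Φ Ψ' x := by
  have hassoc := measurePreserving_prodAssoc (plancherelMeasure e)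
    (volume : Measure (Fin d → ℝ)) (volume : Measure (Fin d → ℝ))
  filter_upwards [Measure.ae_ae_of_ae_prod (hassoc.quasiMeasurePreserving.ae h)] with v hv
  exact integral_congr_ae (hv.mono fun s hs => congrArg (conj (Φ (v.1, v.2 - x, s)) * ·) hs)

theorem enorm_sq_coefficientDensity_cubeTensor (Φ : Coords r d → ℂ) (x : Fin d → ℝ)
    (v : (Fin r → ℝ) × (Fin d → ℝ)) :
    ‖coefficientDensity Φ (cubeTensor u) x v‖ₑ ^ 2 =
      (cell 1 0).indicator 1 v.2 * ‖∫ s, Φ (v.1, v.2 - x, s) * u (v.1, s)‖ₑ ^ 2 := by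
  have hconj : coefficientDensity Φ (cubeTensor u) x v = (cell 1 0).indicator 1 v.2 *
      conj (∫ s, Φ (v.1, v.2 - x, s) * u (v.1, s)) := by
    rw [← integral_conj, ← integral_const_mul]
    refine integral_congr_ae (ae_of_all _ fun s => ?_)
    simp only [cubeTensor, map_mul]
    ring
  by_cases hv : v.2 ∈ cell 1 0 <;> simp [hconj, hv]

theorem lintegral_enorm_sq_coefficientDensity_cubeTensor {Φ : Coords r d → ℂ}
    (hΦ : StronglyMeasurable Φ) (hu : StronglyMeasurable u) :
    ∫⁻ x, ∫⁻ v, ‖coefficientDensity Φ (cubeTensor u) x v‖ₑ ^ 2 ∂(plancherelMeasure e).prod volume =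
      ∫⁻ l, (∫⁻ t, ‖∫ s, Φ (l, t, s) * u (l, s)‖ₑ ^ 2) ∂plancherelMeasure e := by
  set κ : (Fin r → ℝ) × (Fin d → ℝ) → ℝ≥0∞ :=
    fun v => ‖∫ s, Φ (v.1, v.2, s) * u (v.1, s)‖ₑ ^ 2
  have hκ : Measurable κ := by
    have hfield : StronglyMeasurable fun w : ((Fin r → ℝ) × (Fin d → ℝ)) × (Fin d → ℝ) =>
        Φ (w.1.1, w.1.2, w.2) * u (w.1.1, w.2) :=
      (hΦ.comp_measurable (by fun_prop)).mul (hu.comp_measurable (by fun_prop))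
    exact hfield.integral_prod_right'.enorm.pow_const 2
  have hshift : Measurable fun w : (Fin d → ℝ) × (Fin r → ℝ) × (Fin d → ℝ) =>
      (cell 1 0).indicator 1 w.2.2 * κ (w.2.1, w.2.2 - w.1) :=
    (measurable_indicator_cell.comp (by fun_prop)).mul (hκ.comp (by fun_prop))
  have hsum : Measurable fun l => ∫⁻ t, κ (l, t) := hκ.lintegral_prod_right'
  simp only [enorm_sq_coefficientDensity_cubeTensor]
  calc ∫⁻ x, ∫⁻ v, (cell 1 0).indicator 1 v.2 * κ (v.1, v.2 - x) ∂(plancherelMeasure e).prod volume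
      = ∫⁻ v, (∫⁻ x, (cell 1 0).indicator 1 v.2 * κ (v.1, v.2 - x))
          ∂(plancherelMeasure e).prod volume := lintegral_lintegral_swap hshift.aemeasurable
    _ = ∫⁻ v, (∫⁻ t, κ (v.1, t)) * (cell 1 0).indicator 1 v.2
          ∂(plancherelMeasure e).prod volume := by
        refine lintegral_congr fun v => ?_
        have hv : Measurable fun x => κ (v.1, v.2 - x) := hκ.comp (by fun_prop)
        rw [lintegral_const_mul _ hv, mul_comm]
        exact congrArg (· * _) (lintegral_sub_left_eq_self (fun t => κ (v.1, t)) v.2)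
    _ = ∫⁻ l, (∫⁻ t, κ (l, t)) ∂plancherelMeasure e := by
        rw [lintegral_prod_mul hsum.aemeasurable measurable_indicator_cell.aemeasurable,
          lintegral_indicator_cell, mul_one]

end CubeTensor

section Multiplicity

variable {I : Set (Fin r → ℝ)} {P : (Fin r → ℝ) → L2 d →L[ℂ] L2 d}

theorem IsProjectionField.mono (hP : IsProjectionField I P) {E : Set (Fin r → ℝ)} (hEI : E ⊆ I) :
    IsProjectionField E P :=
  ⟨fun l hl => hP.isStarProjection l (hEI hl), fun u v =>
    (hP.measurable u v).comp (measurable_inclusion hEI)⟩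

/-- The field `l ↦ P_l v`, extended by zero outside of `E`. -/
def projectedField (E : Set (Fin r → ℝ)) (P : (Fin r → ℝ) → L2 d →L[ℂ] L2 d) (v : L2 d) :
    (Fin r → ℝ) → L2 d :=
  E.indicator fun l => P l v

theorem projectedField_of_mem {l : Fin r → ℝ} (hl : l ∈ I) (v : L2 d) :
    projectedField I P v l = P l v :=
  Set.indicator_of_mem hl _

theorem projectedField_of_notMem {l : Fin r → ℝ} (hl : l ∉ I) (v : L2 d) :
    projectedField I P v l = 0 :=
  Set.indicator_of_notMem hl _

theorem projectedField_mem_range (v : L2 d) (l : Fin r → ℝ) :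
    projectedField I P v l ∈ Set.range (P l) := by
  by_cases hl : l ∈ I
  · exact ⟨v, (projectedField_of_mem hl v).symm⟩
  · exact ⟨0, by rw [projectedField_of_notMem hl, map_zero]⟩

theorem lintegral_projectedField {μ : Measure (Fin r → ℝ)} (hI : MeasurableSet I)
    {F : (Fin r → ℝ) → L2 d → ℝ≥0∞} (hF : ∀ l, F l 0 = 0) (v : L2 d) :
    ∫⁻ l, F l (projectedField I P v l) ∂μ = ∫⁻ l in I, F l (P l v) ∂μ := by
  rw [← lintegral_indicator hI]
  refine lintegral_congr fun l => ?_
  by_cases hl : l ∈ I <;> simp [projectedField, hl, hF]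

theorem IsProjectionField.measurable_dist_projectedField (hP : IsProjectionField I P)
    (hI : MeasurableSet I) (v w : L2 d) :
    Measurable fun l => dist (projectedField I P v l) w := by
  have hdist (l : I) : dist (projectedField I P v l) w =
      √(RCLike.re (inner ℂ v (P l v)) - 2 * RCLike.re (inner ℂ w (P l v)) + ‖w‖ ^ 2) := by
    rw [projectedField_of_mem l.2,
      ← norm_sq_apply_of_isStarProjection (hP.isStarProjection l l.2) v, ← inner_re_symm,
      ← norm_sub_sq (𝕜 := ℂ), Real.sqrt_sq (norm_nonneg _), dist_eq_norm]
  refine measurable_of_restrict_of_restrict_compl hI ?_ ?_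
  · refine (funext hdist : I.domRestrict (fun l => dist (projectedField I P v l) w) = _) ▸ ?_
    exact (((RCLike.measurable_re.comp (hP.measurable v v)).sub
      ((RCLike.measurable_re.comp (hP.measurable w v)).const_mul 2)).add_const _).sqrt
  · have hzero : Iᶜ.domRestrict (fun l => dist (projectedField I P v l) w) = fun _ => dist 0 w :=
      funext fun l => by rw [Set.domRestrict_apply, projectedField_of_notMem l.2]
    exact hzero ▸ measurable_const

theorem IsProjectionField.exists_stronglyMeasurable (hP : IsProjectionField I P)
    (hI : MeasurableSet I) (v : L2 d) :
    ∃ u : (Fin r → ℝ) × (Fin d → ℝ) → ℂ, StronglyMeasurable u ∧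
      ∀ l, (fun s => u (l, s)) =ᵐ[volume] projectedField I P v l :=
  exists_stronglyMeasurable_prod _ (hP.measurable_dist_projectedField hI v)

variable {e} {K : Submodule ℂ (L2N e)} {φ : L2N e}
  (hK : plancherel e '' (K : Set (L2N e)) = directIntegral e I P)
  (hφ : IsContinuousWavelet e K φ)
include hK hφ

/-- Admissibility, tested on the vector of `K` whose Plancherel transform is `1_C ⊗ T(l)`. -/
theorem IsContinuousWavelet.lintegral_enorm_sq_le {T : (Fin r → ℝ) → L2 d}
    (hT : ∀ l, T l ∈ Set.range (P l)) (hT0 : ∀ l ∉ I, T l = 0)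
    {u : (Fin r → ℝ) × (Fin d → ℝ) → ℂ} (hmeas : StronglyMeasurable u)
    (hu : ∀ l, (fun s => u (l, s)) =ᵐ[volume] T l)
    (hfin : ∫⁻ l, ‖T l‖ₑ ^ 2 ∂plancherelMeasure e < ∞) :
    ∫⁻ l, ‖T l‖ₑ ^ 2 ∂plancherelMeasure e ≤
      ∫⁻ l, (∫⁻ t, ‖∫ s, plancherelIsometry e φ (l, t, s) * T l s‖ₑ ^ 2)
        ∂plancherelMeasure e := by
  have hnorm : ∫⁻ w, ‖cubeTensor u w‖ₑ ^ 2 ∂(plancherelMeasure e).prod volume =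
      ∫⁻ l, ‖T l‖ₑ ^ 2 ∂plancherelMeasure e := by
    rw [lintegral_enorm_sq_cubeTensor e hmeas]
    refine lintegral_congr fun l => ?_
    rw [enorm_Lp_two_sq]
    exact lintegral_congr_ae ((hu l).mono fun s hs => congrArg (‖·‖ₑ ^ 2) hs)
  have hL2 : MemLp (cubeTensor u) 2 ((plancherelMeasure e).prod volume) :=
    (memLp_two_iff_lintegral_enorm_sq_lt_top
      (stronglyMeasurable_cubeTensor hmeas).aestronglyMeasurable).2 (hnorm ▸ hfin)
  obtain ⟨ψ, hψ, hψG⟩ := exists_mem_plancherelIsometry_eq hK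
    (mem_directIntegral_of_ae_eq_cubeTensor hT hT0 hu hL2.coeFn_toLp)
  have hψu : plancherelIsometry e ψ =ᵐ[(plancherelMeasure e).prod volume] cubeTensor u :=
    hψG ▸ hL2.coeFn_toLp
  calc ∫⁻ l, ‖T l‖ₑ ^ 2 ∂plancherelMeasure e
      = ‖ψ‖ₑ ^ 2 := by
        rw [← hnorm, ← (plancherelIsometry e).enorm_map, enorm_Lp_two_sq]
        exact lintegral_congr_ae (hψu.mono fun w hw => congrArg (‖·‖ₑ ^ 2) hw.symm)
    _ = ∫⁻ n, ‖(inner ℂ (leftRegular e n φ) ψ : ℂ)‖ₑ ^ 2 ∂NilGroup.haar e := (hφ.2 ψ hψ).symm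
    _ ≤ ∫⁻ x, ∫⁻ w, ‖coefficientDensity (plancherelIsometry e φ) (plancherelIsometry e ψ) x w‖ₑ ^ 2
          ∂(plancherelMeasure e).prod volume := lintegral_enorm_sq_inner_leftRegular_le e φ ψ
    _ = ∫⁻ x, ∫⁻ w, ‖coefficientDensity (plancherelIsometry e φ) (cubeTensor u) x w‖ₑ ^ 2
          ∂(plancherelMeasure e).prod volume := lintegral_congr fun x => lintegral_congr_ae
        ((coefficientDensity_ae_eq hψu x).mono fun w hw => congrArg (‖·‖ₑ ^ 2) hw)
    _ = ∫⁻ l, (∫⁻ t, ‖∫ s, plancherelIsometry e φ (l, t, s) * u (l, s)‖ₑ ^ 2)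
          ∂plancherelMeasure e :=
        lintegral_enorm_sq_coefficientDensity_cubeTensor e (Lp.stronglyMeasurable _) hmeas
    _ = _ := lintegral_congr fun l => lintegral_congr fun t => congrArg (‖·‖ₑ ^ 2)
        (integral_congr_ae ((hu l).mono fun s hs => congrArg (_ * ·) hs))

variable (hP : IsProjectionField I P)
include hP

theorem setLIntegral_enorm_sq_projection_le {E : Set (Fin r → ℝ)} (hE : MeasurableSet E)
    (hEI : E ⊆ I) (hfin : plancherelMeasure e E < ∞) (v : L2 d) :
    ∫⁻ l in E, ‖P l v‖ₑ ^ 2 ∂plancherelMeasure e ≤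
      ∫⁻ l in E, (∫⁻ t, ‖∫ s, plancherelIsometry e φ (l, t, s) * P l v s‖ₑ ^ 2)
        ∂plancherelMeasure e := by
  obtain ⟨u, hmeas, hu⟩ := (hP.mono hEI).exists_stronglyMeasurable hE v
  have hnorm : ∫⁻ l, ‖projectedField E P v l‖ₑ ^ 2 ∂plancherelMeasure e =
      ∫⁻ l in E, ‖P l v‖ₑ ^ 2 ∂plancherelMeasure e :=
    lintegral_projectedField hE (F := fun _ w => ‖w‖ₑ ^ 2) (fun _ => by simp) v
  have hbound : ∫⁻ l in E, ‖P l v‖ₑ ^ 2 ∂plancherelMeasure e < ∞ :=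
    (setLIntegral_mono measurable_const fun l hl => ENNReal.pow_le_pow_left
      (enorm_le_iff_norm_le.2 (norm_apply_le_of_isStarProjection
        (hP.isStarProjection l (hEI hl)) v))).trans_lt (by
      rw [setLIntegral_const]
      exact ENNReal.mul_lt_top (ENNReal.pow_lt_top enorm_lt_top) hfin)
  rw [← hnorm] at hbound ⊢
  refine (hφ.lintegral_enorm_sq_le hK (projectedField_mem_range v)
    (fun l hl => projectedField_of_notMem (fun hlE => hl (hEI hlE)) v) hmeas hu hbound).trans_eq ?_
  exact lintegral_projectedField hE (F := fun l w =>
    ∫⁻ t, ‖∫ s, plancherelIsometry e φ (l, t, s) * w s‖ₑ ^ 2) (fun l => by simp) v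

theorem ae_enorm_sq_projection_le (hI : MeasurableSet I) (v : L2 d) :
    ∀ᵐ l ∂(plancherelMeasure e).restrict I,
      ‖P l v‖ₑ ^ 2 ≤ ∫⁻ t, ‖∫ s, plancherelIsometry e φ (l, t, s) * P l v s‖ₑ ^ 2 := by
  have hmeas : Measurable fun l => ‖projectedField I P v l‖ₑ ^ 2 := by
    have hdist := hP.measurable_dist_projectedField hI v 0
    simp only [dist_zero_right] at hdist
    simpa only [ofReal_norm] using hdist.ennreal_ofReal.pow_const 2
  have hle := ae_le_of_forall_setLIntegral_le_of_sigmaFinite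
    (μ := (plancherelMeasure e).restrict I) (g := fun l =>
      ∫⁻ t, ‖∫ s, plancherelIsometry e φ (l, t, s) * P l v s‖ₑ ^ 2) hmeas fun s hs hfin => by
    rw [Measure.restrict_apply hs] at hfin
    rw [Measure.restrict_restrict hs, setLIntegral_congr_fun (hs.inter hI) fun l hl => by
      rw [projectedField_of_mem hl.2]]
    exact setLIntegral_enorm_sq_projection_le hK hφ hP (hs.inter hI) Set.inter_subset_right hfin v
  filter_upwards [hle, ae_restrict_mem hI] with l hl hlI
  rwa [projectedField_of_mem hlI] at hl

theorem ae_multiplicity_le_fiberNormSq (hI : MeasurableSet I) :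
    ∀ᵐ l ∂(plancherelMeasure e).restrict I,
      ((multiplicity P l : ℕ∞) : ℝ≥0∞) ≤ fiberNormSq e (plancherelIsometry e φ) l := by
  have hkernel : ∀ᵐ l ∂(plancherelMeasure e).restrict I,
      MemLp (fun p => plancherelIsometry e φ (l, p)) 2 (volume.prod volume) :=
    ae_restrict_of_ae (ae_memLp_two_prodMk (Lp.memLp _))
  have hdense := ae_all_iff.2 fun n => ae_enorm_sq_projection_le hK hφ hP hI
    (TopologicalSpace.denseSeq (L2 d) n)
  filter_upwards [hkernel, hdense] with l hl hn
  refine rank_le_lintegral_of_norm_le_kernelOperator hl ?_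
  rintro _ ⟨v, rfl⟩
  refine (TopologicalSpace.denseRange_denseSeq (L2 d)).induction_on
    (p := fun v => ‖P l v‖ ≤ ‖kernelOperator hl (P l v)‖) v
    (isClosed_le (by fun_prop) (by fun_prop)) fun n => ?_
  have hsq := hn n
  rw [← enorm_sq_kernelOperator hl] at hsq
  exact enorm_le_iff_norm_le.1 ((ENNReal.pow_le_pow_left_iff two_ne_zero).1 hsq)

end Multiplicity

section Conclusion

variable {e} {I : Set (Fin r → ℝ)} {P : (Fin r → ℝ) → L2 d →L[ℂ] L2 d}

theorem ae_fiberNormSq_eq_zero_of_notMem {G : L2Dual e} (hG : G ∈ directIntegral e I P) :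
    ∀ᵐ l ∂plancherelMeasure e, l ∉ I → fiberNormSq e G l = 0 := by
  filter_upwards [hG] with l hl hlI
  have hmeas : StronglyMeasurable fun p => G (l, p) :=
    (Lp.stronglyMeasurable G).comp_measurable measurable_prodMk_left
  have hzero : (fun p => G (l, p)) =ᵐ[volume.prod volume] 0 :=
    ae_eq_prod_of_ae_ae_eq hmeas.aestronglyMeasurable aestronglyMeasurable_zero (hl.2 hlI)
  exact lintegral_eq_zero_of_ae_eq_zero (hzero.mono fun p hp => by simp [hp])

variable {K : Submodule ℂ (L2N e)} {φ : L2N e} {a : Fin r → ℝ} {q b : Fin d → ℝ}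
  (hK : plancherel e '' (K : Set (L2N e)) = directIntegral e I P)
  (hφ : IsContinuousWavelet e K φ)
  (ha : ∀ j, 0 < a j) (hq : ∀ j, 0 < q j) (hb : ∀ j, 0 < b j)
  (hframe : IsParsevalFrame K (fun γ : quasiLattice e a q b => leftRegular e γ.1 φ))
include hK hφ ha hq hb hframe

theorem ae_multiplicity_le (hI : MeasurableSet I) (hP : IsProjectionField I P) :
    ∀ᵐ l ∂volume.restrict I, ((multiplicity P l : ℕ∞) : ℝ≥0∞) ≤
      ENNReal.ofReal (1 / ((∏ j, a j) * |(e.B l).det|)) := by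
  filter_upwards [((volume_absolutelyContinuous_plancherelMeasure e).restrict I).ae_le
      (ae_multiplicity_le_fiberNormSq hK hφ hP hI),
    ae_restrict_of_ae (ae_fiberWeight_le hK hφ.1 ha hq hb hframe),
    ae_restrict_of_ae (ae_det_B_ne_zero e)] with l hmult hweight hdet
  have hpos : 0 < |(e.B l).det| := abs_pos.2 hdet
  refine hmult.trans ?_
  rwa [one_div, mul_inv, ← div_eq_mul_inv, ENNReal.ofReal_div_of_pos hpos,
    ENNReal.le_div_iff_mul_le (Or.inl (ENNReal.ofReal_pos.2 hpos).ne')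
      (Or.inl ENNReal.ofReal_ne_top), mul_comm]

theorem enorm_sq_le_setLIntegral_inv_prod (hI : MeasurableSet I) :
    ‖φ‖ₑ ^ 2 ≤ ∫⁻ _ in I, ENNReal.ofReal (∏ j, a j)⁻¹ := by
  have hle : ∀ᵐ l, fiberWeight e (plancherelIsometry e φ) l ≤
      I.indicator (fun _ => ENNReal.ofReal (∏ j, a j)⁻¹) l := by
    filter_upwards [ae_fiberWeight_le hK hφ.1 ha hq hb hframe,
      (volume_absolutelyContinuous_plancherelMeasure e).ae_le
        (ae_fiberNormSq_eq_zero_of_notMem ((mem_iff_plancherelIsometry_mem hK φ).1 hφ.1))]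
      with l hweight hzero
    by_cases hl : l ∈ I
    · rwa [Set.indicator_of_mem hl]
    · rw [fiberWeight, hzero hl, mul_zero]
      exact zero_le
  calc ‖φ‖ₑ ^ 2 = ∫⁻ l, fiberWeight e (plancherelIsometry e φ) l := by
        rw [← (plancherelIsometry e).enorm_map, enorm_sq_eq_lintegral_fiberWeight]
    _ ≤ ∫⁻ l, I.indicator (fun _ => ENNReal.ofReal (∏ j, a j)⁻¹) l := lintegral_mono_ae hle
    _ = ∫⁻ _ in I, ENNReal.ofReal (∏ j, a j)⁻¹ := lintegral_indicator hI _

theorem prod_mul_prod_eq_inv_prod (hφ0 : φ ≠ 0) :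
    (∏ j, b j) * ∏ j, q j = (∏ j, a j)⁻¹ := by
  have hcovolume : ENNReal.ofReal ((∏ j, a j)⁻¹ * ((∏ j, q j)⁻¹ * (∏ j, b j)⁻¹)) = 1 := by
    have hnorm := (hφ.2 φ hφ.1).symm.trans
      (lintegral_enorm_sq_inner_leftRegular ha hq hb hframe (fun g _ => leftRegular_mem hK g) hφ.1)
    refine (ENNReal.mul_right_inj ?_ (ENNReal.pow_ne_top enorm_ne_top)).1
      (hnorm.symm.trans (mul_one _).symm)
    exact pow_ne_zero 2 (enorm_ne_zero.2 hφ0)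
  have hA : ∏ j, a j ≠ 0 := Finset.prod_ne_zero_iff.2 fun j _ => (ha j).ne'
  have hQ : ∏ j, q j ≠ 0 := Finset.prod_ne_zero_iff.2 fun j _ => (hq j).ne'
  have hB : ∏ j, b j ≠ 0 := Finset.prod_ne_zero_iff.2 fun j _ => (hb j).ne'
  rw [ENNReal.ofReal_eq_one] at hcovolume
  field_simp at hcovolume ⊢
  linarith

theorem enorm_sq_le_setLIntegral (hI : MeasurableSet I) :
    ‖φ‖ₑ ^ 2 ≤ ∫⁻ _ in I, ENNReal.ofReal ((∏ j, b j) * ∏ j, q j) := by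
  rcases eq_or_ne φ 0 with rfl | hφ0
  · simp
  · rw [prod_mul_prod_eq_inv_prod hK hφ ha hq hb hframe hφ0]
    exact enorm_sq_le_setLIntegral_inv_prod hK hφ ha hq hb hframe hI

end Conclusion

end TwoStep

end

theorem mainTheorem6_general {𝔫 : Type*} [LieRing 𝔫] [LieAlgebra ℝ 𝔫] {r d : ℕ}
    (e : TwoStep.AdaptedBasis 𝔫 r d)
    (a : Fin r → ℝ) (q b : Fin d → ℝ) (ha : ∀ j, 0 < a j) (hq : ∀ j, 0 < q j) (hb : ∀ j, 0 < b j)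
    (I : Set (Fin r → ℝ)) (hImeas : MeasurableSet I)
    (P : (Fin r → ℝ) → TwoStep.L2 d →L[ℂ] TwoStep.L2 d) (hP : TwoStep.IsProjectionField I P)
    (K : Submodule ℂ (TwoStep.L2N e))
    (hK : TwoStep.plancherel e '' (K : Set (TwoStep.L2N e)) = TwoStep.directIntegral e I P)
    (φ : TwoStep.L2N e) (hφ : TwoStep.IsContinuousWavelet e K φ)
    (hframe : TwoStep.IsParsevalFrame K
      (fun γ : TwoStep.quasiLattice e a q b => TwoStep.leftRegular e (γ : TwoStep.NilGroup e) φ)) :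
    (∀ᵐ l ∂(volume.restrict I),
      ((TwoStep.multiplicity P l : ℕ∞) : ℝ≥0∞) ≤
        ENNReal.ofReal (1 / ((∏ j, a j) * |(e.B l).det|))) ∧
    ‖φ‖ₑ ^ 2 ≤ ∫⁻ _ in I, ENNReal.ofReal ((∏ j, b j) * (∏ j, q j)) :=
  ⟨TwoStep.ae_multiplicity_le hK hφ ha hq hb hframe hImeas hP,
    TwoStep.enorm_sq_le_setLIntegral hK hφ ha hq hb hframe hImeas⟩

theorem mainTheorem6 {𝔫 : Type*} [LieRing 𝔫] [LieAlgebra ℝ 𝔫] {r d : ℕ} (hd : 0 < d)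
    (e : TwoStep.AdaptedBasis 𝔫 r d)
    (a : Fin r → ℝ) (q b : Fin d → ℝ) (ha : ∀ j, 0 < a j) (hq : ∀ j, 0 < q j) (hb : ∀ j, 0 < b j)
    (I : Set (Fin r → ℝ)) (hImeas : MeasurableSet I) (hIbdd : Bornology.IsBounded I)
    (hI : I ⊆ e.crossSection)
    (P : (Fin r → ℝ) → TwoStep.L2 d →L[ℂ] TwoStep.L2 d) (hP : TwoStep.IsProjectionField I P)
    (K : Submodule ℂ (TwoStep.L2N e))
    (hK : TwoStep.plancherel e '' (K : Set (TwoStep.L2N e)) = TwoStep.directIntegral e I P)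
    (φ : TwoStep.L2N e) (hφ : TwoStep.IsContinuousWavelet e K φ)
    (hframe : TwoStep.IsParsevalFrame K
      (fun γ : TwoStep.quasiLattice e a q b => TwoStep.leftRegular e (γ : TwoStep.NilGroup e) φ)) :
    (∀ᵐ l ∂(volume.restrict I),
      ((TwoStep.multiplicity P l : ℕ∞) : ℝ≥0∞) ≤
        ENNReal.ofReal (1 / ((∏ j, a j) * |(e.B l).det|))) ∧
    ‖φ‖ ^ 2 ≤ ∫ _ in I, (∏ j, b j) * (∏ j, q j) :=
  (mainTheorem6_general e a q b ha hq hb I hImeas P hP K hK φ hφ hframe).imp_right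
    (TwoStep.norm_sq_le_setIntegral_of_enorm_sq_le_setLIntegral
      (integrableOn_const hIbdd.measure_lt_top.ne) (ae_of_all _ fun _ => mul_nonneg
        (Finset.prod_nonneg fun j _ => (hb j).le) (Finset.prod_nonneg fun j _ => (hq j).le)))
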